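/- Write $\mathbb C^\times=\mathbb C\setminus\{0\}$ and, for $n\ge 1$, $D_n=\{(z_1,\dots,z_n)\in(\mathbb C^\times)^n : z_{k+1}/z_k\notin(0,\infty)\text{ for }1\le k<n\}$. **The functions $F_n$.** Consider families of functions $F_n:(\mathbb C^\times)^n\to\mathbb C$, $n\ge1$, with the following properties. (i) $F_1\equiv(2\pi i)^{-1}$; each $F_n$ is holomorphic on $D_n$; for $n\ge2$, $F_n=0$ at the points of $D_n$ with $z_1+\cdots+z_n=0$; and at all points of $D_n$ where no denominator vanishes $$dF_n(z_1,\dots,z_n)=\sum_{k=1}^{n-1}F_k(z_1,\dots,z_k)F_{n-k}(z_{k+1},\dots,z_n)\left[\frac{dz_{k+1}+\cdots+dz_n}{z_{k+1}+\cdots+z_n}-\frac{dz_1+\cdots+dz_k}{z_1+\cdots+z_k}\right].$$ (ii) Every $\tilde z=(\tilde z_1,\dots,\tilde z_n)\in(\mathbb C^\times)^n$ has an open neighbourhood $N_{\tilde z}\subseteq(\mathbb C^\times)^n$, on which $\operatorname{Re}(z_k/\tilde z_k)>0$ for all $k$, and there are functions $G_m(\,\cdot\,;\,\cdot\,)$,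 $m\ge1$, such that for all $z\in N_{\tilde z}$ $$F_n(z)=\sum G_m\bigl(z_{a_0+1}+\cdots+z_{a_1},\dots,z_{a_{m-1}+1}+\cdots+z_{a_m};\ \tilde z_{a_0+1}+\cdots+\tilde z_{a_1},\dots,\tilde z_{a_{m-1}+1}+\cdots+\tilde z_{a_m}\bigr)\prod_{k=1}^m W_k .$$ The sum is over $1\le m\le n$ and $0=a_0<a_1<\cdots<a_m=n$ such that for each $k$ all $\tilde z_a$ with $a_{k-1}<a\le a_k$ lie on one ray $e^{ic_k}(0,\infty)$, $c_k\in[0,2\pi)$. Here $W_k$ is the sum of $\frac{(-1)^{l-1}}{l}\prod_{c=1}^{p}\frac1{|\psi^{-1}(c)|!}$ over $1\le l\le p\le a_k-a_{k-1}$ and weakly increasing surjections $\psi:\{a_{k-1}+1,\dots,a_k\}\to\{1,\dots,p\}$, $\xi:\{1,\dots,p\}\to\{1,\dots,l\}$ such that $\psi(a)=\psi(b)$ implies $\arg z_a=\arg z_b$, and $\psi(a)<\psi(b)$, $\xi(\psi(a))=\xi(\psi(b))$ imply $\arg z_a>\arg z_b$, with arguments taken in $(c_k-\frac\pi2,c_k+\frac\pi2)$.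 For each fixed second argument, $G_m$ is holomorphic in its first argument on the set of points where these formulas evaluate it. **Theorem.** A family with properties (i) and (ii) exists. For every such family $(F_n)$ the following hold. (a) Let $n\ge1$, let $A_n$ be the free associative unital $\mathbb C$-algebra on $e_1,\dots,e_n$ with product $*$, and let $L_n\subseteq A_n$ be the Lie subalgebra generated by $e_1,\dots,e_n$ under $[f,g]=f*g-g*f$. For every $(z_1,\dots,z_n)\in(\mathbb C^\times)^n$, $$\sum_{\sigma\in S_n}F_n(z_{\sigma(1)},\dots,z_{\sigma(n)})\,e_{\sigma(1)}*\cdots*e_{\sigma(n)}\in L_n .$$ (b) For all $n>1$ and $(z_1,\dots,z_n)\in(\mathbb C^\times)^n$, $\ \sum_{\sigma\in S_n}F_n(z_{\sigma(1)},\dots,z_{\sigma(n)})=0$. (c) Let $\mathcal A$ be an abelian category, $K(\mathcal A)$ a quotient of its Grothendieck group in which only zero objects have class $0$, and $C(\mathcal A)\subset K(\mathcal A)$ the set of classes of nonzero objects. Suppose each $\alpha\in C(\mathcal A)$ can be written as $\beta+\gamma$ with $\beta,\gamma\in C(\mathcal A)$ in only finitely many ways. Let $\mathcal H=\bigoplus_{\alpha\in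 C(\mathcal A)\cup\{0\}}\mathcal H^\alpha$ be a graded unital associative $\mathbb C$-algebra with product $*$, and $\mathcal L=\bigoplus_{\alpha\in C(\mathcal A)}\mathcal L^\alpha$ a graded Lie subalgebra of $\mathcal H$ under the commutator, with $\mathcal L^\alpha\subseteq\mathcal H^\alpha$. Let $\mathrm{Stab}$ be any set of homomorphisms $Z:K(\mathcal A)\to\mathbb C$ with $\operatorname{Im}Z(\alpha)>0$ for all $\alpha\in C(\mathcal A)$ (for instance those whose stability condition is permissible), and for $Z\in\mathrm{Stab}$, $\alpha\in C(\mathcal A)$ let $\epsilon^\alpha(Z)\in\mathcal L^\alpha$ be given (for instance the invariants counting semistable objects). Then for $Z\in\mathrm{Stab}$, $n\ge 1$ and $\beta_1,\dots,\beta_n\in C(\mathcal A)$, $$\sum_{\sigma\in S_n}F_n\bigl(Z(\beta_{\sigma(1)}),\dots,Z(\beta_{\sigma(n)})\bigr)\,\epsilon^{\beta_{\sigma(1)}}(Z)*\cdots*\epsilon^{\beta_{\sigma(n)}}(Z)$$ lies in the Lie subalgebra of $\mathcal H$ generated by $\epsilon^{\beta_1}(Z),\dots,\epsilon^{\beta_n}(Z)$;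 and for each $\alpha\in C(\mathcal A)$ the sum $$f^\alpha(Z)=\sum_{\substack{n\ge1,\ \alpha_1,\dots,\alpha_n\in C(\mathcal A):\\ \alpha_1+\cdots+\alpha_n=\alpha}}F_n\bigl(Z(\alpha_1),\dots,Z(\alpha_n)\bigr)\,\epsilon^{\alpha_1}(Z)*\cdots*\epsilon^{\alpha_n}(Z)$$ has finitely many terms, and $f^\alpha$ maps $\mathrm{Stab}$ to $\mathcal L^\alpha$. -/

import Mathlib

open CategoryTheory

universe u v w x

attribute [local instance] LieRing.ofAssociativeRing

/-! ### The functions `F_n`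

A family `F_n : (ℂ \ {0})^n → ℂ`, `n ≥ 1`, is represented by a term
`F : (n : ℕ) → (Fin n → ℂ) → ℂ`; only its values at tuples of nonzero complex numbers with
`1 ≤ n` ever matter. Indices start at `0` instead of `1`. -/

/-- The block `(z_{a+1}, …, z_{a+m})` of `(z_1, …, z_n)`; it is only used for `a + m ≤ n`. -/
def tupleSlice {n : ℕ} (z : Fin n → ℂ) (a m : ℕ) : Fin m → ℂ :=
  fun i => if h : a + (i : ℕ) < n then z ⟨a + i, h⟩ else 0

/-- The set of `(z_1, …, z_n)` in `(ℂ \ {0})^n` such that `z_{k+1} / z_k` is not a positive real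
number for `1 ≤ k < n`. -/
def slitDomain (n : ℕ) : Set (Fin n → ℂ) :=
  {z | (∀ k, z k ≠ 0) ∧
    ∀ (k : ℕ) (hk : k + 1 < n),
      ¬ ∃ r : ℝ, 0 < r ∧ z ⟨k + 1, hk⟩ / z ⟨k, Nat.lt_of_succ_lt hk⟩ = (r : ℂ)}

/-- The partial differential equation
`dF_n = ∑_{k=1}^{n-1} F_k(z_1,…,z_k) F_{n-k}(z_{k+1},…,z_n)
  [(dz_{k+1}+⋯+dz_n)/(z_{k+1}+⋯+z_n) - (dz_1+⋯+dz_k)/(z_1+⋯+z_k)]`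
on `slitDomain n`, at the points where no denominator vanishes (both sides are evaluated on an
arbitrary tangent vector `v`). -/
def SatisfiesPDE (F : (n : ℕ) → (Fin n → ℂ) → ℂ) (n : ℕ) : Prop :=
  ∀ z ∈ slitDomain n,
    (∀ k ∈ Finset.Ico 1 n, ∑ i, tupleSlice z 0 k i ≠ 0 ∧ ∑ i, tupleSlice z k (n - k) i ≠ 0) →
    ∀ v : Fin n → ℂ,
      fderiv ℂ (F n) z v =
        ∑ k ∈ Finset.Ico 1 n,
          F k (tupleSlice z 0 k) * F (n - k) (tupleSlice z k (n - k)) *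
            ((∑ i, tupleSlice v k (n - k) i) / (∑ i, tupleSlice z k (n - k) i) -
              (∑ i, tupleSlice v 0 k i) / (∑ i, tupleSlice z 0 k i))

/-- A choice `0 = a_0 < a_1 < ⋯ < a_m = n` is a composition `c` of `n`; the `k`-th block is
`{a_{k-1}+1, …, a_k}`. This is the restriction of `z` to the `k`-th block. -/
def blockPart {n : ℕ} (c : Composition n) (z : Fin n → ℂ) (k : Fin c.length) :
    Fin (c.blocksFun k) → ℂ :=
  fun j => z (c.embedding k j)

/-- The tuple of block sums `(z_{a_0+1}+⋯+z_{a_1}, …, z_{a_{m-1}+1}+⋯+z_{a_m})`. -/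
def blockSum {n : ℕ} (c : Composition n) (z : Fin n → ℂ) : Fin c.length → ℂ :=
  fun k => ∑ j, blockPart c z k j

/-- Within every block of `c`, all the `z_a` lie on one and the same ray `e^{iθ}(0,∞)` with
`θ ∈ [0,2π)`. -/
def RayBlocks {n : ℕ} (c : Composition n) (z : Fin n → ℂ) : Prop :=
  ∀ k : Fin c.length, ∃ θ : ℝ, 0 ≤ θ ∧ θ < 2 * Real.pi ∧
    ∀ j, ∃ r : ℝ, 0 < r ∧ blockPart c z k j = (r : ℂ) * Complex.exp (θ * Complex.I)

open Classical in
/-- The combinatorial coefficient attached to one block `(z_1, …, z_r)`, where the reference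
points `w_1, …, w_r` lie on one ray `e^{iθ}(0,∞)` and `Re (z_a / w_a) > 0`: the sum of
`(-1)^{l-1}/l · ∏_{c=1}^m 1/|ψ⁻¹(c)|!` over `1 ≤ l ≤ m ≤ r` and over monotone surjections
`ψ : {1,…,r} → {1,…,m}` and `ξ : {1,…,m} → {1,…,l}` such that
`ψ(a) = ψ(b)` implies `arg z_a = arg z_b`, and
`ψ(a) < ψ(b)`, `ξ(ψ(a)) = ξ(ψ(b))` imply `arg z_a > arg z_b`.
The arguments are those in `(θ - π/2, θ + π/2)`, so that
`arg z_a = θ + Complex.arg (z_a / w_a)`; the common constant `θ` is dropped. -/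
noncomputable def blockWeight {r : ℕ} (z w : Fin r → ℂ) : ℂ :=
  ∑ m ∈ Finset.Icc 1 r, ∑ l ∈ Finset.Icc 1 m,
    ∑ ψ : Fin r → Fin m, ∑ ξ : Fin m → Fin l,
      if Monotone ψ ∧ Function.Surjective ψ ∧ Monotone ξ ∧ Function.Surjective ξ ∧
          (∀ a b, ψ a = ψ b → Complex.arg (z a / w a) = Complex.arg (z b / w b)) ∧
          (∀ a b, ψ a < ψ b → ξ (ψ a) = ξ (ψ b) →
            Complex.arg (z b / w b) < Complex.arg (z a / w a))
      then (-1 : ℂ) ^ (l - 1) / (l : ℂ) *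
          ∏ c : Fin m, (1 : ℂ) / ((Finset.univ.filter fun a => ψ a = c).card.factorial : ℂ)
      else 0

open Classical in
/-- The wall-crossing condition (the condition for generating functions built from the `F_n` to
be continuous and holomorphic): every `w ∈ (ℂ \ {0})^n` has an open neighbourhood `N n w` in
`(ℂ \ {0})^n`, with `Re (z_k / w_k) > 0` for all `z ∈ N n w`, on which `F_n` is the indicated
combination of values of functions `G_m( · ; · )`; and each `G_m( · ; u)` is holomorphic (in
particular continuous) on the set of all points at which these formulas evaluate it. -/
def WallCrossing (F : (n : ℕ) → (Fin n → ℂ) → ℂ) : Prop :=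
  ∃ (N : (n : ℕ) → (Fin n → ℂ) → Set (Fin n → ℂ))
    (G : (n : ℕ) → (Fin n → ℂ) → (Fin n → ℂ) → ℂ),
    (∀ n, 1 ≤ n → ∀ w : Fin n → ℂ, (∀ k, w k ≠ 0) →
      IsOpen (N n w) ∧ w ∈ N n w ∧
      ∀ z ∈ N n w, (∀ k, 0 < (z k / w k).re) ∧
        F n z = ∑ c : Composition n,
          if RayBlocks c w then
            G c.length (blockSum c z) (blockSum c w) *
              ∏ k, blockWeight (blockPart c z k) (blockPart c w k)
          else 0) ∧
    ∀ m, 1 ≤ m → ∀ u : Fin m → ℂ, (∀ k, u k ≠ 0) →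
      DifferentiableOn ℂ (fun y => G m y u)
        {y | ∃ (n : ℕ) (w z : Fin n → ℂ) (c : Composition n) (hc : c.length = m),
          1 ≤ n ∧ (∀ k, w k ≠ 0) ∧ z ∈ N n w ∧ RayBlocks c w ∧
          (∀ k, blockSum c z k = y (Fin.cast hc k)) ∧
          (∀ k, blockSum c w k = u (Fin.cast hc k))}

/-- The defining properties of the family `F_n`: `F_1 ≡ 1/(2πi)`; each `F_n` is holomorphic on
`slitDomain n`, satisfies the partial differential equation there, and vanishes at the points of
`slitDomain n` with `z_1 + ⋯ + z_n = 0` (`n ≥ 2`); and the wall-crossing condition holds on all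
of `(ℂ \ {0})^n`. -/
structure IsJoyceFamily (F : (n : ℕ) → (Fin n → ℂ) → ℂ) : Prop where
  one : ∀ z : Fin 1 → ℂ, z 0 ≠ 0 → F 1 z = (2 * (Real.pi : ℂ) * Complex.I)⁻¹
  holomorphic : ∀ n, 1 ≤ n → DifferentiableOn ℂ (F n) (slitDomain n)
  pde : ∀ n, 1 ≤ n → SatisfiesPDE F n
  vanishing : ∀ n, 2 ≤ n → ∀ z ∈ slitDomain n, ∑ k, z k = 0 → F n z = 0
  wallCrossing : WallCrossing F

/-! ### Symmetrised products -/

/-- `∑_{σ ∈ S_n} F_n(z_{σ(1)},…,z_{σ(n)}) x_{σ(1)} * ⋯ * x_{σ(n)}` in an associative algebra. -/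
noncomputable def symmetrizedProduct (F : (n : ℕ) → (Fin n → ℂ) → ℂ) {H : Type*} [Ring H]
    [Algebra ℂ H] {n : ℕ} (z : Fin n → ℂ) (x : Fin n → H) : H :=
  ∑ σ : Equiv.Perm (Fin n), F n (fun i => z (σ i)) • (List.ofFn fun i => x (σ i)).prod

/-! ### The categorical and algebraic setting -/

/-- `K` is a quotient of the Grothendieck group of the abelian category `A` in which only zero
objects have class zero: `cls U` is the class `[U]`, classes are additive on short exact
sequences, and they generate `K`. -/
structure GrothendieckQuotient (A : Type*) [Category A] [Abelian A] (K : Type*)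
    [AddCommGroup K] where
  cls : A → K
  additive : ∀ S : ShortComplex A, S.ShortExact → cls S.X₂ = cls S.X₁ + cls S.X₃
  generates : AddSubgroup.closure (Set.range cls) = ⊤
  isZero_of_cls_eq_zero : ∀ U : A, cls U = 0 → Limits.IsZero U

/-- The positive cone `C(A) ⊆ K(A)`: the classes of nonzero objects. -/
def GrothendieckQuotient.positiveCone {A : Type*} [Category A] [Abelian A] {K : Type*}
    [AddCommGroup K] (κ : GrothendieckQuotient A K) : Set K :=
  {α | ∃ U : A, ¬ Limits.IsZero U ∧ κ.cls U = α}

/-- The central charges of `A`: homomorphisms `Z : K(A) → ℂ` mapping the positive cone to the open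
upper half plane. -/
def GrothendieckQuotient.centralCharges {A : Type*} [Category A] [Abelian A] {K : Type*}
    [AddCommGroup K] (κ : GrothendieckQuotient A K) : Set (K →+ ℂ) :=
  {Z | ∀ α ∈ κ.positiveCone, 0 < (Z α).im}

/-- A grading of the associative algebra `H` by `C ∪ {0}`, `H = ⨁ H^α`, together with a Lie
subalgebra `L` of `H` (for the commutator bracket) graded by `C`, `L = ⨁ L^α`, with
`L^α ⊆ H^α`. The values of `part` outside `C ∪ {0}` and of `liePart` outside `C` are irrelevant;
`⨁ L^α` is direct because `⨁ H^α` is. -/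
structure GradedLiePair {K : Type*} [AddCommGroup K] (C : Set K) (H : Type*) [Ring H]
    [Algebra ℂ H] where
  part : K → Submodule ℂ H
  part_independent : iSupIndep fun α : ↥(insert 0 C) => part α
  part_iSup : ⨆ α : ↥(insert 0 C), part α = ⊤
  one_mem : (1 : H) ∈ part 0
  mul_mem : ∀ α ∈ insert 0 C, ∀ β ∈ insert 0 C, ∀ x ∈ part α, ∀ y ∈ part β,
    x * y ∈ part (α + β)
  lie : LieSubalgebra ℂ H
  liePart : K → Submodule ℂ H
  liePart_iSup : ⨆ α : ↥C, liePart α = lie.toSubmodule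
  liePart_le : ∀ α ∈ C, liePart α ≤ part α
  bracket_mem : ∀ α ∈ C, ∀ β ∈ C, ∀ x ∈ liePart α, ∀ y ∈ liePart β,
    x * y - y * x ∈ liePart (α + β)

/-- The tuples `(α_1, …, α_n)`, `n ≥ 1`, of elements of `C` with `α_1 + ⋯ + α_n = α`. -/
def decompositions {K : Type*} [AddCommGroup K] (C : Set K) (α : K) : Set (Σ n, Fin n → K) :=
  {p | 1 ≤ p.1 ∧ (∀ i, p.2 i ∈ C) ∧ ∑ i, p.2 i = α}

/-- The generating function
`f^α(Z) = ∑ F_n(Z(α_1),…,Z(α_n)) ε^{α_1} * ⋯ * ε^{α_n}`, the sum being over all `n ≥ 1` and all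
`α_1, …, α_n` in `C` with `α_1 + ⋯ + α_n = α`; here `ε^β` depends on `Z` and is written
`ε Z β`. -/
noncomputable def generatingFunction (F : (n : ℕ) → (Fin n → ℂ) → ℂ) {K : Type*}
    [AddCommGroup K] (C : Set K) {H : Type*} [Ring H] [Algebra ℂ H] (ε : (K →+ ℂ) → K → H)
    (α : K) (Z : K →+ ℂ) : H :=
  ∑ᶠ p ∈ decompositions C α,
    F p.1 (fun i => Z (p.2 i)) • (List.ofFn fun i => ε Z (p.2 i)).prod

/-! The family is built from iterated Cauchy integrals. For slopes `a`, integrate e^{-∑ z_i u_i} ∏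
1/(u_k - u_{k+1}) over the rays u_i ∈ a_i(0,∞) (`chainIntegral`), and multiply by (2πi)^{-n} ∑ z_i
(`chainValue`). The integral converges if Re(z_i a_i) > 0 and no two consecutive slopes share a ray,
and it does not change when the slopes are deformed under these conditions
(`chainIntegral_eq_of_isPreconnected`). On the slit domain the slopes a_i = 1/z_i are allowed, and
they give F_n. A derivative along v brings down -∑ v_i u_i. If ∑ v_i = 0, summation by parts turns
this into differences u_k - u_{k+1}; each of them cancels one kernel factor and splits the integral
into a product. Homogeneity of degree -1 supplies the remaining direction, and the differential
equation follows (`sum_mul_chainIntegral_deriv`). The factor ∑ z_i gives the vanishing condition.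

If consecutive z_k share a ray, the contours are separated by small phases, and the value depends on
the order of these phases. Exchanging two neighbouring contours produces a residue in which the two
variables merge (`phaseLimit_insertNth`). By iteration, any order is expressed through the ascending
one, as a sum over cuttings into blocks with descending phases (`listPhaseLimit_eq_sum`). F_n is the
average over all n! orders; equivalently, it is the ascending values composed with the weights
1/|block|! (`joyceF_eq_average`). Sums over cuttings compose associatively (`mouldComp_assoc`). Near
a base point w, the phases natural for z are ordered by arg(z/w), which gives F = asc ∘ desc ∘
equal. As the coefficients of exp and log are inverse to each other, this is (asc ∘ exp) ∘ (log ∘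
desc ∘ equal). The first factor is G, and the second consists of the weights W
(`joyceF_eq_mouldComp`, `weightMould_ofFn`).

For a fixed order of the phases each contour belongs to an index and not to a position. The
symmetrised sum can therefore be taken under one integral, where it becomes ∑_σ ∏ 1/(u_{σ(k)} -
u_{σ(k+1)}) x_{σ(1)}⋯x_{σ(n)}. By partial fractions, removing one letter b replaces some x_i by
[x_i, x_b]/(u_i - u_b) (`kernelProduct_cons`); by induction the sum is a Lie polynomial with scalar
coefficients. Integration and averaging preserve the subspace (`symmetrizedProduct_joyceF_mem`). In
a commutative algebra the commutators vanish, which gives (b); grouping the generating function by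
permutations gives (c).

Finally, the conditions determine the family (`IsJoyceFamily.eq`). If two families agree for fewer
variables, the wall-crossing condition makes the difference of the F_n equal, near each point, to
the difference of the holomorphic G_n. The differential equation makes its derivative zero on a
dense set, so it is constant on the connected space of nonzero tuples. It vanishes at a slit point
of sum zero. Hence every statement only has to be proved for `joyceF`. -/

/-! ### The exponential integral and its logarithmic branches -/

section ExponentialIntegral
open MeasureTheory Set Filter Topology

/-- The exponential integral `∫_0^∞ e^{-bt} b / (bt - τ) dt`. -/
noncomputable def expIntegral (b τ : ℂ) : ℂ :=
  ∫ t in Ioi (0 : ℝ), Complex.exp (-(b * t)) * (b / (b * t - τ))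

theorem exists_le_norm_add_of_mem_slitPlane {m : ℂ} (hm : m ∈ Complex.slitPlane) :
    ∃ δ > 0, ∀ t : ℝ, 0 ≤ t → δ ≤ ‖(t : ℂ) + m‖ := by
  rcases hm with h | h
  · refine ⟨m.re, h, fun t ht => ?_⟩
    calc m.re ≤ ((t : ℂ) + m).re := by simp [ht]
      _ ≤ _ := Complex.re_le_norm _
  · refine ⟨|m.im|, abs_pos.mpr h, fun t _ => ?_⟩
    calc |m.im| = |((t : ℂ) + m).im| := by simp
      _ ≤ _ := Complex.abs_im_le_norm _

theorem exists_le_norm_mul_sub {b τ : ℂ} (hb : b ≠ 0) (hm : -τ / b ∈ Complex.slitPlane) :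
    ∃ δ > 0, ∀ t : ℝ, 0 ≤ t → δ ≤ ‖b * t - τ‖ := by
  obtain ⟨δ, hδ, h⟩ := exists_le_norm_add_of_mem_slitPlane hm
  refine ⟨‖b‖ * δ, mul_pos (norm_pos_iff.mpr hb) hδ, fun t ht => ?_⟩
  have : b * t - τ = b * (t + -τ / b) := by field_simp; ring
  rw [this, norm_mul]
  exact mul_le_mul_of_nonneg_left (h t ht) (norm_nonneg _)

theorem norm_exp_neg_mul_ofReal (b : ℂ) (t : ℝ) :
    ‖Complex.exp (-(b * t))‖ = Real.exp (-(b.re * t)) := by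
  rw [Complex.norm_exp]; simp

theorem integrableOn_exp_neg_mul {c : ℝ} (hc : 0 < c) :
    IntegrableOn (fun t : ℝ => Real.exp (-(c * t))) (Ioi 0) := by
  simpa using exp_neg_integrableOn_Ioi 0 hc

theorem ne_zero_of_re_pos {b : ℂ} (hb : 0 < b.re) : b ≠ 0 := by
  rintro rfl; simp at hb

theorem mul_sub_ne_zero_of_mem_slitPlane {b τ : ℂ} (hb : b ≠ 0)
    (hm : -τ / b ∈ Complex.slitPlane) {t : ℝ} (ht : 0 ≤ t) : b * t - τ ≠ 0 := by
  obtain ⟨δ, hδ, h⟩ := exists_le_norm_mul_sub hb hm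
  exact norm_pos_iff.mp (hδ.trans_le (h t ht))

theorem integrableOn_exp_mul_of_bounded {b : ℂ} (hb : 0 < b.re) {g : ℝ → ℂ} {C : ℝ}
    (hg : ContinuousOn g (Ici 0)) (hC : ∀ t : ℝ, 0 ≤ t → ‖g t‖ ≤ C) :
    IntegrableOn (fun t : ℝ => Complex.exp (-(b * t)) * g t) (Ioi 0) := by
  refine Integrable.mono' ((integrableOn_exp_neg_mul hb).mul_const C) ?_ ?_
  · refine ContinuousOn.aestronglyMeasurable ?_ measurableSet_Ioi
    exact ContinuousOn.mul (by fun_prop) (hg.mono Ioi_subset_Ici_self)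
  · filter_upwards [ae_restrict_mem measurableSet_Ioi] with t ht
    rw [norm_mul, norm_exp_neg_mul_ofReal]
    exact mul_le_mul_of_nonneg_left (hC t (le_of_lt ht)) (Real.exp_pos _).le

theorem integrableOn_expIntegral {b τ : ℂ} (hb : 0 < b.re) (hm : -τ / b ∈ Complex.slitPlane) :
    IntegrableOn (fun t : ℝ => Complex.exp (-(b * t)) * (b / (b * t - τ))) (Ioi 0) := by
  have hb0 := ne_zero_of_re_pos hb
  obtain ⟨δ, hδ, h⟩ := exists_le_norm_mul_sub hb0 hm
  refine integrableOn_exp_mul_of_bounded (C := ‖b‖ / δ) hb ?_ ?_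
  · refine ContinuousOn.div (by fun_prop) (by fun_prop) fun t ht => ?_
    exact mul_sub_ne_zero_of_mem_slitPlane hb0 hm ht
  · intro t ht
    rw [norm_div]
    exact div_le_div_of_nonneg_left (norm_nonneg _) hδ (h t ht)

theorem tendsto_exp_neg_mul_mul_of_bounded {b : ℂ} (hb : 0 < b.re) {g : ℝ → ℂ} {C : ℝ}
    (hC : ∀ t : ℝ, 0 ≤ t → ‖g t‖ ≤ C) :
    Tendsto (fun t : ℝ => Complex.exp (-(b * t)) * g t) atTop (𝓝 0) := by
  rw [tendsto_zero_iff_norm_tendsto_zero]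
  have h0 : Tendsto (fun t : ℝ => Real.exp (-(b.re * t)) * C) atTop (𝓝 (0 * C)) := by
    refine Tendsto.mul_const _ ?_
    exact Real.tendsto_exp_neg_atTop_nhds_zero.comp (tendsto_id.const_mul_atTop hb)
  rw [zero_mul] at h0
  refine squeeze_zero' (Eventually.of_forall fun _ => norm_nonneg _) ?_ h0
  filter_upwards [eventually_ge_atTop 0] with t ht
  rw [norm_mul, norm_exp_neg_mul_ofReal]
  exact mul_le_mul_of_nonneg_left (hC t ht) (Real.exp_pos _).le

/-- Differentiation under the integral squares the denominator. Integration by parts in `t` turns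
the result into minus the original integral plus a boundary term, and the factor e^τ cancels the
integral. -/
theorem hasDerivAt_expIntegral_right {b τ : ℂ} (hb : 0 < b.re)
    (hm : -τ / b ∈ Complex.slitPlane) :
    HasDerivAt (fun τ => Complex.exp τ * expIntegral b τ) (-(Complex.exp τ / τ)) τ := by
  have hb0 := ne_zero_of_re_pos hb
  obtain ⟨δ, hδ, h⟩ := exists_le_norm_mul_sub hb0 hm
  -- Moving `τ` by less than half the distance to the contour keeps the denominator bounded below
  -- uniformly, which gives the dominating function.
  have hball : ∀ σ ∈ Metric.ball τ (δ / 2), ∀ t : ℝ, 0 ≤ t → δ / 2 ≤ ‖b * t - σ‖ := by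
    intro σ hσ t ht
    have h1 := h t ht
    have h2 : ‖b * t - τ‖ ≤ ‖b * t - σ‖ + ‖σ - τ‖ := by
      simpa using norm_add_le (b * t - σ) (σ - τ)
    rw [mem_ball_iff_norm] at hσ
    linarith
  have hne : ∀ σ ∈ Metric.ball τ (δ / 2), ∀ t : ℝ, 0 ≤ t → b * t - σ ≠ 0 := fun σ hσ t ht =>
    norm_pos_iff.mp (lt_of_lt_of_le (by positivity) (hball σ hσ t ht))
  have hτ : τ ∈ Metric.ball τ (δ / 2) := Metric.mem_ball_self (by positivity)
  have hτ0 : τ ≠ 0 := by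
    have := hne τ hτ 0 le_rfl
    simpa using this
  have hI2 : IntegrableOn (fun t : ℝ => Complex.exp (-(b * t)) * (b / (b * t - τ) ^ 2))
      (Ioi 0) := by
    refine integrableOn_exp_mul_of_bounded (C := ‖b‖ / (δ / 2) ^ 2) hb ?_ ?_
    · refine ContinuousOn.div (by fun_prop) (by fun_prop) fun t ht => ?_
      exact pow_ne_zero _ (hne τ hτ t ht)
    · intro t ht
      rw [norm_div, norm_pow]
      exact div_le_div_of_nonneg_left (norm_nonneg _) (by positivity)
        (pow_le_pow_left₀ (by positivity) (hball τ hτ t ht) 2)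
  have hD : HasDerivAt (expIntegral b)
      (∫ t in Ioi (0 : ℝ), Complex.exp (-(b * t)) * (b / (b * t - τ) ^ 2)) τ := by
    refine (hasDerivAt_integral_of_dominated_loc_of_deriv_le
      (μ := volume.restrict (Ioi (0 : ℝ)))
      (F := fun (τ : ℂ) (t : ℝ) => Complex.exp (-(b * t)) * (b / (b * t - τ)))
      (F' := fun (τ : ℂ) (t : ℝ) => Complex.exp (-(b * t)) * (b / (b * t - τ) ^ 2))
      (bound := fun t => Real.exp (-(b.re * t)) * (‖b‖ / (δ / 2) ^ 2))
      (Metric.ball_mem_nhds τ (by positivity : 0 < δ / 2)) ?_ ?_ ?_ ?_ ?_ ?_).2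
    · filter_upwards [Metric.ball_mem_nhds τ (by positivity : 0 < δ / 2)] with σ hσ
      refine ContinuousOn.aestronglyMeasurable ?_ measurableSet_Ioi
      refine ContinuousOn.mul (by fun_prop) ?_
      exact ContinuousOn.div (by fun_prop) (by fun_prop) fun t ht => hne σ hσ t (le_of_lt ht)
    · exact integrableOn_expIntegral hb hm
    · exact hI2.aestronglyMeasurable
    · filter_upwards [ae_restrict_mem measurableSet_Ioi] with t ht σ hσ
      rw [norm_mul, norm_exp_neg_mul_ofReal, norm_div, norm_pow]
      refine mul_le_mul_of_nonneg_left ?_ (Real.exp_pos _).le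
      exact div_le_div_of_nonneg_left (norm_nonneg _) (by positivity)
        (pow_le_pow_left₀ (by positivity) (hball σ hσ t (le_of_lt ht)) 2)
    · exact (integrableOn_exp_neg_mul hb).mul_const _
    · filter_upwards [ae_restrict_mem measurableSet_Ioi] with t ht σ hσ
      have h1 : HasDerivAt (fun σ : ℂ => b * t - σ) (-1) σ := by
        simpa using (hasDerivAt_id σ).const_sub (b * t)
      have h2 := (h1.inv (hne σ hσ t (le_of_lt ht))).const_mul (Complex.exp (-(b * t)) * b)
      have h3 : (fun σ : ℂ => Complex.exp (-(b * t)) * (b / (b * t - σ))) =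
          fun σ => Complex.exp (-(b * t)) * b * (fun σ => b * t - σ)⁻¹ σ := by
        ext σ; simp [div_eq_mul_inv, mul_assoc]
      rw [h3]
      refine h2.congr_deriv ?_
      ring
  -- The integrand is the `t`-derivative of -e^{-bt}/(bt - τ), so only the endpoint 0 contributes.
  have hFTC : ∫ t in Ioi (0 : ℝ), (Complex.exp (-(b * t)) * (b / (b * t - τ)) +
      Complex.exp (-(b * t)) * (b / (b * t - τ) ^ 2)) = -(1 / τ) := by
    have key := integral_Ioi_of_hasDerivAt_of_tendsto' (a := (0 : ℝ)) (m := 0)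
      (f := fun t : ℝ => Complex.exp (-(b * t)) * (-(1 / (b * t - τ))))
      (f' := fun t : ℝ => Complex.exp (-(b * t)) * (b / (b * t - τ)) +
        Complex.exp (-(b * t)) * (b / (b * t - τ) ^ 2)) ?_ ?_ ?_
    · rw [key]; simp
    · intro t ht
      have h0 : HasDerivAt (fun t : ℝ => (b * t : ℂ)) b t := by
        simpa using (Complex.ofRealCLM.hasDerivAt (x := t)).const_mul b
      have h1 : HasDerivAt (fun t : ℝ => (b * t - τ : ℂ)) b t := h0.sub_const τ
      have h3 : HasDerivAt (fun t : ℝ => -(1 / (b * t - τ))) (b / (b * t - τ) ^ 2) t := by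
        simpa [neg_div] using (h1.fun_inv (hne τ hτ t ht)).fun_neg
      refine ((h0.fun_neg.cexp).fun_mul h3).congr_deriv ?_
      ring
    · exact (integrableOn_expIntegral hb hm).add hI2
    · refine tendsto_exp_neg_mul_mul_of_bounded hb (C := 1 / (δ / 2)) fun t ht => ?_
      rw [norm_neg, norm_div, norm_one]
      exact div_le_div_of_nonneg_left zero_le_one (by positivity) (hball τ hτ t ht)
  rw [integral_add (integrableOn_expIntegral hb hm) hI2] at hFTC
  have := (Complex.hasDerivAt_exp τ).mul hD
  refine this.congr_deriv ?_
  rw [← mul_add]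
  change Complex.exp τ * (expIntegral b τ + _) = _
  rw [show expIntegral b τ = ∫ t in Ioi (0 : ℝ), Complex.exp (-(b * t)) * (b / (b * t - τ)) from
    rfl, hFTC]
  ring

/-- This is a rotation of the ray b(0,∞) in the right half plane, away from the pole at -1. The
`b`-derivative of the integrand is the `t`-derivative of e^{-bt} t/(bt + 1), which vanishes at both
ends. -/
theorem expIntegral_neg_one_eq {b : ℂ} (hb : 0 < b.re) :
    expIntegral b (-1) = expIntegral 1 (-1) := by
  have hone : ∀ c : ℂ, 0 < c.re → ∀ t : ℝ, 0 ≤ t → 1 ≤ ‖c * t + 1‖ := by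
    intro c hc t ht
    calc (1 : ℝ) ≤ (c * t + 1).re := by simp; positivity
      _ ≤ _ := Complex.re_le_norm _
  have hne : ∀ c : ℂ, 0 < c.re → ∀ t : ℝ, 0 ≤ t → c * t + 1 ≠ 0 := fun c hc t ht =>
    norm_pos_iff.mp (zero_lt_one.trans_le (hone c hc t ht))
  have hmslit : ∀ c : ℂ, 0 < c.re → -(-1) / c ∈ Complex.slitPlane := by
    intro c hc
    rw [neg_neg, one_div]
    refine Or.inl ?_
    rw [Complex.inv_re]
    exact div_pos hc (Complex.normSq_pos.mpr (ne_zero_of_re_pos hc))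
  set F' : ℂ → ℝ → ℂ := fun c t =>
    Complex.exp (-(c * t)) * (1 / (c * t + 1)) + Complex.exp (-(c * t)) * (-(c * t) / (c * t + 1))
      + Complex.exp (-(c * t)) * (-(c * t) / (c * t + 1) ^ 2) with hF'
  have hquot : ∀ c : ℂ, 0 < c.re → ∀ t : ℝ, 0 ≤ t → ‖c * t / (c * t + 1)‖ ≤ 2 := by
    intro c hc t ht
    have : c * t / (c * t + 1) = 1 - 1 / (c * t + 1) := by
      have := hne c hc t ht
      field_simp; ring
    rw [this]
    have h1 : ‖(1 : ℂ) / (c * t + 1)‖ ≤ 1 := by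
      rw [norm_div, norm_one]
      exact div_le_one_of_le₀ (hone c hc t ht) (norm_nonneg _)
    calc _ ≤ ‖(1 : ℂ)‖ + ‖(1 : ℂ) / (c * t + 1)‖ := norm_sub_le _ _
      _ ≤ 2 := by rw [norm_one]; linarith
  -- The constant is 5 = 1 + 2 + 2, from |1/(ct+1)| ≤ 1 and |ct/(ct+1)| ≤ 2.
  have hbd : ∀ c : ℂ, 0 < c.re → ∀ t : ℝ, 0 ≤ t →
      ‖F' c t‖ ≤ Real.exp (-(c.re * t)) * 5 := by
    intro c hc t ht
    have e : F' c t = Complex.exp (-(c * t)) *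
        (1 / (c * t + 1) - c * t / (c * t + 1) - c * t / (c * t + 1) * (1 / (c * t + 1))) := by
      have := hne c hc t ht
      simp only [hF']; field_simp; ring
    have h1 : ‖(1 : ℂ) / (c * t + 1)‖ ≤ 1 := by
      rw [norm_div, norm_one]
      exact div_le_one_of_le₀ (hone c hc t ht) (norm_nonneg _)
    rw [e, norm_mul, norm_exp_neg_mul_ofReal]
    refine mul_le_mul_of_nonneg_left ?_ (Real.exp_pos _).le
    refine (norm_sub_le _ _).trans ?_
    refine (add_le_add (norm_sub_le _ _) le_rfl).trans ?_
    rw [norm_mul]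
    have h2 := hquot c hc t ht
    nlinarith [norm_nonneg (c * t / (c * t + 1)), norm_nonneg ((1 : ℂ) / (c * t + 1))]
  have hcont : ∀ c : ℂ, 0 < c.re → ContinuousOn (F' c) (Ici 0) := by
    intro c hc
    have h1 := fun t ht => hne c hc t ht
    have h2 := fun t ht => pow_ne_zero 2 (hne c hc t ht)
    refine ContinuousOn.add (ContinuousOn.add ?_ ?_) ?_
    · exact ContinuousOn.mul (by fun_prop) (ContinuousOn.div (by fun_prop) (by fun_prop) h1)
    · exact ContinuousOn.mul (by fun_prop) (ContinuousOn.div (by fun_prop) (by fun_prop) h1)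
    · exact ContinuousOn.mul (by fun_prop) (ContinuousOn.div (by fun_prop) (by fun_prop) h2)
  have hint : ∀ c : ℂ, 0 < c.re → IntegrableOn (F' c) (Ioi 0) := by
    intro c hc
    refine Integrable.mono' ((integrableOn_exp_neg_mul hc).mul_const 5) ?_ ?_
    · exact ((hcont c hc).mono Ioi_subset_Ici_self).aestronglyMeasurable measurableSet_Ioi
    · filter_upwards [ae_restrict_mem measurableSet_Ioi] with t ht
      exact hbd c hc t (le_of_lt ht)
  have hderiv : ∀ c : ℂ, 0 < c.re → HasDerivAt (fun c => expIntegral c (-1)) 0 c := by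
    intro c hc
    have hre : ∀ σ ∈ Metric.ball c (c.re / 2), c.re / 2 < σ.re := by
      intro σ hσ
      rw [mem_ball_iff_norm] at hσ
      have := Complex.abs_re_le_norm (σ - c)
      have := abs_le.mp this
      simp at this
      linarith
    have hc2 : 0 < c.re / 2 := by positivity
    have hD := (hasDerivAt_integral_of_dominated_loc_of_deriv_le
      (μ := volume.restrict (Ioi (0 : ℝ)))
      (F := fun (c : ℂ) (t : ℝ) => Complex.exp (-(c * t)) * (c / (c * t - (-1))))
      (F' := F') (x₀ := c)
      (bound := fun t => Real.exp (-(c.re / 2 * t)) * 5)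
      (Metric.ball_mem_nhds c hc2) ?_ ?_ ?_ ?_ ?_ ?_).2
    · have h0 : ∫ t in Ioi (0 : ℝ), F' c t = 0 := by
        have key := integral_Ioi_of_hasDerivAt_of_tendsto' (a := (0 : ℝ)) (m := 0)
          (f := fun t : ℝ => Complex.exp (-(c * t)) * (t / (c * t + 1)))
          (f' := F' c) ?_ (hint c hc) ?_
        · rw [key]; simp
        · intro t ht
          have h0 : HasDerivAt (fun t : ℝ => (c * t : ℂ)) c t := by
            simpa using (Complex.ofRealCLM.hasDerivAt (x := t)).const_mul c
          have h1 : HasDerivAt (fun t : ℝ => (c * t + 1 : ℂ)) c t := h0.add_const 1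
          have h3 : HasDerivAt (fun t : ℝ => (t : ℂ)) 1 t := Complex.ofRealCLM.hasDerivAt
          have hnz := hne c hc t ht
          have h2 := (h0.neg.cexp).mul (h3.div h1 hnz)
          refine h2.congr_deriv ?_
          simp only [hF', Pi.neg_apply, Pi.div_apply]
          field_simp
          ring
        · refine tendsto_exp_neg_mul_mul_of_bounded hc (C := 2 / ‖c‖) fun t ht => ?_
          have hc0 := ne_zero_of_re_pos hc
          have : (t / (c * t + 1) : ℂ) = (c * t / (c * t + 1)) / c := by
            field_simp
          rw [this, norm_div]
          exact div_le_div_of_nonneg_right (hquot c hc t ht) (norm_nonneg _)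
      rw [h0] at hD
      exact hD
    · filter_upwards [Metric.ball_mem_nhds c hc2] with σ hσ
      have := integrableOn_expIntegral (hc2.trans (hre σ hσ)) (hmslit σ (hc2.trans (hre σ hσ)))
      exact this.aestronglyMeasurable
    · exact integrableOn_expIntegral hc (hmslit c hc)
    · exact (hint c hc).aestronglyMeasurable
    · filter_upwards [ae_restrict_mem measurableSet_Ioi] with t ht σ hσ
      have h1 := hre σ hσ
      refine (hbd σ (hc2.trans h1) t (le_of_lt ht)).trans ?_
      have : (0:ℝ) < t := ht
      gcongr
    · exact (integrableOn_exp_neg_mul hc2).mul_const _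
    · filter_upwards [ae_restrict_mem measurableSet_Ioi] with t ht σ hσ
      have h0 : HasDerivAt (fun σ : ℂ => σ * t) t σ := by
        simpa using (hasDerivAt_id σ).mul_const (t : ℂ)
      have h1 : HasDerivAt (fun σ : ℂ => σ * t - (-1)) t σ := h0.sub_const _
      have hnz := hne σ (hc2.trans (hre σ hσ)) t (le_of_lt ht)
      have hnz' : σ * t - (-1) ≠ 0 := by rwa [sub_neg_eq_add]
      have h2 := (h0.neg.cexp).mul ((hasDerivAt_id σ).div h1 hnz')
      refine h2.congr_deriv ?_
      simp only [hF', Pi.neg_apply, Pi.div_apply, id, sub_neg_eq_add]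
      field_simp
      ring
  have hopen : IsOpen {c : ℂ | 0 < c.re} := isOpen_lt continuous_const Complex.continuous_re
  have hconv : Convex ℝ {c : ℂ | 0 < c.re} := convex_halfSpace_re_gt 0
  exact hopen.is_const_of_deriv_eq_zero hconv.isPreconnected
    (fun c hc => (hderiv c hc).differentiableAt.differentiableWithinAt)
    (fun c hc => (hderiv c hc).deriv) hb (by simp)

/-- The singularity at 0 is removable: `dslope` extends the quotient to an entire function, which
has a primitive on the plane. -/
theorem exists_primitive_exp_sub_one_div :
    ∃ S : ℂ → ℂ, ∀ τ ≠ 0, HasDerivAt S ((Complex.exp τ - 1) / τ) τ := by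
  have hd : Differentiable ℂ (dslope Complex.exp 0) := by
    rw [← differentiableOn_univ, Complex.differentiableOn_dslope Filter.univ_mem]
    exact Complex.differentiable_exp.differentiableOn
  obtain ⟨S, hS⟩ := hd.isExactOn_univ
  refine ⟨S, fun τ hτ => (hS τ (mem_univ τ)).congr_deriv ?_⟩
  rw [dslope_of_ne _ hτ, slope_def_field]
  simp

/-- The slope `b` enters only through two logarithms. Hence the integral is constant while the ray
turns without meeting the pole, and crossing the pole can be read off from the branches of
`Complex.log`. -/
theorem exists_exp_mul_expIntegral_eq :
    ∃ T : ℂ → ℂ, ∀ b τ : ℂ, 0 < b.re → -τ / b ∈ Complex.slitPlane →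
      Complex.exp τ * expIntegral b τ = T τ + (Complex.log (1 / b) - Complex.log (-τ / b)) := by
  obtain ⟨S, hS⟩ := exists_primitive_exp_sub_one_div
  refine ⟨fun τ => Complex.exp (-1) * expIntegral 1 (-1) + S (-1) - S τ, fun b τ hb hm => ?_⟩
  have hb0 := ne_zero_of_re_pos hb
  set V : Set ℂ := {τ | -τ / b ∈ Complex.slitPlane} with hV
  have hVopen : IsOpen V := Complex.isOpen_slitPlane.preimage (by fun_prop)
  have hVimg : V = (fun m : ℂ => -(b * m)) '' Complex.slitPlane := by
    ext σ
    constructor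
    · intro h
      refine ⟨-σ / b, h, ?_⟩
      field_simp
    · rintro ⟨m, hm, rfl⟩
      simp only [hV, mem_ofPred_eq, neg_neg]
      rwa [mul_div_cancel_left₀ _ hb0]
  have hVconn : IsPreconnected V := by
    rw [hVimg]
    refine IsPreconnected.image ?_ _ (by fun_prop)
    have : StarConvex ℝ 1 Complex.slitPlane := Complex.starConvex_one_slitPlane
    exact (this.isPathConnected Complex.one_mem_slitPlane).isConnected.isPreconnected
  have hder : ∀ σ ∈ V, HasDerivAt
      (fun σ => Complex.exp σ * expIntegral b σ + S σ + Complex.log (-σ / b)) 0 σ := by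
    intro σ hσ
    have hσ0 : σ ≠ 0 := by
      rintro rfl
      simp [hV] at hσ
    have h1 : HasDerivAt (fun σ : ℂ => -σ / b) (-1 / b) σ :=
      ((hasDerivAt_id σ).neg).div_const b
    have h2 := ((hasDerivAt_expIntegral_right hb hσ).add (hS σ hσ0)).add (h1.clog hσ)
    refine h2.congr_deriv ?_
    field_simp
    ring
  -- The constant of integration is fixed at τ = -1, where the integral does not depend on `b` and
  -- the second logarithm equals log(1/b).
  have h1V : (-1 : ℂ) ∈ V := by
    simp only [hV, mem_ofPred_eq, neg_neg, one_div]
    refine Or.inl ?_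
    rw [Complex.inv_re]
    exact div_pos hb (Complex.normSq_pos.mpr hb0)
  have := hVopen.is_const_of_deriv_eq_zero hVconn
    (fun c hc => (hder c hc).differentiableAt.differentiableWithinAt)
    (fun c hc => (hder c hc).deriv) hm h1V
  simp only [neg_neg, expIntegral_neg_one_eq hb] at this
  linear_combination this

end ExponentialIntegral

/-! ### Convergence and differentiability of the iterated Cauchy integrals -/

section ChainIntegral
open MeasureTheory Set Filter Topology

/-- The kernel `∏ 1 / (u_k - u_{k+1})`, the product being over consecutive indices. -/
noncomputable def chainKernel : ∀ {n : ℕ}, (Fin n → ℂ) → ℂ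
  | 0, _ => 1
  | 1, _ => 1
  | _ + 2, u => (u 0 - u 1)⁻¹ * chainKernel (Fin.tail u)

/-- No two consecutive entries lie on the same ray. -/
def ChainGeneric {n : ℕ} (a : Fin n → ℂ) : Prop :=
  ∀ (k : ℕ) (hk : k + 1 < n), ¬ SameRay ℝ (a ⟨k, Nat.lt_of_succ_lt hk⟩) (a ⟨k + 1, hk⟩)

theorem ChainGeneric.tail {n : ℕ} {a : Fin (n + 1) → ℂ} (h : ChainGeneric a) :
    ChainGeneric (Fin.tail a) := fun k hk => h (k + 1) (by omega)

/-- Lebesgue measure on the open orthant `(0,∞)^n`. -/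
noncomputable def orthantMeasure (n : ℕ) : Measure (Fin n → ℝ) :=
  Measure.pi fun _ => volume.restrict (Ioi 0)

/-- The integrand of `chainIntegral`. -/
noncomputable def chainIntegrand {n : ℕ} (z a : Fin n → ℂ) (x : Fin n → ℝ) : ℂ :=
  Complex.exp (-∑ i, z i * (a i * x i)) * (chainKernel (fun i => a i * x i) * ∏ i, a i)

/-- The iterated Cauchy integral `∫ e^{-∑ z_i u_i} ∏ 1/(u_k - u_{k+1}) ∏ du_i` over the product of
the rays `u_i ∈ a_i (0,∞)`. -/
noncomputable def chainIntegral {n : ℕ} (z a : Fin n → ℂ) : ℂ :=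
  ∫ x, chainIntegrand z a x ∂(orthantMeasure n)

instance (n : ℕ) : SigmaFinite (orthantMeasure n) := by
  unfold orthantMeasure; infer_instance

theorem ae_orthantMeasure_pos (n : ℕ) : ∀ᵐ x ∂(orthantMeasure n), ∀ i, 0 < x i := by
  rw [ae_all_iff]
  intro i
  have : ∀ᵐ t ∂(volume.restrict (Ioi (0 : ℝ))), 0 < t := ae_restrict_mem measurableSet_Ioi
  exact (Measure.tendsto_eval_ae_ae (μ := fun _ : Fin n => volume.restrict (Ioi (0 : ℝ)))
    (i := i)).eventually this

/-- By homogeneity it suffices to minimise over the compact segment x + y = 1. A zero there would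
put `a` and `b` on one ray. -/
theorem exists_mul_add_le_norm_sub {a b : ℂ} (h : ¬ SameRay ℝ a b) :
    ∃ κ > 0, ∀ x y : ℝ, 0 ≤ x → 0 ≤ y → κ * (x + y) ≤ ‖a * x - b * y‖ := by
  have hcont : ContinuousOn (fun t : ℝ => ‖a * t - b * ((1 - t : ℝ) : ℂ)‖) (Icc 0 1) := by
    fun_prop
  obtain ⟨t₀, ht₀, hmin⟩ := isCompact_Icc.exists_isMinOn (nonempty_Icc.mpr zero_le_one) hcont
  refine ⟨‖a * t₀ - b * ((1 - t₀ : ℝ) : ℂ)‖, ?_, ?_⟩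
  · rw [gt_iff_lt, norm_pos_iff, sub_ne_zero]
    intro he
    apply h
    rcases ht₀.1.eq_or_lt with h0 | h0
    · rw [← h0] at he
      simp only [Complex.ofReal_zero, mul_zero, sub_zero, Complex.ofReal_one, mul_one] at he
      rw [← he]; exact SameRay.zero_right _
    rcases ht₀.2.eq_or_lt with h1 | h1
    · rw [h1] at he
      simp only [sub_self, Complex.ofReal_zero, mul_zero, Complex.ofReal_one, mul_one] at he
      rw [he]; exact SameRay.zero_left _
    · refine Or.inr (Or.inr ⟨t₀, 1 - t₀, h0, by linarith, ?_⟩)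
      rw [Complex.real_smul, Complex.real_smul, mul_comm, he, mul_comm]
  · intro x y hx hy
    rcases (add_nonneg hx hy).eq_or_lt with hs | hs
    · rw [← hs]; simp
    have hmem : x / (x + y) ∈ Icc (0 : ℝ) 1 :=
      ⟨by positivity, div_le_one_of_le₀ (by linarith) hs.le⟩
    have h1 := hmin hmem
    simp only at h1
    have h2 : a * x - b * y =
        (a * ((x / (x + y) : ℝ) : ℂ) - b * ((1 - x / (x + y) : ℝ) : ℂ)) * ((x + y : ℝ) : ℂ) := by
      have : ((x : ℂ) + y) ≠ 0 := by exact_mod_cast hs.ne'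
      push_cast
      field_simp
      ring
    rw [h2, norm_mul, Complex.norm_real, Real.norm_of_nonneg hs.le]
    exact mul_le_mul_of_nonneg_right h1 hs.le

theorem measurable_chainKernel {n : ℕ} (a : Fin n → ℂ) :
    Measurable fun x : Fin n → ℝ => chainKernel fun i => a i * x i := by
  match n, a with
  | 0, _ => simp only [chainKernel]; fun_prop
  | 1, _ => simp only [chainKernel]; fun_prop
  | n + 2, a =>
    have h1 := (measurable_chainKernel (Fin.tail a)).comp
      (measurable_pi_lambda (fun x : Fin (n + 2) → ℝ => (Fin.tail x : Fin (n + 1) → ℝ))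
        fun i => measurable_pi_apply i.succ)
    have h2 : Measurable fun x : Fin (n + 2) → ℝ => (a 0 * x 0 - a 1 * x 1 : ℂ)⁻¹ := by fun_prop
    exact h2.mul h1

theorem aestronglyMeasurable_chainIntegrand {n : ℕ} (z a : Fin n → ℂ) :
    AEStronglyMeasurable (chainIntegrand z a) (orthantMeasure n) := by
  refine Measurable.aestronglyMeasurable ?_
  exact Measurable.mul (by fun_prop) ((measurable_chainKernel a).mul_const _)

/-- Each kernel factor is O(1/(x_k + x_{k+1})), and weighted AM-GM distributes this singularity over
the two variables. The weights are chosen such that every variable after the first gets the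
integrable exponent 1/N - 1; the first one keeps a spare negative power for the induction. -/
theorem exists_norm_chainKernel_le_aux {N : ℕ} :
    ∀ (m : ℕ) (a : Fin (m + 1) → ℂ), ChainGeneric a → m < N →
      ∃ C : ℝ, 0 < C ∧ ∀ x : Fin (m + 1) → ℝ, (∀ i, 0 < x i) →
        ‖chainKernel fun i => a i * x i‖ ≤
          C * (x 0 ^ (-(m / N : ℝ)) * ∏ i : Fin m, x i.succ ^ (1 / N - 1 : ℝ)) := by
  intro m
  induction m with
  | zero =>
    intro a _ _
    exact ⟨1, one_pos, fun x _ => by simp [chainKernel]⟩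
  | succ m ih =>
    intro a ha hm
    have hN : (0 : ℝ) < N := by exact_mod_cast (by omega : 0 < N)
    obtain ⟨C, hC, hb⟩ := ih (Fin.tail a) ha.tail (by omega)
    obtain ⟨κ, hκ, hκb⟩ := exists_mul_add_le_norm_sub (ha 0 (by omega))
    refine ⟨κ⁻¹ * C, by positivity, fun x hx => ?_⟩
    have h1 := hb (Fin.tail x) fun i => hx i.succ
    have hx0 := hx 0
    have hx1 := hx 1
    have h2 : ‖(a 0 * x 0 - a 1 * x 1 : ℂ)⁻¹‖ ≤ κ⁻¹ * (x 0 + x 1)⁻¹ := by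
      rw [norm_inv, ← mul_inv]
      exact inv_anti₀ (by positivity) (hκb _ _ hx0.le hx1.le)
    have h3 : (x 0 + x 1)⁻¹ ≤
        x 0 ^ (-((m + 1 : ℕ) / N : ℝ)) * x 1 ^ (((m + 1 : ℕ) / N : ℝ) - 1) := by
      have hle : ((m + 1 : ℕ) / N : ℝ) ≤ 1 := by
        rw [div_le_one hN]; exact_mod_cast hm.le
      have := Real.geom_mean_le_arith_mean2_weighted (w₁ := ((m + 1 : ℕ) / N : ℝ))
        (w₂ := 1 - ((m + 1 : ℕ) / N : ℝ)) (by positivity) (by linarith) hx0.le hx1.le (by ring)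
      have h4 : x 0 ^ ((m + 1 : ℕ) / N : ℝ) * x 1 ^ (1 - ((m + 1 : ℕ) / N : ℝ)) ≤ x 0 + x 1 := by
        refine this.trans (add_le_add ?_ ?_)
        · exact mul_le_of_le_one_left hx0.le hle
        · refine mul_le_of_le_one_left hx1.le ?_
          have : (0 : ℝ) ≤ ((m + 1 : ℕ) / N : ℝ) := by positivity
          linarith
      rw [Real.rpow_neg hx0.le, show ((m + 1 : ℕ) / N : ℝ) - 1 = -(1 - ((m + 1 : ℕ) / N : ℝ)) by
        ring, Real.rpow_neg hx1.le, ← mul_inv]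
      exact inv_anti₀ (by positivity) h4
    have e : chainKernel (fun i => a i * (x i : ℂ)) =
        (a 0 * x 0 - a 1 * x 1 : ℂ)⁻¹ *
          chainKernel fun i => Fin.tail a i * ((Fin.tail x i : ℝ) : ℂ) := rfl
    rw [e, norm_mul]
    refine (mul_le_mul (h2.trans (mul_le_mul_of_nonneg_left h3 (by positivity))) h1
      (norm_nonneg _) (by positivity)).trans (le_of_eq ?_)
    rw [Fin.prod_univ_succ]
    -- The new factor and the spare power from the induction hypothesis combine to the target
    -- exponent.
    have h5 : x 1 ^ (1 / N - 1 : ℝ) =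
        x 1 ^ (((m + 1 : ℕ) / N : ℝ) - 1) * x 1 ^ (-(m / N : ℝ)) := by
      rw [← Real.rpow_add hx1]
      congr 1
      push_cast
      field_simp
      ring
    simp only [Fin.tail, Fin.succ_zero_eq_one]
    rw [h5]
    ring

theorem exists_norm_chainKernel_le {n : ℕ} (hn : 1 ≤ n) {a : Fin n → ℂ} (ha : ChainGeneric a) :
    ∃ C : ℝ, 0 < C ∧ ∀ x : Fin n → ℝ, (∀ i, 0 < x i) →
      ‖chainKernel fun i => a i * x i‖ ≤ C * ∏ i, x i ^ (1 / n - 1 : ℝ) := by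
  obtain ⟨m, rfl⟩ : ∃ m, n = m + 1 := ⟨n - 1, by omega⟩
  obtain ⟨C, hC, h⟩ := exists_norm_chainKernel_le_aux (N := m + 1) m a ha (by omega)
  refine ⟨C, hC, fun x hx => (h x hx).trans (le_of_eq ?_)⟩
  rw [Fin.prod_univ_succ]
  congr 3
  push_cast
  field_simp
  ring

/-- An integrable function on the orthant dominating chain integrands. -/
noncomputable def orthantEnvelope (n : ℕ) (c : ℝ) (x : Fin n → ℝ) : ℝ :=
  ∏ i, (x i ^ (1 / n - 1 : ℝ) * Real.exp (-(c * x i)))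

theorem integrable_orthantEnvelope {n : ℕ} (hn : 1 ≤ n) {c : ℝ} (hc : 0 < c) :
    Integrable (orthantEnvelope n c) (orthantMeasure n) := by
  have h1 : IntegrableOn (fun t : ℝ => t ^ (1 / n - 1 : ℝ) * Real.exp (-(c * t))) (Ioi 0) := by
    have := integrableOn_rpow_mul_exp_neg_mul_rpow (p := 1) (s := (1 / n - 1 : ℝ)) (b := c)
      (by
        have : (0 : ℝ) < 1 / n := by positivity
        linarith) one_pos hc
    simpa using this
  exact Integrable.fintype_prod (μ := fun _ : Fin n => volume.restrict (Ioi (0 : ℝ)))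
    fun _ => h1

theorem orthantEnvelope_eq {n : ℕ} (c : ℝ) (x : Fin n → ℝ) :
    orthantEnvelope n c x = (∏ i, x i ^ (1 / n - 1 : ℝ)) * Real.exp (-(c * ∑ i, x i)) := by
  rw [orthantEnvelope, Finset.prod_mul_distrib, ← Real.exp_sum]
  simp [Finset.mul_sum]

theorem norm_exp_neg_sum_le {n : ℕ} {z a : Fin n → ℂ} {c : ℝ} (hc : ∀ i, c ≤ (z i * a i).re)
    {x : Fin n → ℝ} (hx : ∀ i, 0 < x i) :
    ‖Complex.exp (-∑ i, z i * (a i * x i))‖ ≤ Real.exp (-(c * ∑ i, x i)) := by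
  rw [Complex.norm_exp, Real.exp_le_exp, Complex.neg_re, neg_le_neg_iff, Complex.re_sum,
    Finset.mul_sum]
  refine Finset.sum_le_sum fun i _ => ?_
  rw [← mul_assoc, Complex.re_mul_ofReal]
  exact mul_le_mul_of_nonneg_right (hc i) (hx i).le

/-- The constant depends on `a` only, so one envelope dominates the integrands for all `z` in a
neighbourhood. -/
theorem exists_norm_chainIntegrand_le {n : ℕ} (hn : 1 ≤ n) {a : Fin n → ℂ} (ha : ChainGeneric a) :
    ∃ C : ℝ, 0 < C ∧ ∀ (z : Fin n → ℂ) (c : ℝ), (∀ i, c ≤ (z i * a i).re) →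
      ∀ x : Fin n → ℝ, (∀ i, 0 < x i) →
        ‖chainIntegrand z a x‖ ≤ C * orthantEnvelope n c x := by
  obtain ⟨C, hC, h⟩ := exists_norm_chainKernel_le hn ha
  refine ⟨C * (‖∏ i, a i‖ + 1), by positivity, fun z c hc x hx => ?_⟩
  rw [chainIntegrand, orthantEnvelope_eq, norm_mul, norm_mul]
  have h1 := norm_exp_neg_sum_le hc hx
  have h2 := h x hx
  have h3 : 0 ≤ ∏ i, x i ^ (1 / n - 1 : ℝ) :=
    Finset.prod_nonneg fun i _ => Real.rpow_nonneg (hx i).le _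
  calc _ ≤ Real.exp (-(c * ∑ i, x i)) *
        ((C * ∏ i, x i ^ (1 / n - 1 : ℝ)) * (‖∏ i, a i‖ + 1)) := by
        gcongr
        linarith
    _ = _ := by ring

theorem exists_pos_le_re {n : ℕ} {z a : Fin n → ℂ} (h : ∀ i, 0 < (z i * a i).re) :
    ∃ c : ℝ, 0 < c ∧ ∀ i, c ≤ (z i * a i).re := by
  rcases isEmpty_or_nonempty (Fin n) with h0 | h0
  · exact ⟨1, one_pos, fun i => h0.elim i⟩
  · obtain ⟨j, hj⟩ := Finite.exists_min fun i => (z i * a i).re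
    exact ⟨_, h j, hj⟩

theorem integrable_chainIntegrand {n : ℕ} (hn : 1 ≤ n) {z a : Fin n → ℂ} (ha : ChainGeneric a)
    (hza : ∀ i, 0 < (z i * a i).re) : Integrable (chainIntegrand z a) (orthantMeasure n) := by
  obtain ⟨C, -, h⟩ := exists_norm_chainIntegrand_le hn ha
  obtain ⟨c, hc, hcz⟩ := exists_pos_le_re hza
  refine Integrable.mono' ((integrable_orthantEnvelope hn hc).const_mul C)
    (aestronglyMeasurable_chainIntegrand z a) ?_
  filter_upwards [ae_orthantMeasure_pos n] with x hx
  exact h z c hcz x hx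

/-- The linear form `v ↦ -∑ v_i a_i x_i`. -/
noncomputable def phaseForm {n : ℕ} (a : Fin n → ℂ) (x : Fin n → ℝ) : (Fin n → ℂ) →L[ℂ] ℂ :=
  -∑ i, (a i * x i) • ContinuousLinearMap.proj (R := ℂ) (φ := fun _ : Fin n => ℂ) i

theorem phaseForm_apply {n : ℕ} (a : Fin n → ℂ) (x : Fin n → ℝ) (v : Fin n → ℂ) :
    phaseForm a x v = -∑ i, v i * (a i * x i) := by
  simp [phaseForm, mul_comm]

theorem norm_phaseForm_le {n : ℕ} (a : Fin n → ℂ) {x : Fin n → ℝ} (hx : ∀ i, 0 < x i) :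
    ‖phaseForm a x‖ ≤ (∑ i, ‖a i‖) * ∑ i, x i := by
  refine ContinuousLinearMap.opNorm_le_bound _ (by
    exact mul_nonneg (Finset.sum_nonneg fun i _ => norm_nonneg _)
      (Finset.sum_nonneg fun i _ => (hx i).le)) fun v => ?_
  rw [phaseForm_apply, norm_neg]
  refine (norm_sum_le _ _).trans ?_
  rw [Finset.mul_sum, Finset.sum_mul]
  refine Finset.sum_le_sum fun i _ => ?_
  rw [norm_mul, norm_mul, Complex.norm_real, Real.norm_of_nonneg (hx i).le]
  have h1 : ‖v i‖ ≤ ‖v‖ := norm_le_pi_norm v i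
  have h2 : ‖a i‖ ≤ ∑ i, ‖a i‖ :=
    Finset.single_le_sum (f := fun i => ‖a i‖) (fun i _ => norm_nonneg _) (Finset.mem_univ i)
  rw [mul_comm]
  gcongr
  · exact mul_nonneg (Finset.sum_nonneg fun i _ => norm_nonneg _) (hx i).le
  · exact (hx i).le

/-- Dominated differentiation applies because the linear factor brought down by the exponential is
paid for with part of the exponential decay. -/
theorem hasFDerivAt_chainIntegral {n : ℕ} (hn : 1 ≤ n) {z a : Fin n → ℂ} (ha : ChainGeneric a)
    (hza : ∀ i, 0 < (z i * a i).re) :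
    Integrable (fun x => chainIntegrand z a x • phaseForm a x) (orthantMeasure n) ∧
    HasFDerivAt (fun z => chainIntegral z a)
      (∫ x, chainIntegrand z a x • phaseForm a x ∂(orthantMeasure n)) z := by
  obtain ⟨C, hC, h⟩ := exists_norm_chainIntegrand_le hn ha
  obtain ⟨c, hc, hcz⟩ := exists_pos_le_re hza
  set s : Set (Fin n → ℂ) := {σ | ∀ i, c / 2 < (σ i * a i).re} with hs
  have hsopen : IsOpen s := by
    rw [hs, ofPred_forall]
    refine isOpen_iInter_of_finite fun i => isOpen_lt continuous_const ?_
    fun_prop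
  have hzs : z ∈ s := fun i => lt_of_lt_of_le (by linarith) (hcz i)
  set A := ∑ i, ‖a i‖ with hA
  have hA0 : 0 ≤ A := Finset.sum_nonneg fun i _ => norm_nonneg _
  have hmeas : AEStronglyMeasurable (fun x => chainIntegrand z a x • phaseForm a x)
      (orthantMeasure n) := by
    refine (aestronglyMeasurable_chainIntegrand z a).smul ?_
    refine Continuous.aestronglyMeasurable ?_
    unfold phaseForm
    fun_prop
  have hbound : ∀ᵐ x ∂(orthantMeasure n), ∀ σ ∈ s,
      ‖chainIntegrand σ a x • phaseForm a x‖ ≤ C * A * (4 / c) * orthantEnvelope n (c / 4) x := by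
    filter_upwards [ae_orthantMeasure_pos n] with x hx σ hσ
    rw [norm_smul]
    have h1 := h σ (c / 2) (fun i => (hσ i).le) x hx
    have h2 := norm_phaseForm_le a hx
    have hX : 0 ≤ ∑ i, x i := Finset.sum_nonneg fun i _ => (hx i).le
    -- With X = ∑ x_i, the inequality X ≤ (4/c) e^{cX/4} lowers the decay rate from c/2 to c/4 and
    -- absorbs X.
    have h3 : orthantEnvelope n (c / 2) x * ∑ i, x i ≤
        (4 / c) * orthantEnvelope n (c / 4) x := by
      have hP : 0 ≤ ∏ i, x i ^ (1 / n - 1 : ℝ) :=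
        Finset.prod_nonneg fun i _ => Real.rpow_nonneg (hx i).le _
      rw [orthantEnvelope_eq, orthantEnvelope_eq]
      have h4 : ∑ i, x i ≤ (4 / c) * Real.exp (c / 4 * ∑ i, x i) := by
        have := Real.add_one_le_exp (c / 4 * ∑ i, x i)
        have : c / 4 * ∑ i, x i ≤ Real.exp (c / 4 * ∑ i, x i) := by linarith
        calc ∑ i, x i = (4 / c) * (c / 4 * ∑ i, x i) := by field_simp
          _ ≤ _ := by gcongr
      have h5 : Real.exp (-(c / 2 * ∑ i, x i)) * Real.exp (c / 4 * ∑ i, x i) =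
          Real.exp (-(c / 4 * ∑ i, x i)) := by
        rw [← Real.exp_add]; congr 1; ring
      calc _ ≤ (∏ i, x i ^ (1 / n - 1 : ℝ)) * Real.exp (-(c / 2 * ∑ i, x i)) *
            ((4 / c) * Real.exp (c / 4 * ∑ i, x i)) := by gcongr
        _ = (4 / c) * ((∏ i, x i ^ (1 / n - 1 : ℝ)) *
            (Real.exp (-(c / 2 * ∑ i, x i)) * Real.exp (c / 4 * ∑ i, x i))) := by ring
        _ = _ := by rw [h5]
    calc _ ≤ (C * orthantEnvelope n (c / 2) x) * (A * ∑ i, x i) :=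
          mul_le_mul h1 h2 (norm_nonneg _) ((norm_nonneg _).trans h1)
      _ = C * A * (orthantEnvelope n (c / 2) x * ∑ i, x i) := by ring
      _ ≤ C * A * ((4 / c) * orthantEnvelope n (c / 4) x) := by gcongr
      _ = _ := by ring
  have hbi : Integrable (fun x => C * A * (4 / c) * orthantEnvelope n (c / 4) x)
      (orthantMeasure n) :=
    (integrable_orthantEnvelope hn (by positivity)).const_mul _
  refine ⟨Integrable.mono' hbi hmeas ?_, ?_⟩
  · filter_upwards [hbound] with x hx using hx z hzs
  refine hasFDerivAt_integral_of_dominated_of_fderiv_le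
    (F := fun σ x => chainIntegrand σ a x) (F' := fun σ x => chainIntegrand σ a x • phaseForm a x)
    (hsopen.mem_nhds hzs) (Eventually.of_forall fun σ => aestronglyMeasurable_chainIntegrand σ a)
    (integrable_chainIntegrand hn ha hza) hmeas hbound hbi ?_
  refine Eventually.of_forall fun x σ _ => ?_
  have h1 := ((phaseForm a x).hasFDerivAt (x := σ)).cexp.mul_const
    (chainKernel (fun i => a i * x i) * ∏ i, a i)
  simp only [phaseForm_apply] at h1
  refine h1.congr_fderiv ?_
  ext v
  simp [chainIntegrand, phaseForm_apply]
  ring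

theorem fderiv_chainIntegral_apply {n : ℕ} (hn : 1 ≤ n) {z a : Fin n → ℂ} (ha : ChainGeneric a)
    (hza : ∀ i, 0 < (z i * a i).re) (v : Fin n → ℂ) :
    fderiv ℂ (fun z => chainIntegral z a) z v =
      ∫ x, chainIntegrand z a x * -∑ i, v i * (a i * x i) ∂(orthantMeasure n) := by
  obtain ⟨hi, hd⟩ := hasFDerivAt_chainIntegral hn ha hza
  rw [hd.fderiv, ContinuousLinearMap.integral_apply hi]
  simp [phaseForm_apply]

end ChainIntegral

/-! ### The differential equation of the chain integrals -/

section ChainIntegralDerivative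
open MeasureTheory Set Filter Topology

/-- The kernel `chainKernel` as a function of lists. -/
noncomputable def chainKernelList : List ℂ → ℂ
  | [] => 1
  | [_] => 1
  | x :: y :: l => (x - y)⁻¹ * chainKernelList (y :: l)

theorem chainKernel_eq_chainKernelList : ∀ {n : ℕ} (u : Fin n → ℂ),
    chainKernel u = chainKernelList (List.ofFn u)
  | 0, _ => rfl
  | 1, _ => rfl
  | n + 2, u => by
    have e : List.ofFn u = u 0 :: u 1 :: List.ofFn (fun i : Fin n => u i.succ.succ) := by
      rw [List.ofFn_succ, List.ofFn_succ]; rfl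
    have e' : List.ofFn (Fin.tail u) = u 1 :: List.ofFn (fun i : Fin n => u i.succ.succ) := by
      rw [List.ofFn_succ]; rfl
    rw [chainKernel, chainKernel_eq_chainKernelList (Fin.tail u), e, e']
    rfl

theorem chainKernelList_append (x y : ℂ) (l₂ : List ℂ) : ∀ l₁ : List ℂ,
    chainKernelList (l₁ ++ x :: y :: l₂) =
      (x - y)⁻¹ * (chainKernelList (l₁ ++ [x]) * chainKernelList (y :: l₂))
  | [] => by simp [chainKernelList]
  | [c] => by simp [chainKernelList]; ring
  | c :: d :: l => by
    have := chainKernelList_append x y l₂ (d :: l)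
    simp only [List.cons_append, chainKernelList] at this ⊢
    rw [this]; ring

theorem chainKernel_smul : ∀ {n : ℕ} (r : ℂ) (u : Fin n → ℂ),
    chainKernel (fun i => r * u i) = (r⁻¹) ^ (n - 1) * chainKernel u
  | 0, _, _ => by simp [chainKernel]
  | 1, _, _ => by simp [chainKernel]
  | n + 2, r, u => by
    have := chainKernel_smul r (Fin.tail u)
    have e : Fin.tail (fun i => r * u i) = fun i => r * Fin.tail u i := rfl
    rw [chainKernel, e, this, chainKernel, ← mul_sub, mul_inv,
      show n + 2 - 1 = (n + 1 - 1) + 1 by omega, pow_succ]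
    ring

theorem orthantMeasure_eq (n : ℕ) :
    orthantMeasure n = (volume : Measure (Fin n → ℝ)).restrict (univ.pi fun _ => Ioi 0) := by
  rw [orthantMeasure, volume_pi, Measure.restrict_pi_pi]

/-- Substituting r x for x gives r^{-n} from the measure and r^{n-1} from the n - 1 kernel factors.
-/
theorem chainIntegral_smul {n : ℕ} (hn : 1 ≤ n) (z a : Fin n → ℂ) {r : ℝ} (hr : 0 < r) :
    chainIntegral (fun i => (r : ℂ) * z i) a = (r : ℂ)⁻¹ * chainIntegral z a := by
  have h1 : ∀ x : Fin n → ℝ, chainIntegrand (fun i => (r : ℂ) * z i) a x =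
      (r : ℂ) ^ (n - 1) * chainIntegrand z a (r • x) := by
    intro x
    have e : (fun i => a i * (((r • x) i : ℝ) : ℂ)) = fun i => (r : ℂ) * (a i * x i) := by
      ext i; simp; ring
    rw [chainIntegrand, chainIntegrand, e, chainKernel_smul]
    have e2 : ∑ i, (r : ℂ) * z i * (a i * x i) = ∑ i, z i * (a i * (((r • x) i : ℝ) : ℂ)) := by
      refine Finset.sum_congr rfl fun i _ => ?_
      simp; ring
    rw [e2]
    have hr0 : (r : ℂ) ≠ 0 := by exact_mod_cast hr.ne'
    have e3 : (r : ℂ) ^ (n - 1) * (r : ℂ)⁻¹ ^ (n - 1) = 1 := by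
      rw [← mul_pow, mul_inv_cancel₀ hr0, one_pow]
    linear_combination (-Complex.exp (-∑ i, z i * (a i * (((r • x) i : ℝ) : ℂ))) *
      (chainKernel (fun i => a i * x i) * ∏ i, a i)) * e3
  open scoped Pointwise in
  have h2 : r • (univ.pi fun _ : Fin n => Ioi (0 : ℝ)) = univ.pi fun _ => Ioi 0 := by
    ext x
    rw [mem_smul_set_iff_inv_smul_mem₀ hr.ne']
    simp only [Set.mem_pi, mem_univ, true_implies, mem_Ioi, Pi.smul_apply, smul_eq_mul]
    refine forall_congr' fun i => ?_
    rw [mul_pos_iff_of_pos_left (inv_pos.mpr hr)]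
  rw [chainIntegral, chainIntegral, orthantMeasure_eq]
  simp_rw [h1]
  rw [integral_const_mul, Measure.setIntegral_comp_smul_of_pos _ _ _ hr, h2, Module.finrank_fin_fun]
  have hr0 : (r : ℂ) ≠ 0 := by exact_mod_cast hr.ne'
  rw [Complex.real_smul, ← mul_assoc]
  congr 1
  push_cast
  obtain ⟨m, rfl⟩ : ∃ m, n = m + 1 := ⟨n - 1, by omega⟩
  rw [Nat.add_sub_cancel, pow_succ]
  field_simp

/-- Euler's identity for homogeneity of degree -1. -/
theorem fderiv_chainIntegral_self {n : ℕ} (hn : 1 ≤ n) {z a : Fin n → ℂ} (ha : ChainGeneric a)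
    (hza : ∀ i, 0 < (z i * a i).re) :
    fderiv ℂ (fun z => chainIntegral z a) z z = -chainIntegral z a := by
  have hd := (hasFDerivAt_chainIntegral hn ha hza).2.differentiableAt.hasFDerivAt
  have h0 : HasDerivAt (fun r : ℝ => (r : ℂ)) 1 1 := Complex.ofRealCLM.hasDerivAt
  have h1 : HasDerivAt (fun r : ℝ => fun i => (r : ℂ) * z i) z 1 := by
    rw [hasDerivAt_pi]
    intro i
    simpa using h0.mul_const (z i)
  have hd' : HasFDerivAt (fun z => chainIntegral z a)
      ((fderiv ℂ (fun z => chainIntegral z a) z).restrictScalars ℝ)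
      (fun i => ((1 : ℝ) : ℂ) * z i) := by
    simpa using hd.restrictScalars ℝ
  have h2 := hd'.comp_hasDerivAt (1 : ℝ) h1
  have h3 : HasDerivAt (fun r : ℝ => (r : ℂ)⁻¹ * chainIntegral z a) (-chainIntegral z a) 1 := by
    have := (h0.fun_inv (by simp)).mul_const (chainIntegral z a)
    simpa using this
  have h4 : (fun r : ℝ => (r : ℂ)⁻¹ * chainIntegral z a) =ᶠ[𝓝 1]
      (fun z => chainIntegral z a) ∘ fun r : ℝ => fun i => (r : ℂ) * z i := by
    filter_upwards [lt_mem_nhds (zero_lt_one' ℝ)] with r hr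
    exact (chainIntegral_smul hn z a hr).symm
  have h5 := h2.congr_of_eventuallyEq h4
  simpa using h5.unique h3

theorem measurePreserving_append (p q : ℕ) :
    ∃ e : (Fin p → ℝ) × (Fin q → ℝ) ≃ᵐ (Fin (p + q) → ℝ),
      MeasurePreserving e ((orthantMeasure p).prod (orthantMeasure q)) (orthantMeasure (p + q)) ∧
      ∀ x, e x = Fin.append x.1 x.2 := by
  have h1 := measurePreserving_sumPiEquivProdPi_symm
    (X := fun _ : Fin p ⊕ Fin q => ℝ) (fun _ => volume.restrict (Ioi (0 : ℝ)))
  have h2 := measurePreserving_piCongrLeft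
    (fun _ : Fin (p + q) => volume.restrict (Ioi (0 : ℝ))) finSumFinEquiv
  refine ⟨(MeasurableEquiv.sumPiEquivProdPi fun _ => ℝ).symm.trans
    (MeasurableEquiv.piCongrLeft (fun _ => ℝ) finSumFinEquiv), h2.comp h1, fun x => ?_⟩
  ext i
  refine Fin.addCases (fun i => ?_) (fun i => ?_) i
  · rw [Fin.append_left, ← finSumFinEquiv_apply_left]
    exact Equiv.piCongrLeft_apply_apply (fun _ => ℝ) finSumFinEquiv _ _
  · rw [Fin.append_right, ← finSumFinEquiv_apply_right]
    exact Equiv.piCongrLeft_apply_apply (fun _ => ℝ) finSumFinEquiv _ _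

/-- The factor cancelled here is the only one that links the two parts of the chain. -/
theorem chainKernel_append {p q : ℕ} (u : Fin (p + 1 + (q + 1)) → ℂ)
    (h : u (Fin.castAdd (q + 1) (Fin.last p)) ≠ u (Fin.natAdd (p + 1) 0)) :
    (u (Fin.castAdd (q + 1) (Fin.last p)) - u (Fin.natAdd (p + 1) 0)) * chainKernel u =
      chainKernel (fun i => u (Fin.castAdd (q + 1) i)) *
        chainKernel fun i => u (Fin.natAdd (p + 1) i) := by
  have e1 : List.ofFn (fun i => u (Fin.castAdd (q + 1) i)) =
      List.ofFn (fun i : Fin p => u (Fin.castAdd (q + 1) i.castSucc)) ++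
        [u (Fin.castAdd (q + 1) (Fin.last p))] := by
    rw [List.ofFn_succ', List.concat_eq_append]
  have e2 : List.ofFn (fun i => u (Fin.natAdd (p + 1) i)) =
      u (Fin.natAdd (p + 1) 0) :: List.ofFn (fun i : Fin q => u (Fin.natAdd (p + 1) i.succ)) := by
    rw [List.ofFn_succ]
  have e3 : List.ofFn u = List.ofFn (fun i => u (Fin.castAdd (q + 1) i)) ++
      List.ofFn (fun i => u (Fin.natAdd (p + 1) i)) := List.ofFn_add
  rw [chainKernel_eq_chainKernelList, chainKernel_eq_chainKernelList,
    chainKernel_eq_chainKernelList, e3, e1, e2, List.append_assoc, List.singleton_append,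
    chainKernelList_append, ← mul_assoc, mul_inv_cancel₀ (sub_ne_zero.mpr h), one_mul]

theorem mul_ofReal_sub_ne_zero {a b : ℂ} (h : ¬ SameRay ℝ a b) {x y : ℝ} (hx : 0 < x)
    (hy : 0 < y) : a * x ≠ b * y := by
  obtain ⟨κ, hκ, hb⟩ := exists_mul_add_le_norm_sub h
  rw [← sub_ne_zero, ← norm_pos_iff]
  exact lt_of_lt_of_le (by positivity) (hb x y hx.le hy.le)

/-- Once the linking factor is cancelled the integrand is a product in separate variables. This is
the source of the quadratic terms in the differential equation. -/
theorem integral_chainIntegrand_mul_sub {p q : ℕ} {z a : Fin (p + 1 + (q + 1)) → ℂ}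
    (ha : ChainGeneric a) :
    ∫ x, chainIntegrand z a x *
        (a (Fin.castAdd (q + 1) (Fin.last p)) * x (Fin.castAdd (q + 1) (Fin.last p)) -
          a (Fin.natAdd (p + 1) 0) * x (Fin.natAdd (p + 1) 0)) ∂(orthantMeasure _) =
      chainIntegral (fun i => z (Fin.castAdd (q + 1) i)) (fun i => a (Fin.castAdd (q + 1) i)) *
        chainIntegral (fun i => z (Fin.natAdd (p + 1) i)) fun i => a (Fin.natAdd (p + 1) i) := by
  obtain ⟨e, he, hex⟩ := measurePreserving_append (p + 1) (q + 1)
  rw [chainIntegral, chainIntegral, ← integral_prod_mul, ← he.integral_comp']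
  refine integral_congr_ae ?_
  have hpos := he.quasiMeasurePreserving.ae (ae_orthantMeasure_pos (p + 1 + (q + 1)))
  filter_upwards [hpos] with x hx
  have hL : ∀ i, (e x) (Fin.castAdd (q + 1) i) = x.1 i := fun i => by
    rw [hex, Fin.append_left]
  have hR : ∀ i, (e x) (Fin.natAdd (p + 1) i) = x.2 i := fun i => by
    rw [hex, Fin.append_right]
  have hray := ha p (by omega)
  have hne := mul_ofReal_sub_ne_zero hray (hx (Fin.castAdd (q + 1) (Fin.last p)))
    (hx (Fin.natAdd (p + 1) 0))
  have hK := chainKernel_append (fun i => a i * (e x) i) hne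
  have hI : chainIntegrand z a (e x) =
      Complex.exp (-∑ i, z (Fin.castAdd (q + 1) i) * (a (Fin.castAdd (q + 1) i) * x.1 i)) *
      Complex.exp (-∑ i, z (Fin.natAdd (p + 1) i) * (a (Fin.natAdd (p + 1) i) * x.2 i)) *
      (chainKernel (fun i => a i * (e x) i) * ((∏ i, a (Fin.castAdd (q + 1) i)) *
        ∏ i, a (Fin.natAdd (p + 1) i))) := by
    rw [chainIntegrand, Fin.sum_univ_add, Fin.prod_univ_add, ← Complex.exp_add, ← neg_add]
    simp only [hL, hR]
  simp only [hL, hR] at hK ⊢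
  rw [hI]
  simp only [chainIntegrand]
  linear_combination (Complex.exp (-∑ i, z (Fin.castAdd (q + 1) i) *
    (a (Fin.castAdd (q + 1) i) * x.1 i)) * Complex.exp (-∑ i, z (Fin.natAdd (p + 1) i) *
    (a (Fin.natAdd (p + 1) i) * x.2 i)) * (∏ i, a (Fin.castAdd (q + 1) i)) *
    ∏ i, a (Fin.natAdd (p + 1) i)) * hK

theorem tupleSlice_castAdd {p q : ℕ} (z : Fin (p + q) → ℂ) :
    tupleSlice z 0 p = fun i => z (Fin.castAdd q i) := by
  ext i
  rw [tupleSlice, dif_pos (by omega)]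
  congr 1
  ext
  simp

theorem tupleSlice_natAdd {p q : ℕ} (z : Fin (p + q) → ℂ) :
    tupleSlice z p q = fun i => z (Fin.natAdd p i) := by
  ext i
  rw [tupleSlice, dif_pos (by omega)]
  rfl

theorem integral_chainIntegrand_mul_sub_tupleSlice {n : ℕ} {z a : Fin n → ℂ}
    (ha : ChainGeneric a) (k : ℕ) (hk : k + 1 < n) :
    ∫ x, chainIntegrand z a x * (a ⟨k, Nat.lt_of_succ_lt hk⟩ * x ⟨k, Nat.lt_of_succ_lt hk⟩ -
        a ⟨k + 1, hk⟩ * x ⟨k + 1, hk⟩) ∂(orthantMeasure n) =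
      chainIntegral (tupleSlice z 0 (k + 1)) (tupleSlice a 0 (k + 1)) *
        chainIntegral (tupleSlice z (k + 1) (n - (k + 1))) (tupleSlice a (k + 1) (n - (k + 1))) := by
  obtain ⟨q, rfl⟩ : ∃ q, n = k + 1 + (q + 1) := ⟨n - (k + 2), by omega⟩
  have e : k + 1 + (q + 1) - (k + 1) = q + 1 := by omega
  rw [e, tupleSlice_castAdd, tupleSlice_castAdd, tupleSlice_natAdd, tupleSlice_natAdd,
    ← integral_chainIntegrand_mul_sub ha]
  rfl

theorem sum_tupleSlice_zero {n : ℕ} (y : Fin n → ℂ) (k : ℕ) :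
    ∑ i, tupleSlice y 0 k i = ∑ i ∈ Finset.range k, if h : i < n then y ⟨i, h⟩ else 0 := by
  rw [← Fin.sum_univ_eq_sum_range (fun i => if h : i < n then y ⟨i, h⟩ else 0)]
  simp [tupleSlice]

theorem sum_tupleSlice_zero_add {n : ℕ} (y : Fin n → ℂ) {k : ℕ} (hk : k ≤ n) :
    ∑ i, tupleSlice y 0 k i + ∑ i, tupleSlice y k (n - k) i = ∑ i, y i := by
  obtain ⟨q, rfl⟩ := Nat.exists_eq_add_of_le hk
  rw [Nat.add_sub_cancel_left, tupleSlice_castAdd, tupleSlice_natAdd, Fin.sum_univ_add]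

/-- Summation by parts for weights of total sum zero. -/
theorem sum_mul_eq_sum_partial_mul_sub {n : ℕ} (hn : 1 ≤ n) (y u : Fin n → ℂ)
    (hy : ∑ i, y i = 0) :
    ∑ i, y i * u i = ∑ k ∈ Finset.range (n - 1), if hk : k + 1 < n then
      (∑ i, tupleSlice y 0 (k + 1) i) * (u ⟨k, Nat.lt_of_succ_lt hk⟩ - u ⟨k + 1, hk⟩) else 0 := by
  set f : ℕ → ℂ := fun i => if h : i < n then u ⟨i, h⟩ else 0 with hf
  set g : ℕ → ℂ := fun i => if h : i < n then y ⟨i, h⟩ else 0 with hg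
  have h1 : ∑ i, y i * u i = ∑ i ∈ Finset.range n, f i • g i := by
    rw [← Fin.sum_univ_eq_sum_range (fun i => f i • g i)]
    refine Finset.sum_congr rfl fun i _ => ?_
    simp [hf, hg, mul_comm]
  have h2 : ∑ i ∈ Finset.range n, g i = 0 := by
    rw [← hy, ← Fin.sum_univ_eq_sum_range g]
    refine Finset.sum_congr rfl fun i _ => ?_
    simp [hg]
  rw [h1, Finset.sum_range_by_parts, h2, smul_zero, zero_sub, ← Finset.sum_neg_distrib]
  refine Finset.sum_congr rfl fun k hk => ?_
  rw [Finset.mem_range] at hk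
  have hk' : k + 1 < n := by omega
  rw [dif_pos hk', sum_tupleSlice_zero]
  simp only [hf, hk', Nat.lt_of_succ_lt hk', dif_pos, smul_eq_mul]
  ring

/-- The derivative of the chain integral along vectors with vanishing coordinate sum. -/
theorem fderiv_chainIntegral_of_sum_eq_zero {n : ℕ} (hn : 1 ≤ n) {z a : Fin n → ℂ}
    (ha : ChainGeneric a) (hza : ∀ i, 0 < (z i * a i).re) (y : Fin n → ℂ) (hy : ∑ i, y i = 0) :
    fderiv ℂ (fun z => chainIntegral z a) z y = -∑ k ∈ Finset.Ico 1 n,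
      (∑ i, tupleSlice y 0 k i) * (chainIntegral (tupleSlice z 0 k) (tupleSlice a 0 k) *
        chainIntegral (tupleSlice z k (n - k)) (tupleSlice a k (n - k))) := by
  rw [fderiv_chainIntegral_apply hn ha hza]
  have hint : ∀ i : Fin n, Integrable (fun x => chainIntegrand z a x * (a i * x i))
      (orthantMeasure n) := by
    intro i
    have := ((hasFDerivAt_chainIntegral hn ha hza).1.apply_continuousLinearMap
      (Pi.single i (-1)))
    refine this.congr (Eventually.of_forall fun x => ?_)
    simp [phaseForm_apply, Pi.single_apply]
  have h1 : ∀ x, chainIntegrand z a x * -∑ i, y i * (a i * x i) =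
      ∑ k ∈ Finset.range (n - 1), if hk : k + 1 < n then
        -(∑ i, tupleSlice y 0 (k + 1) i) * (chainIntegrand z a x *
          (a ⟨k, Nat.lt_of_succ_lt hk⟩ * x ⟨k, Nat.lt_of_succ_lt hk⟩ -
            a ⟨k + 1, hk⟩ * x ⟨k + 1, hk⟩)) else 0 := by
    intro x
    rw [sum_mul_eq_sum_partial_mul_sub hn y _ hy, ← Finset.sum_neg_distrib, Finset.mul_sum]
    refine Finset.sum_congr rfl fun k _ => ?_
    split_ifs
    · ring
    · simp
  simp_rw [h1]
  rw [integral_finsetSum]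
  · rw [← Finset.sum_neg_distrib, Finset.sum_Ico_eq_sum_range]
    refine Finset.sum_congr rfl fun k hk => ?_
    rw [Finset.mem_range] at hk
    have hk' : k + 1 < n := by omega
    simp only [dif_pos hk']
    rw [integral_const_mul, integral_chainIntegrand_mul_sub_tupleSlice ha k hk', add_comm 1 k]
    ring
  · intro k hk
    rw [Finset.mem_range] at hk
    have hk' : k + 1 < n := by omega
    simp only [dif_pos hk']
    refine Integrable.const_mul ?_ _
    simp_rw [mul_sub]
    exact (hint _).sub (hint _)

/-- The function `(∑ z_i) · chainIntegral z a` satisfies the differential equation. -/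
theorem sum_mul_chainIntegral_deriv {n : ℕ} (hn : 1 ≤ n) {z a : Fin n → ℂ}
    (ha : ChainGeneric a) (hza : ∀ i, 0 < (z i * a i).re) (v : Fin n → ℂ) :
    fderiv ℂ (fun z => (∑ i, z i) * chainIntegral z a) z v = ∑ k ∈ Finset.Ico 1 n,
      (chainIntegral (tupleSlice z 0 k) (tupleSlice a 0 k) *
        chainIntegral (tupleSlice z k (n - k)) (tupleSlice a k (n - k))) *
      ((∑ i, tupleSlice z 0 k i) * (∑ i, tupleSlice v k (n - k) i) -
        (∑ i, tupleSlice z k (n - k) i) * (∑ i, tupleSlice v 0 k i)) := by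
  have hd := (hasFDerivAt_chainIntegral hn ha hza).2.differentiableAt
  have hs : HasFDerivAt (fun z : Fin n → ℂ => ∑ i, z i)
      (∑ i, ContinuousLinearMap.proj (R := ℂ) (φ := fun _ : Fin n => ℂ) i) z :=
    HasFDerivAt.fun_sum fun i _ => hasFDerivAt_apply i z
  rw [(hs.fun_mul hd.hasFDerivAt).fderiv]
  set s := ∑ i, z i
  set t := ∑ i, v i
  -- The vector s v - t z has coordinate sum zero, so the zero-sum formula applies to it; Euler's
  -- identity handles the direction `z`.
  have h0 : ∑ i, (s * v i - t * z i) = 0 := by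
    rw [Finset.sum_sub_distrib, ← Finset.mul_sum, ← Finset.mul_sum]
    ring
  have h1 := fderiv_chainIntegral_of_sum_eq_zero hn ha hza (s • v - t • z)
    (by simpa using h0)
  rw [map_sub, map_smul, map_smul, fderiv_chainIntegral_self hn ha hza] at h1
  have h2 : ((s • fderiv ℂ (fun z => chainIntegral z a) z +
      chainIntegral z a • ∑ i, ContinuousLinearMap.proj (R := ℂ) (φ := fun _ : Fin n => ℂ) i :
        (Fin n → ℂ) →L[ℂ] ℂ) v) =
      s * fderiv ℂ (fun z => chainIntegral z a) z v + chainIntegral z a * t := by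
    simp [t]
  rw [h2]
  simp only [smul_eq_mul] at h1
  rw [show s * fderiv ℂ (fun z => chainIntegral z a) z v + chainIntegral z a * t =
    s * fderiv ℂ (fun z => chainIntegral z a) z v - t * -chainIntegral z a by ring, h1,
    ← Finset.sum_neg_distrib]
  refine Finset.sum_congr rfl fun k hk => ?_
  rw [Finset.mem_Ico] at hk
  have h3 : ∑ i, tupleSlice (s • v - t • z) 0 k i =
      s * ∑ i, tupleSlice v 0 k i - t * ∑ i, tupleSlice z 0 k i := by
    rw [Finset.mul_sum, Finset.mul_sum, ← Finset.sum_sub_distrib]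
    refine Finset.sum_congr rfl fun i _ => ?_
    simp only [tupleSlice]
    split_ifs <;> simp
  rw [h3]
  have h4 := sum_tupleSlice_zero_add z hk.2.le
  have h5 := sum_tupleSlice_zero_add v hk.2.le
  simp only [s, t]
  rw [← h4, ← h5]
  ring

end ChainIntegralDerivative

/-! ### Integrating out a single contour -/

section ContourRotation
open MeasureTheory Set Filter Topology

open scoped ComplexOrder in
-- This form makes genericity an open condition, and it is the domain on which the logarithm of the
-- quotient is holomorphic.
theorem not_sameRay_iff_neg_div_mem_slitPlane {a b : ℂ} (ha : a ≠ 0) (hb : b ≠ 0) :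
    ¬ SameRay ℝ a b ↔ -b / a ∈ Complex.slitPlane := by
  rw [Complex.mem_slitPlane_iff_not_le_zero, not_iff_not]
  constructor
  · intro h
    obtain ⟨r, hr, h⟩ := h.exists_pos_left ha hb
    rw [← h, Complex.real_smul, neg_div, mul_div_cancel_right₀ _ ha]
    rw [neg_nonpos]
    exact_mod_cast hr.le
  · intro h
    have h1 : -b / a = (((-b / a).re : ℝ) : ℂ) := by
      apply Complex.ext
      · simp
      · have := (Complex.le_def.mp h).2
        simpa using this
    have h2 : b = ((-(-b / a).re : ℝ) : ℂ) * a := by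
      push_cast
      rw [← h1]
      field_simp
    have h3 : 0 ≤ -(-b / a).re := by
      have := (Complex.le_def.mp h).1
      simp only [Complex.zero_re] at this
      linarith
    rw [h2, ← Complex.real_smul]
    exact SameRay.nonneg_smul_right SameRay.rfl h3

theorem neg_mul_ofReal_div_mem_slitPlane {a b : ℂ} (ha : a ≠ 0) (hb : b ≠ 0)
    (h : ¬ SameRay ℝ a b) {x : ℝ} (hx : 0 < x) : -(b * x) / a ∈ Complex.slitPlane := by
  rw [← not_sameRay_iff_neg_div_mem_slitPlane ha
    (mul_ne_zero hb (by exact_mod_cast hx.ne'))]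
  intro h'
  apply h
  have := h'.pos_smul_right (inv_pos.mpr hx)
  rw [Complex.real_smul] at this
  convert this using 1
  have : (x : ℂ) ≠ 0 := by exact_mod_cast hx.ne'
  push_cast
  field_simp

theorem inv_mem_slitPlane_of_re_pos {b : ℂ} (hb : 0 < b.re) : 1 / b ∈ Complex.slitPlane := by
  rw [one_div]
  refine Or.inl ?_
  rw [Complex.inv_re]
  exact div_pos hb (Complex.normSq_pos.mpr (ne_zero_of_re_pos hb))

/-- The Cauchy transform `∫_0^∞ e^{-zat} a / (at - u) dt` over the ray through `a`. -/
noncomputable def rayTransform (z a u : ℂ) : ℂ := expIntegral (z * a) (z * u)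

theorem rayTransform_eq_integral {z : ℂ} (hz : z ≠ 0) (a u : ℂ) :
    rayTransform z a u =
      ∫ t in Ioi (0 : ℝ), Complex.exp (-(z * (a * t))) * (a * (a * t - u)⁻¹) := by
  rw [rayTransform, expIntegral]
  congr 1
  ext t
  rw [mul_assoc, ← mul_sub, mul_div_mul_left _ _ hz, div_eq_mul_inv]

theorem integrableOn_rayTransform {z a u : ℂ} (hz : z ≠ 0) (h : 0 < (z * a).re)
    (hu : -u / a ∈ Complex.slitPlane) :
    IntegrableOn (fun t : ℝ => Complex.exp (-(z * (a * t))) * (a * (a * t - u)⁻¹)) (Ioi 0) := by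
  have := integrableOn_expIntegral (b := z * a) (τ := z * u) h
    (by rwa [← mul_neg, mul_div_mul_left _ _ hz])
  refine this.congr_fun (fun t _ => ?_) measurableSet_Ioi
  simp only
  rw [mul_assoc, ← mul_sub, mul_div_mul_left _ _ hz, div_eq_mul_inv]

/-- In the logarithmic formula the function `T` does not see the slope, and the two logarithms have
the same derivative with respect to it. -/
theorem rayTransform_eq_of_isPreconnected {z u : ℂ} {U : Set ℂ} (hU : IsOpen U)
    (hc : IsPreconnected U) (hre : ∀ a ∈ U, 0 < (z * a).re)
    (hu : ∀ a ∈ U, -u / a ∈ Complex.slitPlane) {a b : ℂ} (ha : a ∈ U) (hb : b ∈ U) :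
    rayTransform z a u = rayTransform z b u := by
  obtain ⟨T, hT⟩ := exists_exp_mul_expIntegral_eq
  have hz : z ≠ 0 := by
    rintro rfl
    simpa using hre a ha
  have hform : ∀ c ∈ U, Complex.exp (z * u) * rayTransform z c u =
      T (z * u) + (Complex.log (1 / (z * c)) - Complex.log (-u / c)) := by
    intro c hc
    have := hT (z * c) (z * u) (hre c hc) (by
      rw [← mul_neg, mul_div_mul_left _ _ hz]; exact hu c hc)
    rw [← mul_neg, mul_div_mul_left _ _ hz] at this
    exact this
  have hder : ∀ c ∈ U, HasDerivAt
      (fun c => Complex.log (1 / (z * c)) - Complex.log (-u / c)) 0 c := by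
    intro c hc
    have hc0 : c ≠ 0 := by
      rintro rfl
      simpa using hre 0 hc
    have hu0 : u ≠ 0 := by
      rintro rfl
      simpa using hu c hc
    have h1 : HasDerivAt (fun c : ℂ => c⁻¹) (-(c ^ 2)⁻¹) c := hasDerivAt_inv hc0
    have h2 : HasDerivAt (fun c : ℂ => 1 / (z * c)) (z⁻¹ * -(c ^ 2)⁻¹) c := by
      have e : (fun c : ℂ => 1 / (z * c)) = fun c => z⁻¹ * c⁻¹ := by
        ext c; rw [one_div, mul_inv]
      rw [e]
      exact h1.const_mul z⁻¹
    have h3 : HasDerivAt (fun c : ℂ => -u / c) (-u * -(c ^ 2)⁻¹) c := by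
      simpa [div_eq_mul_inv] using h1.const_mul (-u)
    refine ((h2.clog (inv_mem_slitPlane_of_re_pos (hre c hc))).sub
      (h3.clog (hu c hc))).congr_deriv ?_
    field_simp
    ring
  have := hU.is_const_of_deriv_eq_zero hc
    (fun c hc => (hder c hc).differentiableAt.differentiableWithinAt)
    (fun c hc => (hder c hc).deriv) ha hb
  have h1 := hform a ha
  have h2 := hform b hb
  rw [this] at h1
  exact mul_left_cancel₀ (Complex.exp_ne_zero _) (h1.trans h2.symm)

/-- The factor by which `chainKernel` changes when `s` is inserted at position `k`. -/
noncomputable def insertionFactor {m : ℕ} (k : Fin (m + 2)) (y : Fin (m + 1) → ℂ) (s : ℂ) : ℂ :=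
  (if h : (k : ℕ) < m + 1 then (s - y ⟨k, h⟩)⁻¹ else 0) +
    if _h : 0 < (k : ℕ) then (y ⟨k - 1, by omega⟩ - s)⁻¹ else 0

theorem insertNth_succ_eq_cons {m : ℕ} {α : Type*} (k : Fin (m + 1)) (s : α) (y : Fin (m + 1) → α) :
    Fin.insertNth (α := fun _ => α) k.succ s y =
      Fin.cons (α := fun _ => α) (y 0) (Fin.insertNth (α := fun _ => α) k s (Fin.tail y)) := by
  symm
  rw [Fin.eq_insertNth_iff]
  refine ⟨by simp, ?_⟩
  ext i
  refine Fin.cases ?_ (fun i => ?_) i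
  · simp [Fin.removeNth]
  · simp [Fin.removeNth, Fin.tail]

/-- Partial fractions: 1/((p-s)(s-q)) = (1/(p-q)) (1/(p-s) + 1/(s-q)). The inserted variable then
occurs only in simple Cauchy kernels at its neighbours, which integrate to ray transforms; at an end
of the chain there is only one such kernel. -/
theorem chainKernel_insertNth : ∀ {m : ℕ} (k : Fin (m + 2)) (y : Fin (m + 1) → ℂ) (s : ℂ),
    (∀ h : (k : ℕ) < m + 1, s ≠ y ⟨k, h⟩) → (∀ _h : 0 < (k : ℕ), y ⟨k - 1, by omega⟩ ≠ s) →
    (∀ (_h : 0 < (k : ℕ)) (h : (k : ℕ) < m + 1), y ⟨k - 1, by omega⟩ ≠ y ⟨k, h⟩) →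
    chainKernel (Fin.insertNth (α := fun _ => ℂ) k s y) =
      chainKernel y * insertionFactor k y s := by
  intro m
  induction m with
  | zero =>
    intro k y s h1 h2 h3
    refine Fin.cases ?_ (fun k => ?_) k
    · rw [Fin.insertNth_zero']
      simp [chainKernel, insertionFactor]
    · obtain rfl : k = 0 := Subsingleton.elim _ _
      rw [insertNth_succ_eq_cons]
      simp [chainKernel, insertionFactor]
  | succ m ih =>
    intro k
    refine Fin.cases ?_ (fun k => ?_) k
    · intro y s h1 h2 h3
      rw [Fin.insertNth_zero']
      simp [chainKernel, insertionFactor]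
      ring
    · intro y s h1 h2 h3
      rw [insertNth_succ_eq_cons]
      have e1 : chainKernel (Fin.cons (α := fun _ => ℂ) (y 0)
          (Fin.insertNth (α := fun _ => ℂ) k s (Fin.tail y))) =
          (y 0 - Fin.insertNth (α := fun _ => ℂ) k s (Fin.tail y) 0)⁻¹ *
          chainKernel (Fin.insertNth (α := fun _ => ℂ) k s (Fin.tail y)) := rfl
      have e2 : chainKernel y = (y 0 - y 1)⁻¹ * chainKernel (Fin.tail y) := rfl
      have hih := ih k (Fin.tail y) s (fun h => h1 (by simpa using h))
        (fun h => by
          have e : Fin.tail y ⟨k - 1, by omega⟩ = y ⟨k.succ - 1, by simp; omega⟩ :=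
            congrArg y (Fin.ext (by simp; omega))
          rw [e]
          exact h2 (by simp))
        (fun h h' => by
          have e : Fin.tail y ⟨k - 1, by omega⟩ = y ⟨k.succ - 1, by simp; omega⟩ :=
            congrArg y (Fin.ext (by simp; omega))
          rw [e]
          exact h3 (by simp) (by simpa using h'))
      rw [e1, e2, hih]
      revert h1 h2 h3
      refine Fin.cases ?_ (fun j => ?_) k
      · intro h1 h2 h3
        have h1' := sub_ne_zero.mpr (h1 (by simp))
        have h2' := sub_ne_zero.mpr (h2 (by simp))
        have h3' := sub_ne_zero.mpr (h3 (by simp) (by simp))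
        simp [insertionFactor, Fin.tail] at h1' h2' h3' ⊢
        field_simp
        ring
      · intro h1 h2 h3
        rw [insertNth_succ_eq_cons]
        have e3 : insertionFactor j.succ.succ y s = insertionFactor j.succ (Fin.tail y) s := by
          simp [insertionFactor, Fin.tail]
          rfl
        rw [e3, Fin.cons_zero]
        simp only [Fin.tail, Fin.succ_zero_eq_one]
        ring

/-- The integral of `insertionFactor` along a ray. -/
noncomputable def insertionIntegral {m : ℕ} (k : Fin (m + 2)) (ζ α : ℂ) (y : Fin (m + 1) → ℂ) : ℂ :=
  (if h : (k : ℕ) < m + 1 then rayTransform ζ α (y ⟨k, h⟩) else 0) -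
    if _h : 0 < (k : ℕ) then rayTransform ζ α (y ⟨k - 1, by omega⟩) else 0

theorem integral_insertionFactor {m : ℕ} (k : Fin (m + 2)) {ζ α : ℂ} (y : Fin (m + 1) → ℂ)
    (hre : 0 < (ζ * α).re) (h1 : ∀ h : (k : ℕ) < m + 1, -(y ⟨k, h⟩) / α ∈ Complex.slitPlane)
    (h2 : ∀ _h : 0 < (k : ℕ), -(y ⟨k - 1, by omega⟩) / α ∈ Complex.slitPlane) :
    ∫ t in Ioi (0 : ℝ), Complex.exp (-(ζ * (α * t))) * (α * insertionFactor k y (α * t)) =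
      insertionIntegral k ζ α y := by
  have hζ : ζ ≠ 0 := by
    rintro rfl
    simp at hre
  have e : ∀ t : ℝ, Complex.exp (-(ζ * (α * t))) * (α * insertionFactor k y (α * t)) =
      (if h : (k : ℕ) < m + 1 then
        Complex.exp (-(ζ * (α * t))) * (α * (α * t - y ⟨k, h⟩)⁻¹) else 0) -
      if _h : 0 < (k : ℕ) then
        Complex.exp (-(ζ * (α * t))) * (α * (α * t - y ⟨k - 1, by omega⟩)⁻¹) else 0 := by
    intro t
    rw [insertionFactor]
    by_cases hk : (k : ℕ) < m + 1 <;> by_cases hk' : 0 < (k : ℕ)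
    · simp only [hk, hk', dif_pos]
      rw [← neg_sub (α * (t : ℂ)) (y ⟨k - 1, by omega⟩), inv_neg]
      ring
    · simp only [hk, hk', dif_pos, dif_neg, not_false_eq_true]
      ring
    · simp only [hk, hk', dif_pos, dif_neg, not_false_eq_true]
      rw [← neg_sub (α * (t : ℂ)) (y ⟨k - 1, by omega⟩), inv_neg]
      ring
    · simp only [hk, hk', dif_neg, not_false_eq_true]
      ring
  simp_rw [e]
  rw [integral_sub, insertionIntegral]
  · congr 1
    · split_ifs with h
      · exact (rayTransform_eq_integral hζ _ _).symm
      · simp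
    · split_ifs with h
      · exact (rayTransform_eq_integral hζ _ _).symm
      · simp
  · split_ifs with h
    · exact integrableOn_rayTransform hζ hre (h1 h)
    · simp
  · split_ifs with h
    · exact integrableOn_rayTransform hζ hre (h2 h)
    · simp

/-- The exceptional set lies in a proper real subspace, hence is null. This holds even if `a` and
`b` lie on one ray. -/
theorem ae_orthantMeasure_mul_ne {n : ℕ} {i j : Fin n} (hij : i ≠ j) {a : ℂ} (ha : a ≠ 0) (b : ℂ) :
    ∀ᵐ x ∂(orthantMeasure n), a * x i ≠ b * x j := by
  rw [orthantMeasure_eq]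
  refine ae_restrict_of_ae ?_
  let f : (Fin n → ℝ) →ₗ[ℝ] ℂ :=
    { toFun := fun x => a * x i - b * x j
      map_add' := fun x y => by simp; ring
      map_smul' := fun r x => by simp; ring }
  have hf : LinearMap.ker f ≠ ⊤ := by
    intro h
    have : f (Pi.single i 1) = 0 := by
      rw [← LinearMap.mem_ker, h]; trivial
    simp [f, hij.symm, ha] at this
  have := Measure.addHaar_submodule (volume : Measure (Fin n → ℝ)) _ hf
  rw [ae_iff]
  refine measure_mono_null (fun x hx => ?_) this
  simp only [ne_eq, not_not, Set.mem_ofPred_eq] at hx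
  change f x = 0
  simp [f, hx]

/-- Integrating out one variable of a chain integral. -/
theorem chainIntegral_insertNth {m : ℕ} (k : Fin (m + 2)) {ζ α : ℂ} {z a : Fin (m + 1) → ℂ}
    (hA : ChainGeneric (Fin.insertNth (α := fun _ => ℂ) k α a))
    (hre : 0 < (ζ * α).re) (hza : ∀ i, 0 < (z i * a i).re) :
    Integrable (fun x => chainIntegrand z a x * insertionIntegral k ζ α fun i => a i * x i)
      (orthantMeasure (m + 1)) ∧
    chainIntegral (Fin.insertNth (α := fun _ => ℂ) k ζ z)
        (Fin.insertNth (α := fun _ => ℂ) k α a) =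
      ∫ x, chainIntegrand z a x * insertionIntegral k ζ α (fun i => a i * x i)
        ∂(orthantMeasure (m + 1)) := by
  have hα : α ≠ 0 := by rintro rfl; simp at hre
  have ha0 : ∀ i, a i ≠ 0 := fun i h => by have := hza i; simp [h] at this
  have hre' : ∀ i, 0 < (Fin.insertNth (α := fun _ => ℂ) k ζ z i *
      Fin.insertNth (α := fun _ => ℂ) k α a i).re := by
    intro i
    refine Fin.succAboveCases k ?_ (fun j => ?_) i
    · simpa using hre
    · simpa using hza j
  have hint := integrable_chainIntegrand (by omega) hA hre'
  have hmp := (measurePreserving_piFinSuccAbove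
    (fun _ : Fin (m + 2) => volume.restrict (Ioi (0 : ℝ))) k).symm
  have hint' := (hmp.integrable_comp_emb (MeasurableEquiv.measurableEmbedding _)).mpr hint
  have hiter : chainIntegral (Fin.insertNth (α := fun _ => ℂ) k ζ z)
      (Fin.insertNth (α := fun _ => ℂ) k α a) = ∫ x, (∫ t in Ioi (0 : ℝ),
        chainIntegrand (Fin.insertNth (α := fun _ => ℂ) k ζ z)
        (Fin.insertNth (α := fun _ => ℂ) k α a)
        ((MeasurableEquiv.piFinSuccAbove (fun _ => ℝ) k).symm (t, x)))
        ∂(orthantMeasure (m + 1)) := by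
    rw [chainIntegral]
    change ∫ x, (_ : ℂ) ∂(Measure.pi fun _ : Fin (m + 2) => volume.restrict (Ioi (0 : ℝ))) = _
    rw [← hmp.integral_comp']
    exact integral_prod_symm (fun x => chainIntegrand (Fin.insertNth (α := fun _ => ℂ) k ζ z)
      (Fin.insertNth (α := fun _ => ℂ) k α a)
      ((MeasurableEquiv.piFinSuccAbove (fun _ => ℝ) k).symm x)) hint'
  suffices hae : ∀ᵐ x ∂(orthantMeasure (m + 1)),
      ∫ t in Ioi (0 : ℝ), chainIntegrand (Fin.insertNth (α := fun _ => ℂ) k ζ z)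
        (Fin.insertNth (α := fun _ => ℂ) k α a)
        ((MeasurableEquiv.piFinSuccAbove (fun _ => ℝ) k).symm (t, x)) =
      chainIntegrand z a x * insertionIntegral k ζ α fun i => a i * x i from
    ⟨Integrable.congr (f := fun x => ∫ t in Ioi (0 : ℝ),
        chainIntegrand (Fin.insertNth (α := fun _ => ℂ) k ζ z)
        (Fin.insertNth (α := fun _ => ℂ) k α a)
        ((MeasurableEquiv.piFinSuccAbove (fun _ => ℝ) k).symm (t, x)))
        (Integrable.integral_prod_right (f := fun p : ℝ × (Fin (m + 1) → ℝ) =>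
          chainIntegrand (Fin.insertNth (α := fun _ => ℂ) k ζ z)
        (Fin.insertNth (α := fun _ => ℂ) k α a)
        ((MeasurableEquiv.piFinSuccAbove (fun _ => ℝ) k).symm p)) hint') hae,
      hiter.trans (integral_congr_ae hae)⟩
  -- Removing position `k` creates new neighbours that may share a ray, so their variables are
  -- distinct only almost everywhere.
  have hdist : ∀ᵐ x ∂(orthantMeasure (m + 1)), ∀ (h : 0 < (k : ℕ)) (h' : (k : ℕ) < m + 1),
      a ⟨k - 1, by omega⟩ * x ⟨k - 1, by omega⟩ ≠ a ⟨k, h'⟩ * x ⟨k, h'⟩ := by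
    by_cases h : 0 < (k : ℕ)
    · by_cases h' : (k : ℕ) < m + 1
      · filter_upwards [ae_orthantMeasure_mul_ne (i := (⟨k - 1, by omega⟩ : Fin (m + 1)))
          (j := ⟨k, h'⟩) (by simp [Fin.ext_iff]; omega) (ha0 ⟨k - 1, by omega⟩) (a ⟨k, h'⟩)]
          with x hx _ _ using hx
      · exact Eventually.of_forall fun _ _ h'' => absurd h'' h'
    · exact Eventually.of_forall fun _ h'' => absurd h'' h
  filter_upwards [ae_orthantMeasure_pos (m + 1), hdist] with x hx hxd
  have hk1 : ∀ h : (k : ℕ) < m + 1, ¬ SameRay ℝ α (a ⟨k, h⟩) := by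
    intro h
    have := hA k (by omega)
    rw [show (⟨(k : ℕ), _⟩ : Fin (m + 2)) = k from rfl, Fin.insertNth_apply_same,
      show (⟨(k : ℕ) + 1, by omega⟩ : Fin (m + 2)) = k.succAbove ⟨k, h⟩ from
          (Fin.succAbove_of_le_castSucc k ⟨k, h⟩ (Fin.le_def.mpr le_rfl)).symm,
      Fin.insertNth_apply_succAbove] at this
    exact this
  have hk2 : ∀ h : 0 < (k : ℕ), ¬ SameRay ℝ (a ⟨k - 1, by omega⟩) α := by
    intro h
    have := hA (k - 1) (by omega)
    rw [show (⟨(k : ℕ) - 1, by omega⟩ : Fin (m + 2)) = k.succAbove ⟨k - 1, by omega⟩ from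
          (Fin.succAbove_of_castSucc_lt k ⟨k - 1, by omega⟩ (Fin.lt_def.mpr (by
            change (k : ℕ) - 1 < k; omega))).symm,
      show (⟨(k : ℕ) - 1 + 1, by omega⟩ : Fin (m + 2)) = k by ext; simp; omega,
      Fin.insertNth_apply_same, Fin.insertNth_apply_succAbove] at this
    exact this
  have hs1 : ∀ h : (k : ℕ) < m + 1, -(a ⟨k, h⟩ * (x ⟨k, h⟩ : ℂ)) / α ∈ Complex.slitPlane :=
    fun h => neg_mul_ofReal_div_mem_slitPlane hα (ha0 _) (hk1 h) (hx _)
  have hs2 : ∀ h : 0 < (k : ℕ),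
      -(a ⟨k - 1, by omega⟩ * (x ⟨k - 1, by omega⟩ : ℂ)) / α ∈ Complex.slitPlane :=
    fun h => neg_mul_ofReal_div_mem_slitPlane hα (ha0 _)
      (fun h' => hk2 h h'.symm) (hx _)
  rw [← integral_insertionFactor k (fun i => a i * x i) hre hs1 hs2, ← integral_const_mul]
  -- For fixed `x`, the kernel factors into the shorter chain kernel, constant in `t`, and the
  -- insertion factor.
  refine setIntegral_congr_fun measurableSet_Ioi fun t ht => ?_
  have hker := chainKernel_insertNth k (fun i => a i * (x i : ℂ)) (α * t)
    (fun h => mul_ofReal_sub_ne_zero (hk1 h) ht (hx _))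
    (fun h => mul_ofReal_sub_ne_zero (hk2 h) (hx _) ht)
    (fun h h' => hxd h h')
  have hins : (MeasurableEquiv.piFinSuccAbove (fun _ : Fin (m + 2) => ℝ) k).symm (t, x) =
      Fin.insertNth (α := fun _ => ℝ) k t x := rfl
  rw [hins]
  have hfun : (fun i => Fin.insertNth (α := fun _ => ℂ) k α a i *
      ((Fin.insertNth (α := fun _ => ℝ) k t x i : ℝ) : ℂ)) =
      Fin.insertNth (α := fun _ => ℂ) k (α * t) fun i => a i * (x i : ℂ) := by
    ext i
    refine Fin.succAboveCases k ?_ (fun j => ?_) i <;> simp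
  simp only [chainIntegrand]
  rw [hfun, hker, Fin.sum_univ_succAbove _ k, Fin.prod_univ_succAbove _ k]
  simp only [Fin.insertNth_apply_same, Fin.insertNth_apply_succAbove]
  rw [neg_add, Complex.exp_add]
  ring

end ContourRotation

/-! ### Deforming contours and crossing a neighbouring contour -/

section ContourCrossing
open MeasureTheory Set Filter Topology

theorem integral_exp_neg_mul_ofReal {c : ℂ} (hc : 0 < c.re) :
    ∫ t in Ioi (0 : ℝ), Complex.exp (-(c * t)) = c⁻¹ := by
  have hc0 := ne_zero_of_re_pos hc
  have key := integral_Ioi_of_hasDerivAt_of_tendsto' (a := (0 : ℝ)) (m := 0)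
    (f := fun t : ℝ => Complex.exp (-(c * t)) * (-c⁻¹))
    (f' := fun t : ℝ => Complex.exp (-(c * t))) ?_ ?_ ?_
  · rw [key]; simp
  · intro t _
    have h0 : HasDerivAt (fun t : ℝ => (c * t : ℂ)) c t := by
      simpa using (Complex.ofRealCLM.hasDerivAt (x := t)).const_mul c
    refine (h0.fun_neg.cexp.mul_const (-c⁻¹)).congr_deriv ?_
    field_simp
  · simpa using integrableOn_exp_mul_of_bounded (g := fun _ => 1) (C := 1) hc
      continuousOn_const (by simp)
  · exact tendsto_exp_neg_mul_mul_of_bounded hc (C := ‖-c⁻¹‖) fun _ _ => le_rfl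

theorem chainIntegral_one {z a : Fin 1 → ℂ} (h : 0 < (z 0 * a 0).re) :
    chainIntegral z a = (z 0)⁻¹ := by
  have e : ∀ x : Fin 1 → ℝ, chainIntegrand z a x =
      ∏ i : Fin 1, (Complex.exp (-(z i * a i * x i)) * a i) := by
    intro x
    simp [chainIntegrand, chainKernel, mul_assoc]
  rw [chainIntegral]
  simp_rw [e]
  rw [orthantMeasure, integral_fintype_prod_eq_prod
    (fun (i : Fin 1) (t : ℝ) => Complex.exp (-(z i * a i * t)) * a i)]
  rw [Fin.prod_univ_one, integral_mul_const, integral_exp_neg_mul_ofReal h]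
  have := ne_zero_of_re_pos h
  have h1 : z 0 ≠ 0 := left_ne_zero_of_mul this
  have h2 : a 0 ≠ 0 := right_ne_zero_of_mul this
  field_simp

/-- The slopes `a` of contours for which `chainIntegral z a` converges. -/
def admissibleSlopes {n : ℕ} (z : Fin n → ℂ) : Set (Fin n → ℂ) :=
  {a | (∀ i, 0 < (z i * a i).re) ∧ ChainGeneric a}

theorem ne_zero_of_mem_admissibleSlopes {n : ℕ} {z a : Fin n → ℂ}
    (h : a ∈ admissibleSlopes z) (i : Fin n) : a i ≠ 0 := fun h0 => by
  have := h.1 i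
  simp [h0] at this

theorem isOpen_admissibleSlopes {n : ℕ} (z : Fin n → ℂ) : IsOpen (admissibleSlopes z) := by
  rw [isOpen_iff_mem_nhds]
  intro a ha
  have h1 : ∀ᶠ b in 𝓝 a, ∀ i, 0 < (z i * b i).re := by
    rw [eventually_all]
    intro i
    have : ContinuousAt (fun b : Fin n → ℂ => (z i * b i).re) a := by fun_prop
    exact this.eventually_const_lt (ha.1 i)
  have h2 : ∀ᶠ b in 𝓝 a, ∀ k : Fin n, ∀ hk : (k : ℕ) + 1 < n,
      -b ⟨k + 1, hk⟩ / b k ∈ Complex.slitPlane := by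
    rw [eventually_all]
    intro k
    by_cases hk : (k : ℕ) + 1 < n
    · have hc : ContinuousAt (fun b : Fin n → ℂ => -b ⟨k + 1, hk⟩ / b k) a :=
        ContinuousAt.div (continuous_apply _).neg.continuousAt (continuous_apply _).continuousAt (ne_zero_of_mem_admissibleSlopes ha k)
      have := (not_sameRay_iff_neg_div_mem_slitPlane (ne_zero_of_mem_admissibleSlopes ha _)
        (ne_zero_of_mem_admissibleSlopes ha _)).mp (ha.2 k hk)
      filter_upwards [hc.eventually (Complex.isOpen_slitPlane.mem_nhds this)] with b hb _ using hb
    · exact Eventually.of_forall fun _ h => absurd h hk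
  filter_upwards [h1, h2] with b hb1 hb2
  refine ⟨hb1, fun k hk => ?_⟩
  have hb0 : ∀ i, b i ≠ 0 := fun i h0 => by
    have := hb1 i
    simp [h0] at this
  rw [not_sameRay_iff_neg_div_mem_slitPlane (hb0 _) (hb0 _)]
  exact hb2 ⟨k, by omega⟩ hk

/-- After the moving contour is integrated out, its slope survives only in ray transforms at points
of the neighbouring contours. Admissibility throughout `U` keeps these points off the moving ray. -/
theorem chainIntegral_insertNth_eq {m : ℕ} (k : Fin (m + 2)) {ζ α β : ℂ} {z a : Fin (m + 1) → ℂ}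
    {U : Set ℂ} (hU : IsOpen U) (hUc : IsPreconnected U)
    (hadm : ∀ γ ∈ U, Fin.insertNth (α := fun _ => ℂ) k γ a ∈
      admissibleSlopes (Fin.insertNth (α := fun _ => ℂ) k ζ z)) (hα : α ∈ U) (hβ : β ∈ U) :
    chainIntegral (Fin.insertNth (α := fun _ => ℂ) k ζ z)
      (Fin.insertNth (α := fun _ => ℂ) k α a) =
    chainIntegral (Fin.insertNth (α := fun _ => ℂ) k ζ z)
      (Fin.insertNth (α := fun _ => ℂ) k β a) := by
  have hre : ∀ γ ∈ U, 0 < (ζ * γ).re := fun γ hγ => by simpa using (hadm γ hγ).1 k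
  have hza : ∀ i, 0 < (z i * a i).re := fun i => by simpa using (hadm α hα).1 (k.succAbove i)
  have ha0 : ∀ i, a i ≠ 0 := fun i h => by have := hza i; simp [h] at this
  have hγ0 : ∀ γ ∈ U, γ ≠ 0 := fun γ hγ h => by have := hre γ hγ; simp [h] at this
  rw [(chainIntegral_insertNth k (hadm α hα).2 (hre α hα) hza).2,
    (chainIntegral_insertNth k (hadm β hβ).2 (hre β hβ) hza).2]
  refine integral_congr_ae ?_
  filter_upwards [ae_orthantMeasure_pos (m + 1)] with x hx
  simp only [insertionIntegral]
  congr 2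
  · split_ifs with h
    · refine rayTransform_eq_of_isPreconnected hU hUc hre (fun γ hγ => ?_) hα hβ
      refine neg_mul_ofReal_div_mem_slitPlane (hγ0 γ hγ) (ha0 _) ?_ (hx _)
      have := (hadm γ hγ).2 k (by omega)
      rw [show (⟨(k : ℕ), _⟩ : Fin (m + 2)) = k from rfl, Fin.insertNth_apply_same,
        show (⟨(k : ℕ) + 1, by omega⟩ : Fin (m + 2)) = k.succAbove ⟨k, h⟩ from
          (Fin.succAbove_of_le_castSucc k ⟨k, h⟩ (Fin.le_def.mpr le_rfl)).symm,
        Fin.insertNth_apply_succAbove] at this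
      exact this
    · rfl
  · split_ifs with h
    · refine rayTransform_eq_of_isPreconnected hU hUc hre (fun γ hγ => ?_) hα hβ
      refine neg_mul_ofReal_div_mem_slitPlane (hγ0 γ hγ) (ha0 _) ?_ (hx _)
      have := (hadm γ hγ).2 (k - 1) (by omega)
      rw [show (⟨(k : ℕ) - 1, by omega⟩ : Fin (m + 2)) = k.succAbove ⟨k - 1, by omega⟩ from
          (Fin.succAbove_of_castSucc_lt k ⟨k - 1, by omega⟩ (Fin.lt_def.mpr (by
            change (k : ℕ) - 1 < k; omega))).symm,
        show (⟨(k : ℕ) - 1 + 1, by omega⟩ : Fin (m + 2)) = k by ext; simp; omega,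
        Fin.insertNth_apply_same, Fin.insertNth_apply_succAbove] at this
      exact fun h' => this h'.symm
    · rfl

theorem chainIntegral_update_eq {n : ℕ} (k : Fin n) {α β : ℂ} {z a : Fin n → ℂ}
    {U : Set ℂ} (hU : IsOpen U) (hUc : IsPreconnected U)
    (hadm : ∀ γ ∈ U, Function.update a k γ ∈ admissibleSlopes z) (hα : α ∈ U) (hβ : β ∈ U) :
    chainIntegral z (Function.update a k α) = chainIntegral z (Function.update a k β) := by
  match n, k, z, a, hadm with
  | 0, k, _, _, _ => exact k.elim0
  | 1, k, z, a, hadm =>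
    rw [chainIntegral_one ((hadm α hα).1 0), chainIntegral_one ((hadm β hβ).1 0)]
  | m + 2, k, z, a, hadm =>
    have hz : z = Fin.insertNth (α := fun _ => ℂ) k (z k) (Fin.removeNth k z) := by simp
    have ha : ∀ γ, Function.update a k γ =
        Fin.insertNth (α := fun _ => ℂ) k γ (Fin.removeNth k a) := fun γ => by simp
    simp_rw [ha] at hadm ⊢
    rw [hz] at hadm ⊢
    exact chainIntegral_insertNth_eq k hU hUc hadm hα hβ

/-- The slopes are moved one coordinate at a time. In a ball for the sup norm every mixture of `a`
and `b` stays in the ball, hence admissible. -/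
theorem chainIntegral_eventually_eq {n : ℕ} {z a : Fin n → ℂ} (ha : a ∈ admissibleSlopes z) :
    ∀ᶠ b in 𝓝 a, chainIntegral z b = chainIntegral z a := by
  obtain ⟨r, hr, hball⟩ := Metric.isOpen_iff.mp (isOpen_admissibleSlopes z) a ha
  filter_upwards [Metric.ball_mem_nhds a hr] with b hb
  have hpw : ∀ (s : Finset (Fin n)) (k : Fin n) (γ : ℂ), γ ∈ Metric.ball (a k) r →
      Function.update (s.piecewise b a) k γ ∈ Metric.ball a r := by
    intro s k γ hγ
    rw [mem_ball_iff_norm, pi_norm_lt_iff hr]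
    intro i
    rw [mem_ball_iff_norm, pi_norm_lt_iff hr] at hb
    rw [mem_ball_iff_norm] at hγ
    rw [Pi.sub_apply]
    rcases eq_or_ne i k with rfl | hik
    · simpa using hγ
    · rw [Function.update_of_ne hik]
      by_cases his : i ∈ s
      · simpa [his] using hb i
      · simpa [his] using hr
  have key : ∀ s : Finset (Fin n), chainIntegral z (s.piecewise b a) = chainIntegral z a := by
    intro s
    induction s using Finset.induction_on with
    | empty => simp
    | insert k s hk ih =>
      rw [Finset.piecewise_insert, ← ih]
      have e : s.piecewise b a = Function.update (s.piecewise b a) k (a k) := by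
        rw [eq_comm, Function.update_eq_iff]
        simp [hk]
      have hbk : b k ∈ Metric.ball (a k) r := by
        rw [mem_ball_iff_norm, pi_norm_lt_iff hr] at hb
        rw [mem_ball_iff_norm]
        exact hb k
      conv_rhs => rw [e]
      exact chainIntegral_update_eq k Metric.isOpen_ball
        (convex_ball _ _).isPreconnected (fun γ hγ => hball (hpw s k γ hγ)) hbk
        (Metric.mem_ball_self hr)
  simpa using key Finset.univ

/-- Deforming the contours of a chain integral. -/
theorem chainIntegral_eq_of_isPreconnected {X : Type*} [TopologicalSpace X] {T : Set X}
    (hT : IsPreconnected T) {n : ℕ} {z : Fin n → ℂ} {f : X → Fin n → ℂ} (hf : ContinuousOn f T)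
    (hadm : ∀ x ∈ T, f x ∈ admissibleSlopes z) {x y : X} (hx : x ∈ T) (hy : y ∈ T) :
    chainIntegral z (f x) = chainIntegral z (f y) := by
  refine hT.induction₂ (fun x y => chainIntegral z (f x) = chainIntegral z (f y))
    (fun x hx => ?_) (fun _ _ _ _ _ _ => Eq.trans) (fun _ _ _ _ => Eq.symm) hx hy
  have := (hf x hx).eventually (chainIntegral_eventually_eq (hadm x hx))
  filter_upwards [this] with y hy using hy.symm

theorem arg_exp_ofReal_mul_I {ε : ℝ} (h1 : -Real.pi < ε) (h2 : ε ≤ Real.pi) :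
    Complex.log (Complex.exp (ε * Complex.I)) = ε * Complex.I := by
  apply Complex.log_exp <;> simpa

/-- The jump of the Cauchy transform across a ray. -/
theorem rayTransform_sub_rayTransform {ζ u : ℂ} {ρ ε : ℝ} (hρ : 0 < ρ) (hε : 0 < ε)
    (hε' : ε < Real.pi / 2)
    (h1 : 0 < (ζ * (ρ * u * Complex.exp (-(ε * Complex.I)))).re)
    (h2 : 0 < (ζ * (ρ * u * Complex.exp (ε * Complex.I))).re) :
    rayTransform ζ (ρ * u * Complex.exp (-(ε * Complex.I))) u -
      rayTransform ζ (ρ * u * Complex.exp (ε * Complex.I)) u =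
      2 * Real.pi * Complex.I * Complex.exp (-(ζ * u)) := by
  have hπ := Real.pi_pos
  have hρ0 : (ρ : ℂ) ≠ 0 := by exact_mod_cast hρ.ne'
  have hu : u ≠ 0 := by rintro rfl; simp at h1
  have hζ : ζ ≠ 0 := by rintro rfl; simp at h1
  set E := Complex.exp (ε * Complex.I) with hE
  have hE0 : E ≠ 0 := Complex.exp_ne_zero _
  have hEneg : Complex.exp (-(ε * Complex.I)) = E⁻¹ := Complex.exp_neg _
  rw [hEneg] at h1 ⊢
  have hlogE : Complex.log E = ε * Complex.I := arg_exp_ofReal_mul_I (by linarith) (by linarith)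
  have hlogE' : Complex.log E⁻¹ = -(ε * Complex.I) := by
    rw [← hEneg, ← neg_mul, ← Complex.ofReal_neg]
    exact arg_exp_ofReal_mul_I (by linarith) (by linarith)
  set q := ζ * (ρ * u) with hq
  have hqE : ζ * (ρ * u * E⁻¹) = q * E⁻¹ := by rw [hq]; ring
  have hqE' : ζ * (ρ * u * E) = q * E := by rw [hq]; ring
  -- The sum of the two rotated values is 2q cos ε, so `q` inherits their positive real part.
  have hqre : 0 < q.re := by
    rw [hqE] at h1
    rw [hqE'] at h2
    have hsum : q * E⁻¹ + q * E = q * ((2 * Real.cos ε : ℝ) : ℂ) := by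
      rw [← mul_add, ← hEneg, hE]
      congr 1
      push_cast
      rw [Complex.cos]
      ring_nf
    have h3 := congrArg Complex.re hsum
    rw [Complex.add_re, Complex.re_mul_ofReal] at h3
    have hcos : 0 < Real.cos ε := Real.cos_pos_of_mem_Ioo ⟨by linarith, hε'⟩
    by_contra hcon
    have := mul_nonpos_of_nonpos_of_nonneg (not_lt.mp hcon) (by positivity : 0 ≤ 2 * Real.cos ε)
    linarith
  have hq0 := ne_zero_of_re_pos hqre
  have hargq : |Complex.arg q⁻¹| < Real.pi / 2 := by
    rw [Complex.abs_arg_lt_pi_div_two_iff]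
    left
    rw [Complex.inv_re]
    exact div_pos hqre (Complex.normSq_pos.mpr hq0)
  have hargE : Complex.arg E = ε := by
    rw [← Complex.log_im, hlogE]; simp
  have hargE' : Complex.arg E⁻¹ = -ε := by
    rw [← Complex.log_im, hlogE']; simp
  rw [abs_lt] at hargq
  -- Both arguments are smaller than π/2 in modulus, so the logarithm of the product splits without
  -- a branch correction.
  have l1 : Complex.log (1 / (ζ * (ρ * u * E⁻¹))) = Complex.log q⁻¹ + ε * Complex.I := by
    rw [hqE, one_div, mul_inv, inv_inv, Complex.log_mul (inv_ne_zero hq0) hE0, hlogE]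
    rw [hargE]
    constructor <;> linarith
  have l2 : Complex.log (1 / (ζ * (ρ * u * E))) = Complex.log q⁻¹ - ε * Complex.I := by
    rw [hqE', one_div, mul_inv, Complex.log_mul (inv_ne_zero hq0) (inv_ne_zero hE0), hlogE',
      sub_eq_add_neg]
    rw [hargE']
    constructor <;> linarith
  have hpi : Complex.exp (((ε - Real.pi : ℝ) : ℂ) * Complex.I) = -E := by
    push_cast
    rw [sub_mul, Complex.exp_sub, Complex.exp_pi_mul_I, ← hE]
    ring
  have hpi' : Complex.exp (((Real.pi - ε : ℝ) : ℂ) * Complex.I) = -E⁻¹ := by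
    push_cast
    rw [sub_mul, Complex.exp_sub, Complex.exp_pi_mul_I, ← hE, neg_div, one_div]
  -- Here the branch matters: the argument is ε - π on one side of the ray and π - ε on the other.
  -- With the contribution 2ε of the first logarithms, the total jump is 2ε - 2(ε - π) = 2π.
  have l3 : Complex.log (-u / (ρ * u * E⁻¹)) =
      Real.log ρ⁻¹ + ((ε - Real.pi : ℝ) : ℂ) * Complex.I := by
    have : -u / (ρ * u * E⁻¹) = ((ρ⁻¹ : ℝ) : ℂ) * -E := by
      push_cast; field_simp
    rw [this, Complex.log_ofReal_mul (inv_pos.mpr hρ) (neg_ne_zero.mpr hE0), ← hpi,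
      arg_exp_ofReal_mul_I (by linarith) (by linarith)]
  have l4 : Complex.log (-u / (ρ * u * E)) =
      Real.log ρ⁻¹ + ((Real.pi - ε : ℝ) : ℂ) * Complex.I := by
    have : -u / (ρ * u * E) = ((ρ⁻¹ : ℝ) : ℂ) * -E⁻¹ := by
      push_cast; field_simp
    rw [this, Complex.log_ofReal_mul (inv_pos.mpr hρ) (neg_ne_zero.mpr (inv_ne_zero hE0)), ← hpi',
      arg_exp_ofReal_mul_I (by linarith) (by linarith)]
  have s3 : -u / (ρ * u * E⁻¹) ∈ Complex.slitPlane := by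
    rw [Complex.mem_slitPlane_iff_arg]
    have := congrArg Complex.im l3
    rw [Complex.log_im] at this
    constructor
    · rw [this]; simp; linarith
    · exact div_ne_zero (neg_ne_zero.mpr hu)
        (mul_ne_zero (mul_ne_zero hρ0 hu) (inv_ne_zero hE0))
  have s4 : -u / (ρ * u * E) ∈ Complex.slitPlane := by
    rw [Complex.mem_slitPlane_iff_arg]
    have := congrArg Complex.im l4
    rw [Complex.log_im] at this
    constructor
    · rw [this]; simp; linarith
    · exact div_ne_zero (neg_ne_zero.mpr hu) (mul_ne_zero (mul_ne_zero hρ0 hu) hE0)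
  obtain ⟨T, hT⟩ := exists_exp_mul_expIntegral_eq
  have t1 := hT (ζ * (ρ * u * E⁻¹)) (ζ * u) h1 (by
    rwa [← mul_neg, mul_div_mul_left _ _ hζ])
  have t2 := hT (ζ * (ρ * u * E)) (ζ * u) h2 (by
    rwa [← mul_neg, mul_div_mul_left _ _ hζ])
  rw [← mul_neg, mul_div_mul_left _ _ hζ, l1, l3] at t1
  rw [← mul_neg, mul_div_mul_left _ _ hζ, l2, l4] at t2
  have t3 : Complex.exp (ζ * u) * (rayTransform ζ (ρ * u * E⁻¹) u -
      rayTransform ζ (ρ * u * E) u) = 2 * Real.pi * Complex.I := by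
    rw [mul_sub, rayTransform, rayTransform, t1, t2]
    push_cast
    ring
  rw [Complex.exp_neg, ← t3]
  field_simp

/-- The jump of a chain integral when the `k`-th contour crosses the next one. -/
theorem chainIntegral_insertNth_sub {m : ℕ} (k : Fin (m + 1)) {ζ α β : ℂ}
    {z a : Fin (m + 1) → ℂ} {ρ ε : ℝ} (hρ : 0 < ρ) (hε : 0 < ε) (hε' : ε < Real.pi / 2)
    (hα : α = ρ * a k * Complex.exp (-(ε * Complex.I)))
    (hβ : β = ρ * a k * Complex.exp (ε * Complex.I))
    (hadmα : Fin.insertNth (α := fun _ => ℂ) k.castSucc α a ∈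
      admissibleSlopes (Fin.insertNth (α := fun _ => ℂ) k.castSucc ζ z))
    (hadmβ : Fin.insertNth (α := fun _ => ℂ) k.castSucc β a ∈
      admissibleSlopes (Fin.insertNth (α := fun _ => ℂ) k.castSucc ζ z))
    (hprev : ∀ (_h : 0 < (k : ℕ)) (x : ℝ), 0 < x →
      rayTransform ζ α (a ⟨k - 1, by omega⟩ * x) = rayTransform ζ β (a ⟨k - 1, by omega⟩ * x)) :
    chainIntegral (Fin.insertNth (α := fun _ => ℂ) k.castSucc ζ z)
        (Fin.insertNth (α := fun _ => ℂ) k.castSucc α a) -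
      chainIntegral (Fin.insertNth (α := fun _ => ℂ) k.castSucc ζ z)
        (Fin.insertNth (α := fun _ => ℂ) k.castSucc β a) =
      2 * Real.pi * Complex.I * chainIntegral (Function.update z k (z k + ζ)) a := by
  have hreα : 0 < (ζ * α).re := by simpa using hadmα.1 k.castSucc
  have hreβ : 0 < (ζ * β).re := by simpa using hadmβ.1 k.castSucc
  have hza : ∀ i, 0 < (z i * a i).re := fun i => by
    have := hadmα.1 (k.castSucc.succAbove i)
    rwa [Fin.insertNth_apply_succAbove, Fin.insertNth_apply_succAbove] at this
  obtain ⟨i1, e1⟩ := chainIntegral_insertNth k.castSucc hadmα.2 hreα hza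
  obtain ⟨i2, e2⟩ := chainIntegral_insertNth k.castSucc hadmβ.2 hreβ hza
  rw [e1, e2, ← integral_sub i1 i2, chainIntegral, ← integral_const_mul]
  refine integral_congr_ae ?_
  filter_upwards [ae_orthantMeasure_pos (m + 1)] with x hx
  have hjump : rayTransform ζ α (a k * x k) - rayTransform ζ β (a k * x k) =
      2 * Real.pi * Complex.I * Complex.exp (-(ζ * (a k * x k))) := by
    have hx0 : (x k : ℂ) ≠ 0 := by exact_mod_cast (hx k).ne'
    have ha1 : α = ((ρ / x k : ℝ) : ℂ) * (a k * x k) * Complex.exp (-(ε * Complex.I)) := by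
      rw [hα]; push_cast; field_simp
    have hb1 : β = ((ρ / x k : ℝ) : ℂ) * (a k * x k) * Complex.exp (ε * Complex.I) := by
      rw [hβ]; push_cast; field_simp
    have := rayTransform_sub_rayTransform (ζ := ζ) (u := a k * x k) (div_pos hρ (hx k)) hε hε'
      (by rwa [← ha1]) (by rwa [← hb1])
    rwa [← ha1, ← hb1] at this
  -- Only the transform at the next neighbour jumps; the one at the previous neighbour is the same
  -- for both slopes by `hprev`.
  have hins : insertionIntegral k.castSucc ζ α (fun i => a i * (x i : ℂ)) -
      insertionIntegral k.castSucc ζ β (fun i => a i * (x i : ℂ)) =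
      2 * Real.pi * Complex.I * Complex.exp (-(ζ * (a k * x k))) := by
    rw [← hjump]
    simp only [insertionIntegral, Fin.val_castSucc, k.isLt, dif_pos, Fin.eta]
    split_ifs with h
    · rw [hprev h _ (hx _)]; ring
    · ring
  rw [← mul_sub, hins, chainIntegrand, chainIntegrand]
  -- The exponential in the residue adds `ζ` to the coefficient of the variable that was crossed,
  -- which is how the two variables merge.
  have hsum : ∑ i, Function.update z k (z k + ζ) i * (a i * (x i : ℂ)) =
      ∑ i, z i * (a i * (x i : ℂ)) + ζ * (a k * x k) := by
    rw [← Finset.add_sum_erase _ _ (Finset.mem_univ k),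
      ← Finset.add_sum_erase (a := k) _ (fun i => z i * (a i * (x i : ℂ))) (Finset.mem_univ k)]
    rw [Function.update_self, Finset.sum_congr rfl fun i hi => by
      rw [Function.update_of_ne (Finset.ne_of_mem_erase hi)]]
    ring
  rw [hsum, neg_add, Complex.exp_add]
  ring

end ContourCrossing

/-! ### Limits for infinitesimally separated phases -/

section PhaseLimits
open MeasureTheory Set Filter Topology

/-- The value `(2πi)^{-n} (∑ z) ∫ ⋯` attached to a product of rays. -/
noncomputable def chainValue {n : ℕ} (z a : Fin n → ℂ) : ℂ :=
  ((2 * (Real.pi : ℂ) * Complex.I)⁻¹) ^ n * ((∑ i, z i) * chainIntegral z a)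

/-- Positive rescalings form a convex set of admissible deformations, so only the rays matter and
not their generators. -/
theorem chainIntegral_ofReal_mul {n : ℕ} {z a : Fin n → ℂ} {r : Fin n → ℝ} (hr : ∀ i, 0 < r i)
    (ha : a ∈ admissibleSlopes z) :
    chainIntegral z (fun i => r i * a i) = chainIntegral z a := by
  have hc : Convex ℝ {r : Fin n → ℝ | ∀ i, 0 < r i} := by
    intro r hr s hs p q hp hq hpq i
    have h1 := hr i
    have h2 := hs i
    simp only [Pi.add_apply, Pi.smul_apply, smul_eq_mul]
    rcases hp.eq_or_lt with rfl | hp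
    · simp only [zero_add] at hpq
      subst hpq
      simpa using h2
    · positivity
  have key := chainIntegral_eq_of_isPreconnected (z := z) hc.isPreconnected
    (f := fun r i => (r i : ℂ) * a i) (by fun_prop) (fun r hr => ?_) hr
    (y := fun _ => 1) (fun i => one_pos)
  · simpa using key
  · refine ⟨fun i => ?_, fun k hk h => ha.2 k hk ?_⟩
    · have := mul_pos (hr i) (ha.1 i)
      rwa [← Complex.re_ofReal_mul, mul_left_comm] at this
    · have h1 := h.pos_smul_left (inv_pos.mpr (hr ⟨k, by omega⟩))
      have h2 := h1.pos_smul_right (inv_pos.mpr (hr ⟨k + 1, hk⟩))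
      have n1 := (hr ⟨k, by omega⟩).ne'
      have n2 := (hr ⟨k + 1, hk⟩).ne'
      rwa [Complex.real_smul, Complex.real_smul, Complex.ofReal_inv, Complex.ofReal_inv,
        inv_mul_cancel_left₀ (by exact_mod_cast n1), inv_mul_cancel_left₀ (by exact_mod_cast n2)]
        at h2

/-- The slopes of the rays opposite in phase to `w`, rotated clockwise by `φ`. -/
noncomputable def phaseSlopes {n : ℕ} (w : Fin n → ℂ) (φ : Fin n → ℝ) : Fin n → ℂ :=
  fun i => Complex.exp (-(φ i * Complex.I)) / w i

theorem re_mul_phaseSlope_pos {z w : ℂ} {φ : ℝ} (h : 0 < (z / w).re)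
    (hφ : |φ - Complex.arg (z / w)| < Real.pi / 2) :
    0 < (z * (Complex.exp (-(φ * Complex.I)) / w)).re := by
  have h0 := ne_zero_of_re_pos h
  have e : z * (Complex.exp (-(φ * Complex.I)) / w) = ((‖z / w‖ : ℝ) : ℂ) *
      Complex.exp (((Complex.arg (z / w) - φ : ℝ) : ℂ) * Complex.I) := by
    rw [mul_div_assoc', mul_comm z, mul_div_assoc]
    conv_lhs => rw [← Complex.norm_mul_exp_arg_mul_I (z / w)]
    rw [mul_left_comm, ← Complex.exp_add]
    push_cast
    ring_nf
  rw [e, Complex.re_ofReal_mul, Complex.exp_ofReal_mul_I_re]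
  refine mul_pos (norm_pos_iff.mpr h0) (Real.cos_pos_of_mem_Ioo ?_)
  rw [abs_lt] at hφ
  constructor <;> linarith [hφ.1, hφ.2]

theorem phaseSlope_div_phaseSlope {w₁ w₂ : ℂ} (h₁ : w₁ ≠ 0) (h₂ : w₂ ≠ 0) (φ₁ φ₂ : ℝ) :
    (Complex.exp (-(φ₁ * Complex.I)) / w₁) / (Complex.exp (-(φ₂ * Complex.I)) / w₂) =
      w₂ / w₁ * Complex.exp (((φ₂ - φ₁ : ℝ) : ℂ) * Complex.I) := by
  have h := Complex.exp_ne_zero (φ₂ * Complex.I)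
  have h' := Complex.exp_ne_zero (φ₁ * Complex.I)
  push_cast
  rw [sub_mul, Complex.exp_sub, Complex.exp_neg, Complex.exp_neg]
  field_simp

theorem not_sameRay_phaseSlope {w₁ w₂ : ℂ} (h₁ : w₁ ≠ 0) (h₂ : w₂ ≠ 0) (h : SameRay ℝ w₁ w₂)
    {φ₁ φ₂ : ℝ} (hne : φ₁ ≠ φ₂) (hlt : |φ₂ - φ₁| < Real.pi) :
    ¬ SameRay ℝ (Complex.exp (-(φ₁ * Complex.I)) / w₁)
      (Complex.exp (-(φ₂ * Complex.I)) / w₂) := by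
  rw [Complex.sameRay_iff_arg_div_eq_zero, phaseSlope_div_phaseSlope h₁ h₂]
  obtain ⟨r, hr, hw⟩ := h.exists_pos_left h₁ h₂
  rw [abs_lt] at hlt
  rw [← hw, Complex.real_smul, mul_div_cancel_right₀ _ h₁, Complex.arg_real_mul _ hr,
    Complex.exp_mul_I, Complex.arg_cos_add_sin_mul_I ⟨hlt.1, hlt.2.le⟩]
  exact sub_ne_zero.mpr hne.symm

theorem exists_not_sameRay_phaseSlope {w₁ w₂ : ℂ} (h : ¬ SameRay ℝ w₁ w₂) :
    ∃ δ > 0, ∀ φ₁ φ₂ : ℝ, |φ₁| < δ → |φ₂| < δ →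
      ¬ SameRay ℝ (Complex.exp (-(φ₁ * Complex.I)) / w₁)
        (Complex.exp (-(φ₂ * Complex.I)) / w₂) := by
  have h₁ : w₁ ≠ 0 := by rintro rfl; exact h (SameRay.zero_left _)
  have h₂ : w₂ ≠ 0 := by rintro rfl; exact h (SameRay.zero_right _)
  have hs := (not_sameRay_iff_neg_div_mem_slitPlane h₁ h₂).mp h
  have hc : ContinuousAt (fun ψ : ℝ => -w₂ / w₁ * Complex.exp (ψ * Complex.I)) 0 := by fun_prop
  have hev := hc.eventually (Complex.isOpen_slitPlane.mem_nhds (by simpa using hs))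
  obtain ⟨δ, hδ, hball⟩ := Metric.eventually_nhds_iff.mp hev
  refine ⟨δ / 2, by positivity, fun φ₁ φ₂ h1 h2 hray => ?_⟩
  have e1 : Complex.exp (-(φ₁ * Complex.I)) / w₁ ≠ 0 := div_ne_zero (Complex.exp_ne_zero _) h₁
  have e2 : Complex.exp (-(φ₂ * Complex.I)) / w₂ ≠ 0 := div_ne_zero (Complex.exp_ne_zero _) h₂
  refine (not_sameRay_iff_neg_div_mem_slitPlane e2 e1).mpr ?_ hray.symm
  rw [neg_div, phaseSlope_div_phaseSlope h₁ h₂]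
  have := @hball (φ₂ - φ₁) (by
    rw [Real.dist_eq, sub_zero]
    exact (abs_sub _ _).trans_lt (by linarith))
  rwa [neg_div, neg_mul] at this

/-- A bound on the phases `φ` below which `phaseSlopes w φ` is generic as soon as `φ` separates
consecutive entries of `w` on a common ray. -/
def IsPhaseRadius {n : ℕ} (w : Fin n → ℂ) (δ : ℝ) : Prop :=
  0 < δ ∧ ∀ φ : Fin n → ℝ, (∀ i, |φ i| < δ) →
    (∀ (k : ℕ) (hk : k + 1 < n), SameRay ℝ (w ⟨k, by omega⟩) (w ⟨k + 1, hk⟩) →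
      φ ⟨k, by omega⟩ ≠ φ ⟨k + 1, hk⟩) → ChainGeneric (phaseSlopes w φ)

theorem exists_isPhaseRadius {n : ℕ} {w : Fin n → ℂ} (hw : ∀ i, w i ≠ 0) :
    ∃ δ, IsPhaseRadius w δ := by
  have key : ∀ᶠ δ in 𝓝[>] (0 : ℝ), ∀ k : Fin n, ∀ hk : (k : ℕ) + 1 < n, ∀ φ₁ φ₂ : ℝ,
      |φ₁| < δ → |φ₂| < δ → (SameRay ℝ (w k) (w ⟨k + 1, hk⟩) → φ₁ ≠ φ₂) →
      ¬ SameRay ℝ (Complex.exp (-(φ₁ * Complex.I)) / w k)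
        (Complex.exp (-(φ₂ * Complex.I)) / w ⟨k + 1, hk⟩) := by
    rw [eventually_all]
    intro k
    by_cases hk : (k : ℕ) + 1 < n
    · by_cases hray : SameRay ℝ (w k) (w ⟨k + 1, hk⟩)
      · filter_upwards [Ioo_mem_nhdsGT (show (0 : ℝ) < Real.pi / 2 by positivity)]
          with δ hδ _ φ₁ φ₂ h1 h2 hne
        exact not_sameRay_phaseSlope (hw _) (hw _) hray (hne hray)
          ((abs_sub _ _).trans_lt (by linarith [hδ.2]))
      · obtain ⟨δ₀, hδ₀, h⟩ := exists_not_sameRay_phaseSlope hray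
        filter_upwards [Ioo_mem_nhdsGT hδ₀] with δ hδ _ φ₁ φ₂ h1 h2 _
        exact h φ₁ φ₂ (h1.trans hδ.2) (h2.trans hδ.2)
    · exact Eventually.of_forall fun _ h => absurd h hk
  obtain ⟨δ, h1, h2⟩ := (key.and self_mem_nhdsWithin).exists
  exact ⟨δ, h2, fun φ hφ hne k hk => h1 ⟨k, by omega⟩ hk _ _ (hφ _) (hφ _) (hne k hk)⟩

/-- `t` takes different values at consecutive entries of `w` on a common ray. -/
def Separates {n : ℕ} (w : Fin n → ℂ) (t : Fin n → ℝ) : Prop :=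
  ∀ (k : ℕ) (hk : k + 1 < n), SameRay ℝ (w ⟨k, by omega⟩) (w ⟨k + 1, hk⟩) →
    t ⟨k, by omega⟩ ≠ t ⟨k + 1, hk⟩

/-- The phases that order consecutive entries of `w` on a common ray in the same way as `t`. -/
def phaseChamber {n : ℕ} (z w : Fin n → ℂ) (δ : ℝ) (t : Fin n → ℝ) : Set (Fin n → ℝ) :=
  {φ | (∀ i, |φ i| < δ) ∧ (∀ i, |φ i - Complex.arg (z i / w i)| < Real.pi / 2) ∧
    ∀ (k : ℕ) (hk : k + 1 < n), SameRay ℝ (w ⟨k, by omega⟩) (w ⟨k + 1, hk⟩) →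
      0 < (φ ⟨k + 1, hk⟩ - φ ⟨k, by omega⟩) * (t ⟨k + 1, hk⟩ - t ⟨k, by omega⟩)}

theorem convex_phaseChamber {n : ℕ} (z w : Fin n → ℂ) (δ : ℝ) (t : Fin n → ℝ) :
    Convex ℝ (phaseChamber z w δ t) := by
  intro φ hφ ψ hψ p q hp hq hpq
  have hlin : ∀ a b c d : ℝ, a < c → b < d → p * a + q * b < p * c + q * d := by
    intro a b c d h1 h2
    rcases hp.eq_or_lt with rfl | hp
    · simp only [zero_add] at hpq
      subst hpq
      simpa using h2
    · have := mul_lt_mul_of_pos_left h1 hp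
      have := mul_le_mul_of_nonneg_left h2.le hq
      linarith
  have hconst : ∀ c : ℝ, p * c + q * c = c := fun c => by rw [← add_mul, hpq, one_mul]
  refine ⟨fun i => ?_, fun i => ?_, fun k hk hray => ?_⟩
  · have h1 := abs_lt.mp (hφ.1 i)
    have h2 := abs_lt.mp (hψ.1 i)
    simp only [Pi.add_apply, Pi.smul_apply, smul_eq_mul]
    rw [abs_lt]
    exact ⟨by linarith [hlin _ _ _ _ h1.1 h2.1, hconst (-δ)],
      by linarith [hlin _ _ _ _ h1.2 h2.2, hconst δ]⟩
  · have h1 := abs_lt.mp (hφ.2.1 i)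
    have h2 := abs_lt.mp (hψ.2.1 i)
    simp only [Pi.add_apply, Pi.smul_apply, smul_eq_mul]
    rw [abs_lt]
    exact ⟨by linarith [hlin _ _ _ _ h1.1 h2.1, hconst (-(Real.pi / 2)),
        hconst (Complex.arg (z i / w i))],
      by linarith [hlin _ _ _ _ h1.2 h2.2, hconst (Real.pi / 2),
        hconst (Complex.arg (z i / w i))]⟩
  · have := hlin _ _ _ _ (hφ.2.2 k hk hray) (hψ.2.2 k hk hray)
    simp only [Pi.add_apply, Pi.smul_apply, smul_eq_mul]
    linarith

theorem phaseSlopes_mem_admissibleSlopes {n : ℕ} {z w : Fin n → ℂ} {δ : ℝ} {φ : Fin n → ℝ}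
    (hδ : IsPhaseRadius w δ) (hre : ∀ i, 0 < (z i / w i).re) (h1 : ∀ i, |φ i| < δ)
    (h2 : ∀ i, |φ i - Complex.arg (z i / w i)| < Real.pi / 2) (h3 : Separates w φ) :
    phaseSlopes w φ ∈ admissibleSlopes z :=
  ⟨fun i => re_mul_phaseSlope_pos (hre i) (h2 i), hδ.2 φ h1 h3⟩

theorem separates_of_mem_phaseChamber {n : ℕ} {z w : Fin n → ℂ} {δ : ℝ} {t φ : Fin n → ℝ}
    (h : φ ∈ phaseChamber z w δ t) : Separates w φ := fun k hk hray he => by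
  have := h.2.2 k hk hray
  rw [he, sub_self, zero_mul] at this
  exact lt_irrefl _ this

theorem phaseSlopes_mem_of_mem_phaseChamber {n : ℕ} {z w : Fin n → ℂ} {δ : ℝ} {t φ : Fin n → ℝ}
    (hδ : IsPhaseRadius w δ) (hre : ∀ i, 0 < (z i / w i).re) (h : φ ∈ phaseChamber z w δ t) :
    phaseSlopes w φ ∈ admissibleSlopes z :=
  phaseSlopes_mem_admissibleSlopes hδ hre h.1 h.2.1 (separates_of_mem_phaseChamber h)

theorem continuous_phaseSlopes {n : ℕ} (w : Fin n → ℂ) : Continuous (phaseSlopes w) := by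
  unfold phaseSlopes
  fun_prop

theorem chainValue_phaseSlopes_eq {n : ℕ} {z w : Fin n → ℂ} {δ : ℝ} {t φ ψ : Fin n → ℝ}
    (hδ : IsPhaseRadius w δ) (hre : ∀ i, 0 < (z i / w i).re) (hφ : φ ∈ phaseChamber z w δ t)
    (hψ : ψ ∈ phaseChamber z w δ t) :
    chainValue z (phaseSlopes w φ) = chainValue z (phaseSlopes w ψ) := by
  rw [chainValue, chainValue, chainIntegral_eq_of_isPreconnected
    (convex_phaseChamber z w δ t).isPreconnected (continuous_phaseSlopes w).continuousOn
    (fun x hx => phaseSlopes_mem_of_mem_phaseChamber hδ hre hx) hφ hψ]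

/-- The value of the chain on the rays `phaseSlopes w (ε t)`, for small `ε > 0`. -/
noncomputable def phaseLimit {n : ℕ} (z w : Fin n → ℂ) (t : Fin n → ℝ) : ℂ :=
  limUnder (𝓝[>] (0 : ℝ)) fun ε => chainValue z (phaseSlopes w fun i => ε * t i)

theorem abs_arg_lt_of_re_pos {q : ℂ} (h : 0 < q.re) : |Complex.arg q| < Real.pi / 2 := by
  rw [Complex.abs_arg_lt_pi_div_two_iff]
  exact Or.inl h

theorem eventually_abs_mul_lt (t : ℝ) {c : ℝ} (hc : 0 < c) :
    ∀ᶠ ε in 𝓝[>] (0 : ℝ), |ε * t| < c := by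
  have h : ContinuousAt (fun ε : ℝ => |ε * t|) 0 := by fun_prop
  exact nhdsWithin_le_nhds (h.eventually_lt_const (by simpa using hc))

theorem eventually_mem_phaseChamber {n : ℕ} {z w : Fin n → ℂ} {δ : ℝ} {t : Fin n → ℝ}
    (hδ : 0 < δ) (hre : ∀ i, 0 < (z i / w i).re) (ht : Separates w t) :
    ∀ᶠ ε in 𝓝[>] (0 : ℝ), (fun i => ε * t i) ∈ phaseChamber z w δ t := by
  have h1 : ∀ᶠ ε in 𝓝[>] (0 : ℝ), ∀ i, |ε * t i| < δ :=
    eventually_all.mpr fun i => eventually_abs_mul_lt _ hδ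
  have h2 : ∀ᶠ ε in 𝓝[>] (0 : ℝ), ∀ i, |ε * t i - Complex.arg (z i / w i)| < Real.pi / 2 := by
    refine eventually_all.mpr fun i => ?_
    have h : ContinuousAt (fun ε : ℝ => |ε * t i - Complex.arg (z i / w i)|) 0 := by fun_prop
    exact nhdsWithin_le_nhds (h.eventually_lt_const (by
      simpa using abs_arg_lt_of_re_pos (hre i)))
  filter_upwards [h1, h2, self_mem_nhdsWithin] with ε e1 e2 (e3 : 0 < ε)
  refine ⟨e1, e2, fun k hk hray => ?_⟩
  rw [← mul_sub, mul_assoc]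
  exact mul_pos e3 (mul_self_pos.mpr (sub_ne_zero.mpr (ht k hk hray).symm))

theorem phaseLimit_eq_of_eventually {n : ℕ} {z w : Fin n → ℂ} {t : Fin n → ℝ} {c : ℂ}
    (h : ∀ᶠ ε in 𝓝[>] (0 : ℝ), chainValue z (phaseSlopes w fun i => ε * t i) = c) :
    phaseLimit z w t = c :=
  (tendsto_const_nhds.congr' (h.mono fun _ e => e.symm)).limUnder_eq

theorem chainValue_eq_phaseLimit {n : ℕ} {z w : Fin n → ℂ} {δ : ℝ} {t φ : Fin n → ℝ}
    (hδ : IsPhaseRadius w δ) (hre : ∀ i, 0 < (z i / w i).re) (ht : Separates w t)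
    (hφ : φ ∈ phaseChamber z w δ t) : chainValue z (phaseSlopes w φ) = phaseLimit z w t :=
  (phaseLimit_eq_of_eventually ((eventually_mem_phaseChamber hδ.1 hre ht).mono fun _ h =>
    chainValue_phaseSlopes_eq hδ hre h hφ)).symm

theorem ne_zero_of_div_re_pos {z w : ℂ} (h : 0 < (z / w).re) : z ≠ 0 ∧ w ≠ 0 := by
  constructor <;> rintro rfl <;> simp at h

theorem eventually_chainValue_eq_phaseLimit {n : ℕ} {z w : Fin n → ℂ} {t : Fin n → ℝ}
    (hre : ∀ i, 0 < (z i / w i).re) (ht : Separates w t) :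
    ∀ᶠ ε in 𝓝[>] (0 : ℝ), (phaseSlopes w fun i => ε * t i) ∈ admissibleSlopes z ∧
      chainValue z (phaseSlopes w fun i => ε * t i) = phaseLimit z w t := by
  obtain ⟨δ, hδ⟩ := exists_isPhaseRadius fun i => (ne_zero_of_div_re_pos (hre i)).2
  exact (eventually_mem_phaseChamber hδ.1 hre ht).mono fun _ h =>
    ⟨phaseSlopes_mem_of_mem_phaseChamber hδ hre h, chainValue_eq_phaseLimit hδ hre ht h⟩

/-- Small phases with the same order at consecutive entries of a common ray lie in one convex
chamber, so one contour deforms into the other. -/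
theorem phaseLimit_congr {n : ℕ} {z w : Fin n → ℂ} {s t : Fin n → ℝ}
    (hre : ∀ i, 0 < (z i / w i).re)
    (h : ∀ (k : ℕ) (hk : k + 1 < n), SameRay ℝ (w ⟨k, by omega⟩) (w ⟨k + 1, hk⟩) →
      0 < (s ⟨k + 1, hk⟩ - s ⟨k, by omega⟩) * (t ⟨k + 1, hk⟩ - t ⟨k, by omega⟩)) :
    phaseLimit z w s = phaseLimit z w t := by
  have hs : Separates w s := fun k hk hray he => by
    have := h k hk hray
    simp [he] at this
  have ht : Separates w t := fun k hk hray he => by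
    have := h k hk hray
    simp [he] at this
  obtain ⟨δ, hδ⟩ := exists_isPhaseRadius fun i => (ne_zero_of_div_re_pos (hre i)).2
  refine phaseLimit_eq_of_eventually ?_
  filter_upwards [eventually_mem_phaseChamber hδ.1 hre hs, self_mem_nhdsWithin]
    with ε hε (h0 : 0 < ε)
  refine chainValue_eq_phaseLimit hδ hre ht ⟨hε.1, hε.2.1, fun k hk hray => ?_⟩
  rw [← mul_sub, mul_assoc]
  exact mul_pos h0 (h k hk hray)

/-- Near `z₀` one fixed contour, defined by `w` alone, computes all the values; holomorphy is then
that of the chain integral. -/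
theorem differentiableOn_phaseLimit {n : ℕ} (hn : 1 ≤ n) {w : Fin n → ℂ} {t : Fin n → ℝ}
    (ht : Separates w t) :
    DifferentiableOn ℂ (fun z => phaseLimit z w t) {z | ∀ i, 0 < (z i / w i).re} := by
  intro z₀ hz₀
  refine DifferentiableAt.differentiableWithinAt ?_
  obtain ⟨δ, hδ⟩ := exists_isPhaseRadius fun i => (ne_zero_of_div_re_pos (hz₀ i)).2
  obtain ⟨ε, hε⟩ := (eventually_mem_phaseChamber hδ.1 hz₀ ht).exists
  have hadm := phaseSlopes_mem_of_mem_phaseChamber hδ hz₀ hε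
  have hd : DifferentiableAt ℂ (fun z => chainValue z (phaseSlopes w fun i => ε * t i)) z₀ := by
    have := (hasFDerivAt_chainIntegral hn hadm.2 hadm.1).2.differentiableAt
    unfold chainValue
    fun_prop
  refine hd.congr_of_eventuallyEq ?_
  have h1 : ∀ᶠ z in 𝓝 z₀, ∀ i, 0 < (z i / w i).re := by
    refine eventually_all.mpr fun i => ?_
    have : ContinuousAt (fun z : Fin n → ℂ => (z i / w i).re) z₀ :=
      (Complex.continuous_re.comp ((continuous_apply i).div_const _)).continuousAt
    exact this.eventually_const_lt (hz₀ i)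
  have h2 : ∀ᶠ z in 𝓝 z₀, ∀ i, |ε * t i - Complex.arg (z i / w i)| < Real.pi / 2 := by
    refine eventually_all.mpr fun i => ?_
    have h3 : ContinuousAt (fun z : Fin n → ℂ => z i / w i) z₀ :=
      ((continuous_apply i).div_const _).continuousAt
    have h4 : ContinuousAt Complex.arg (z₀ i / w i) :=
      Complex.continuousAt_arg (Or.inl (hz₀ i))
    have h5 : ContinuousAt (fun z : Fin n → ℂ => Complex.arg (z i / w i)) z₀ :=
      ContinuousAt.comp' (f := fun z : Fin n → ℂ => z i / w i) h4 h3
    exact (continuousAt_const.sub h5).abs.eventually_lt_const (hε.2.1 i)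
  filter_upwards [h1, h2] with z e1 e2
  exact (chainValue_eq_phaseLimit hδ e1 ht ⟨hε.1, e2, hε.2.2⟩).symm

/-- Changing the base point of a phase limit. -/
theorem eventually_phaseLimit_self_eq {n : ℕ} {z w : Fin n → ℂ} {t : Fin n → ℝ} {δ : ℝ}
    (hδ : IsPhaseRadius w δ) (hre : ∀ i, 0 < (z i / w i).re)
    (harg : ∀ i, |Complex.arg (z i / w i)| < δ)
    (ht : ∀ (k : ℕ) (hk : k + 1 < n), t ⟨k, by omega⟩ ≠ t ⟨k + 1, hk⟩) :
    ∀ᶠ η in 𝓝[>] (0 : ℝ),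
      phaseLimit z z t = phaseLimit z w fun i => Complex.arg (z i / w i) + η * t i := by
  have hz : ∀ i, 0 < (z i / z i).re := fun i => by
    rw [div_self (ne_zero_of_div_re_pos (hre i)).1]; simp
  have h0 := eventually_chainValue_eq_phaseLimit (t := t) hz fun k hk _ => ht k hk
  have h1 : ∀ᶠ η in 𝓝[>] (0 : ℝ), ∀ i, |Complex.arg (z i / w i) + η * t i| < δ := by
    refine eventually_all.mpr fun i => ?_
    have h : ContinuousAt (fun ε : ℝ => |Complex.arg (z i / w i) + ε * t i|) 0 := by fun_prop
    exact nhdsWithin_le_nhds (h.eventually_lt_const (by simpa using harg i))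
  have h2 : ∀ᶠ η in 𝓝[>] (0 : ℝ), ∀ i, |η * t i| < Real.pi / 2 :=
    eventually_all.mpr fun i => eventually_abs_mul_lt _ (by positivity)
  have h3 : ∀ᶠ η in 𝓝[>] (0 : ℝ), ∀ k : Fin n, ∀ hk : (k : ℕ) + 1 < n,
      Complex.arg (z k / w k) + η * t k ≠
        Complex.arg (z ⟨k + 1, hk⟩ / w ⟨k + 1, hk⟩) + η * t ⟨k + 1, hk⟩ := by
    refine eventually_all.mpr fun k => ?_
    by_cases hk : (k : ℕ) + 1 < n
    -- Two perturbed phases coincide for at most one value of `η`, which small positive `η` avoid.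
    · have hne : t k - t ⟨k + 1, hk⟩ ≠ 0 := sub_ne_zero.mpr (ht k hk)
      have hfin : ∀ᶠ η in 𝓝[>] (0 : ℝ), η ≠
          (Complex.arg (z ⟨k + 1, hk⟩ / w ⟨k + 1, hk⟩) - Complex.arg (z k / w k)) /
            (t k - t ⟨k + 1, hk⟩) := by
        rcases eq_or_ne ((Complex.arg (z ⟨k + 1, hk⟩ / w ⟨k + 1, hk⟩) - Complex.arg (z k / w k)) /
            (t k - t ⟨k + 1, hk⟩)) 0 with h | h
        · rw [h]
          filter_upwards [self_mem_nhdsWithin] with η (hη : 0 < η) using hη.ne'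
        · exact nhdsWithin_le_nhds (eventually_ne_nhds h.symm)
      filter_upwards [hfin] with η hη _ he
      apply hη
      rw [eq_div_iff hne]
      linarith
    · exact Eventually.of_forall fun _ h => absurd h hk
  filter_upwards [h0, h1, h2, h3] with η e0 e1 e2 e3
  have hsep : Separates w fun i => Complex.arg (z i / w i) + η * t i :=
    fun k hk _ => e3 ⟨k, by omega⟩ hk
  have hmem : (fun i => Complex.arg (z i / w i) + η * t i) ∈
      phaseChamber z w δ fun i => Complex.arg (z i / w i) + η * t i :=
    ⟨e1, fun i => by rw [add_sub_cancel_left]; exact e2 i, fun k hk hray =>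
      mul_self_pos.mpr (sub_ne_zero.mpr (hsep k hk hray).symm)⟩
  rw [← chainValue_eq_phaseLimit hδ hre hsep hmem, ← e0.2, chainValue, chainValue]
  congr 2
  -- The slope based at `w` with the phase arg(z/w) added is |z/w| times the slope based at `z`.
  rw [← chainIntegral_ofReal_mul (r := fun i => ‖z i / w i‖)
    (fun i => norm_pos_iff.mpr (ne_zero_of_re_pos (hre i))) e0.1]
  congr 1
  ext i
  obtain ⟨z0, w0⟩ := ne_zero_of_div_re_pos (hre i)
  simp only [phaseSlopes]
  have hp := Complex.norm_mul_exp_arg_mul_I (z i / w i)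
  have he := Complex.exp_ne_zero (Complex.arg (z i / w i) * Complex.I)
  rw [← eq_div_iff he] at hp
  rw [hp]
  push_cast
  rw [add_mul, neg_add, Complex.exp_add, Complex.exp_neg (Complex.arg (z i / w i) * Complex.I)]
  field_simp

end PhaseLimits

/-! ### Cutting lists into blocks, and the composition of moulds -/

section Segmentations

/-- The ways of extending a first block to the right by letters of a list and cutting the rest of
the list into blocks: the pairs of the letters added to the first block and the other blocks. -/
def headSegmentations {α : Type*} : List α → List (List α × List (List α))
  | [] => [([], [])]
  | y :: r => (headSegmentations r).flatMap fun p => [([], (y :: p.1) :: p.2), (y :: p.1, p.2)]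

/-- The ways of cutting a list into nonempty blocks. -/
def segmentations {α : Type*} : List α → List (List (List α))
  | [] => [[]]
  | x :: r => (headSegmentations r).map fun p => (x :: p.1) :: p.2

theorem sum_map_flatMap {α β R : Type*} [AddCommMonoid R] (l : List α) (g : α → List β)
    (f : β → R) : ((l.flatMap g).map f).sum = (l.map fun a => ((g a).map f).sum).sum := by
  induction l with
  | nil => simp
  | cons a l ih => simp [ih]

theorem sum_headSegmentations_cons {α R : Type*} [AddCommMonoid R] (y : α) (r : List α)
    (f : List α × List (List α) → R) :
    ((headSegmentations (y :: r)).map f).sum =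
      ((headSegmentations r).map fun p =>
        f ([], (y :: p.1) :: p.2) + f (y :: p.1, p.2)).sum := by
  simp [headSegmentations, sum_map_flatMap]

theorem sum_segmentations_cons {α R : Type*} [AddCommMonoid R] (x : α) (r : List α)
    (f : List (List α) → R) :
    ((segmentations (x :: r)).map f).sum =
      ((headSegmentations r).map fun p => f ((x :: p.1) :: p.2)).sum := by
  simp [segmentations, Function.comp_def]

/-- The two ways of adding a letter in front of a segmentation. -/
def consSegmentation {α R : Type*} [AddCommMonoid R] (x : α) (f : List (List α) → R) :
    List (List α) → R
  | [] => f [[x]]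
  | s :: S => f ([x] :: s :: S) + f ((x :: s) :: S)

/-- The new letter is a block by itself or joins the first block. -/
theorem sum_segmentations_cons' {α R : Type*} [AddCommMonoid R] (x : α) (l : List α)
    (f : List (List α) → R) :
    ((segmentations (x :: l)).map f).sum =
      ((segmentations l).map (consSegmentation x f)).sum := by
  cases l with
  | nil => simp [segmentations, headSegmentations, consSegmentation]
  | cons y r =>
    rw [sum_segmentations_cons, sum_headSegmentations_cons, sum_segmentations_cons]
    rfl

theorem flatten_of_mem_headSegmentations {α : Type*} :
    ∀ {l : List α} {p : List α × List (List α)}, p ∈ headSegmentations l →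
      p.1 ++ p.2.flatten = l ∧ [] ∉ p.2
  | [], p, h => by
    simp only [headSegmentations, List.mem_singleton] at h
    simp [h]
  | y :: r, p, h => by
    simp only [headSegmentations, List.mem_flatMap, List.mem_cons, List.not_mem_nil,
      or_false] at h
    obtain ⟨q, hq, rfl | rfl⟩ := h <;>
    obtain ⟨h1, h2⟩ := flatten_of_mem_headSegmentations hq <;> simp [h1, h2]

theorem flatten_of_mem_segmentations {α : Type*} {l : List α} {S : List (List α)}
    (h : S ∈ segmentations l) : S.flatten = l ∧ [] ∉ S := by
  cases l with
  | nil => simp only [segmentations, List.mem_singleton] at h; simp [h]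
  | cons x r =>
    simp only [segmentations, List.mem_map] at h
    obtain ⟨p, hp, rfl⟩ := h
    obtain ⟨h1, h2⟩ := flatten_of_mem_headSegmentations hp
    simp [h1, h2]

theorem mem_headSegmentations {α : Type*} (S : List (List α)) :
    ∀ s : List α, [] ∉ S → (s, S) ∈ headSegmentations (s ++ S.flatten) := by
  induction S with
  | nil =>
    intro s _
    induction s with
    | nil => simp [headSegmentations]
    | cons y s ih =>
      simp only [List.flatten_nil, List.append_nil] at ih ⊢
      simp only [headSegmentations, List.mem_flatMap]
      exact ⟨_, ih, by simp⟩
  | cons s₀ S ih =>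
    intro s hS
    simp only [List.mem_cons, not_or] at hS
    induction s with
    | nil =>
      obtain ⟨y, s₁, rfl⟩ := List.exists_cons_of_ne_nil (Ne.symm hS.1)
      simp only [List.flatten_cons, List.nil_append, List.cons_append, headSegmentations,
        List.mem_flatMap]
      exact ⟨_, ih s₁ hS.2, by simp⟩
    | cons y s ihs =>
      simp only [List.cons_append, headSegmentations, List.mem_flatMap]
      exact ⟨_, ihs, by simp⟩

theorem mem_segmentations {α : Type*} {l : List α} {S : List (List α)} :
    S ∈ segmentations l ↔ S.flatten = l ∧ [] ∉ S := by
  refine ⟨flatten_of_mem_segmentations, ?_⟩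
  rintro ⟨rfl, h⟩
  cases S with
  | nil => simp [segmentations]
  | cons s S =>
    simp only [List.mem_cons, not_or] at h
    obtain ⟨y, s₁, rfl⟩ := List.exists_cons_of_ne_nil (Ne.symm h.1)
    simp only [List.flatten_cons, List.cons_append, segmentations, List.mem_map]
    exact ⟨_, mem_headSegmentations S s₁ h.2, rfl⟩

theorem nodup_headSegmentations {α : Type*} : ∀ l : List α, (headSegmentations l).Nodup
  | [] => by simp [headSegmentations]
  | y :: r => by
    rw [headSegmentations, List.nodup_flatMap]
    refine ⟨fun p _ => by simp, (nodup_headSegmentations r).imp fun {p q} hpq => ?_⟩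
    rw [Function.onFun, List.disjoint_left]
    rintro a ha hb
    simp only [List.mem_cons, List.not_mem_nil, or_false] at ha hb
    apply hpq
    rcases ha with rfl | rfl <;> rcases hb with hb | hb <;>
      simp_all [Prod.ext_iff]

theorem nodup_segmentations {α : Type*} (l : List α) : (segmentations l).Nodup := by
  cases l with
  | nil => simp [segmentations]
  | cons x r =>
    refine (nodup_headSegmentations r).map fun p q h => ?_
    simpa [Prod.ext_iff] using h

theorem segmentations_map {α β : Type*} (g : α → β) (l : List α) :
    segmentations (l.map g) = (segmentations l).map fun S => S.map (List.map g) := by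
  have h : ∀ r : List α, headSegmentations (r.map g) =
      (headSegmentations r).map fun p => (p.1.map g, p.2.map (List.map g)) := by
    intro r
    induction r with
    | nil => simp [headSegmentations]
    | cons y r ih =>
      rw [List.map_cons, headSegmentations, ih, headSegmentations, List.flatMap_map,
        List.map_flatMap]
      simp
  cases l with
  | nil => simp [segmentations]
  | cons x r => simp [segmentations, h, Function.comp_def]

/-- Summing over the segmentations of every block of a segmentation. -/
def blockwiseSum {α R : Type*} [AddCommMonoid R] :
    List (List α) → (List (List (List α)) → R) → R
  | [], f => f []
  | u :: U, f => ((segmentations u).map fun V => blockwiseSum U fun T => f (V :: T)).sum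

/-- The ways of adding a letter in front of a twofold segmentation. -/
def consDoubleSegmentation {α R : Type*} [AddCommMonoid R] (x : α)
    (f : List (List (List α)) → R) : List (List (List α)) → R
  | [] => f [[[x]]]
  -- An empty entry comes only from the segmentation of an empty block. With this value the
  -- recursion holds term by term and nonemptiness of the blocks need not be tracked.
  | [] :: T => f ([[x]] :: [] :: T) + f ([[x]] :: T)
  | (s :: t) :: T =>
    f ([[x]] :: (s :: t) :: T) + (f (([x] :: s :: t) :: T) + f (((x :: s) :: t) :: T))

theorem blockwiseSum_add {α R : Type*} [AddCommMonoid R] (U : List (List α)) :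
    ∀ f g : List (List (List α)) → R,
      blockwiseSum U (fun T => f T + g T) = blockwiseSum U f + blockwiseSum U g := by
  induction U with
  | nil => intro f g; rfl
  | cons u U ih => intro f g; simp [blockwiseSum, ih, List.sum_map_add]

/-- Grouping the blocks of a fine cutting amounts to refining every block of a coarse one. Both sums
obey the same recursion when a letter is put in front, so the induction runs over all `f` at once.
-/
theorem sum_segmentations_segmentations_eq {α R : Type*} [AddCommMonoid R] (l : List α) :
    ∀ f : List (List (List α)) → R,
      ((segmentations l).map fun S => ((segmentations S).map f).sum).sum =
        ((segmentations l).map fun U => blockwiseSum U f).sum := by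
  induction l with
  | nil => intro f; simp [segmentations, blockwiseSum]
  | cons x l ih =>
    intro f
    have h1 : ((segmentations (x :: l)).map fun S => ((segmentations S).map f).sum).sum =
        ((segmentations l).map fun S =>
          ((segmentations S).map (consDoubleSegmentation x f)).sum).sum := by
      rw [sum_segmentations_cons']
      congr 2
      ext S
      cases S with
      | nil => simp [consSegmentation, segmentations, headSegmentations, consDoubleSegmentation]
      | cons s S =>
        rw [consSegmentation, sum_segmentations_cons' [x], sum_segmentations_cons s,
          sum_segmentations_cons (x :: s), sum_segmentations_cons s, ← List.sum_map_add]
        congr 2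
        ext p
        simp only [consSegmentation, consDoubleSegmentation]
        abel
    have h2 : ((segmentations (x :: l)).map fun U => blockwiseSum U f).sum =
        ((segmentations l).map fun U => blockwiseSum U (consDoubleSegmentation x f)).sum := by
      rw [sum_segmentations_cons']
      congr 2
      ext U
      cases U with
      | nil => simp [consSegmentation, blockwiseSum, segmentations, headSegmentations,
          consDoubleSegmentation]
      | cons u U =>
        rw [consSegmentation]
        rw [blockwiseSum, blockwiseSum, sum_segmentations_cons' x u]
        rw [show segmentations [x] = [[[x]]] from rfl]
        simp only [List.map_cons, List.map_nil, List.sum_cons, List.sum_nil, add_zero]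
        rw [blockwiseSum, blockwiseSum, ← List.sum_map_add]
        congr 2
        ext V
        cases V with
        | nil =>
          simp only [consSegmentation, consDoubleSegmentation]
          rw [blockwiseSum_add]
        | cons v V =>
          simp only [consSegmentation, consDoubleSegmentation]
          rw [blockwiseSum_add, blockwiseSum_add]
    rw [h1, h2, ih]

/-- The composition of moulds: `∑ M (sums of the blocks) ∏ E (block)` over the segmentations of a
list into blocks. -/
def mouldComp {α R : Type*} [AddMonoid α] [CommSemiring R] (M E : List α → R) (l : List α) : R :=
  ((segmentations l).map fun S => M (S.map List.sum) * (S.map E).prod).sum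

/-- Both sides sum over twofold cuttings, and the sum of a coarse block is the sum of the sums of
its fine blocks. -/
theorem mouldComp_assoc {α R : Type*} [AddMonoid α] [CommSemiring R] (M E E' : List α → R) :
    mouldComp (mouldComp M E) E' = mouldComp M (mouldComp E E') := by
  ext l
  have h1 : mouldComp (mouldComp M E) E' l = ((segmentations l).map fun S =>
      ((segmentations S).map fun T : List (List (List α)) =>
        M (T.map fun t => (t.map List.sum).sum) *
          (T.map fun t => E (t.map List.sum) * (t.map E').prod).prod).sum).sum := by
    rw [mouldComp]
    congr 1
    refine List.map_congr_left fun S _ => ?_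
    rw [mouldComp, ← List.sum_map_mul_right, segmentations_map, List.map_map]
    congr 1
    refine List.map_congr_left fun T hT => ?_
    have hS : S = T.flatten := (flatten_of_mem_segmentations hT).1.symm
    simp only [Function.comp_apply, List.map_map, mul_assoc]
    congr 1
    rw [List.prod_map_mul]
    congr 1
    rw [hS, List.map_flatten, List.prod_flatten, List.map_map]
    rfl
  have h2 : ∀ (U : List (List α)) (N : List α → R), blockwiseSum U (fun T =>
      N (T.map fun t => (t.map List.sum).sum) *
        (T.map fun t => E (t.map List.sum) * (t.map E').prod).prod) =
      N (U.map List.sum) * (U.map (mouldComp E E')).prod := by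
    intro U
    induction U with
    | nil => intro N; simp [blockwiseSum]
    | cons u U ih =>
      intro N
      rw [blockwiseSum, List.map_cons, List.map_cons, List.prod_cons, mouldComp,
        ← List.sum_map_mul_right, ← List.sum_map_mul_left]
      congr 1
      refine List.map_congr_left fun V hV => ?_
      have hsum : (V.map List.sum).sum = u.sum := by
        rw [← (flatten_of_mem_segmentations hV).1, List.sum_flatten]
      have := ih fun L => N (u.sum :: L) * (E (V.map List.sum) * (V.map E').prod)
      simp only [List.map_cons, List.prod_cons, hsum]
      simp only [mul_assoc] at this ⊢
      rw [this]
  rw [h1, sum_segmentations_segmentations_eq, mouldComp]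
  simp_rw [h2]

end Segmentations

/-! ### Compositions, monotone surjections, and the exp–log identity -/

section Compositions

theorem sum_segmentations_eq_sum_composition {α R : Type*} [AddCommMonoid R] {n : ℕ} {l : List α}
    (hl : l.length = n) (f : List (List α) → R) :
    ((segmentations l).map f).sum = ∑ c : Composition n, f (l.splitWrtComposition c) := by
  classical
  subst hl
  rw [← List.sum_toFinset f (nodup_segmentations l)]
  symm
  refine Finset.sum_bij (fun c _ => l.splitWrtComposition c) (fun c _ => ?_) (fun c _ c' _ h => ?_)
    (fun S hS => ?_) (fun _ _ => rfl)
  · rw [List.mem_toFinset, mem_segmentations]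
    refine ⟨l.flatten_splitWrtComposition c, fun h => ?_⟩
    simpa using List.length_pos_of_mem_splitWrtComposition h
  · have h1 := congrArg (List.map List.length) h
    rw [List.map_length_splitWrtComposition, List.map_length_splitWrtComposition] at h1
    exact Composition.ext h1
  · rw [List.mem_toFinset, mem_segmentations] at hS
    obtain ⟨h1, h2⟩ := hS
    subst h1
    refine ⟨⟨S.map List.length, fun {i} hi => ?_, by rw [List.length_flatten]⟩,
      Finset.mem_univ _, List.splitWrtComposition_flatten _ _ rfl⟩
    obtain ⟨s, hs, rfl⟩ := List.mem_map.mp hi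
    exact List.length_pos_of_ne_nil fun h => h2 (h ▸ hs)

theorem splitWrtComposition_ofFn {α : Type*} {n : ℕ} (c : Composition n) (x : Fin n → α) :
    (List.ofFn x).splitWrtComposition c =
      List.ofFn fun k => List.ofFn fun j => x (c.embedding k j) := by
  refine List.ext_getElem (by simp) fun k h1 h2 => ?_
  rw [List.getElem_splitWrtComposition, List.getElem_ofFn]
  have hk : k < c.length := by simpa using h2
  have hs : c.sizeUpTo (k + 1) = c.sizeUpTo k + c.blocksFun ⟨k, hk⟩ := c.sizeUpTo_succ hk
  have hle := c.sizeUpTo_le (k + 1)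
  refine List.ext_getElem ?_ fun j h3 h4 => ?_
  · simp only [List.length_drop, List.length_take, List.length_ofFn]
    omega
  · simp only [List.getElem_drop, List.getElem_take, List.getElem_ofFn]
    rfl

theorem mouldComp_ofFn {α R : Type*} [AddCommMonoid α] [CommSemiring R] (M E : List α → R) {n : ℕ}
    (x : Fin n → α) :
    mouldComp M E (List.ofFn x) = ∑ c : Composition n,
      M (List.ofFn fun k => ∑ j, x (c.embedding k j)) *
        ∏ k, E (List.ofFn fun j => x (c.embedding k j)) := by
  rw [mouldComp, sum_segmentations_eq_sum_composition (List.length_ofFn)]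
  refine Finset.sum_congr rfl fun c _ => ?_
  rw [splitWrtComposition_ofFn, List.map_ofFn, List.map_ofFn, List.prod_ofFn]
  congr 2
  simp only [Function.comp_def, List.sum_ofFn]

theorem mouldComp_congr {α R : Type*} [AddMonoid α] [CommSemiring R] {M M' E E' : List α → R}
    {l : List α} (h : ∀ S ∈ segmentations l, M (S.map List.sum) * (S.map E).prod =
      M' (S.map List.sum) * (S.map E').prod) : mouldComp M E l = mouldComp M' E' l := by
  rw [mouldComp, mouldComp, List.map_congr_left h]

/-- Only the cutting into single letters survives. -/
theorem mouldComp_unit {α R : Type*} [AddMonoid α] [CommSemiring R] (M : List α → R) (l : List α) :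
    mouldComp M (fun s => if s.length = 1 then 1 else 0) l = M l := by
  induction l generalizing M with
  | nil => simp [mouldComp, segmentations]
  | cons x l ih =>
    have h := ih fun L => M (x :: L)
    rw [mouldComp] at h ⊢
    rw [sum_segmentations_cons', ← h]
    congr 1
    refine List.map_congr_left fun S hS => ?_
    cases S with
    | nil => simp [consSegmentation]
    | cons s S =>
      have hs : s ≠ [] := fun h => (flatten_of_mem_segmentations hS).2 (by simp [h])
      simp [consSegmentation, hs]

/-- These are the Taylor coefficients of exp(log(1 + x)) = 1 + x. Composition of formal multilinear
series is itself a sum over compositions, so uniqueness of the power series gives the identity. -/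
theorem sum_composition_exp_log (n : ℕ) :
    ∑ c : Composition n, ((c.length.factorial : ℂ)⁻¹) *
      ∏ k, (-(-1 : ℂ) ^ c.blocksFun k / c.blocksFun k) = if n ≤ 1 then 1 else 0 := by
  have h1 := hasFPowerSeriesAt_clog_one_add
  have h2 : HasFPowerSeriesAt Complex.exp (NormedSpace.expSeries ℂ ℂ)
      ((fun x => Complex.log (1 + x)) 0) := by
    simp only [add_zero, Complex.log_one]
    rw [Complex.exp_eq_exp_ℂ]
    exact NormedSpace.exp_hasFPowerSeriesAt_zero
  have h3 := HasFPowerSeriesAt.comp (f := fun x => Complex.log (1 + x)) h2 h1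
  have h4 : HasFPowerSeriesAt (Complex.exp ∘ fun x => Complex.log (1 + x))
      (.ofScalars ℂ fun n => if n ≤ 1 then (1 : ℂ) else 0) 0 := by
    rw [hasFPowerSeriesAt_iff]
    have hne : ∀ᶠ z in nhds (0 : ℂ), 1 + z ≠ 0 := by
      have : ContinuousAt (fun z : ℂ => 1 + z) 0 := by fun_prop
      exact this.eventually_ne (by simp)
    filter_upwards [hne] with z hz
    have := hasSum_sum_of_ne_finset_zero (f := fun n => z ^ n •
      (FormalMultilinearSeries.ofScalars ℂ fun n => if n ≤ 1 then (1 : ℂ) else 0).coeff n)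
      (s := Finset.range 2) (L := SummationFilter.unconditional ℕ) (fun b hb => by
        have : ¬ b ≤ 1 := by simp at hb; omega
        simp [FormalMultilinearSeries.coeff_ofScalars, this])
    convert this using 1
    · rfl
    · simp [Finset.sum_range_succ, FormalMultilinearSeries.coeff_ofScalars, Complex.exp_log hz]
  have h5 := congrArg (fun p => p n fun _ => (1 : ℂ)) (h3.eq_formalMultilinearSeries h4)
  simp only [FormalMultilinearSeries.comp, sum_apply,
    FormalMultilinearSeries.compAlongComposition_apply, NormedSpace.expSeries_eq_ofScalars,
    FormalMultilinearSeries.apply_eq_prod_smul_coeff, FormalMultilinearSeries.coeff_ofScalars,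
    FormalMultilinearSeries.applyComposition] at h5
  simpa [mul_comm] using h5

theorem mem_iff_lt_card_of_isLowerSet {r : ℕ} {s : Finset (Fin r)} (hs : IsLowerSet (s : Set (Fin r)))
    (j : Fin r) : j ∈ s ↔ (j : ℕ) < s.card := by
  constructor
  · intro h
    have : Finset.Iic j ⊆ s := fun i hi => hs (Finset.mem_Iic.mp hi) h
    have := Finset.card_le_card this
    rw [Fin.card_Iic] at this
    omega
  · intro h
    by_contra hj
    have : s ⊆ Finset.Iio j := fun i hi => Finset.mem_Iio.mpr (by
      by_contra hc
      exact hj (hs (not_lt.mp hc) hi))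
    have := Finset.card_le_card this
    rw [Fin.card_Iio] at this
    omega

/-- The sublevel sets of a monotone map are initial segments, hence determined by their
cardinalities, which are partial sums of the fibre sizes. -/
theorem monotone_eq_of_card_fiber_eq {r m : ℕ} {ψ χ : Fin r → Fin m} (hψ : Monotone ψ)
    (hχ : Monotone χ) (h : ∀ k, (Finset.univ.filter fun a => ψ a = k).card =
      (Finset.univ.filter fun a => χ a = k).card) : ψ = χ := by
  have key : ∀ k, (Finset.univ.filter fun a => ψ a ≤ k).card =
      (Finset.univ.filter fun a => χ a ≤ k).card := by
    intro k
    have e : ∀ φ : Fin r → Fin m, (Finset.univ.filter fun a => φ a ≤ k).card =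
        ∑ i ∈ Finset.Iic k, (Finset.univ.filter fun a => φ a = i).card := by
      intro φ
      rw [Finset.card_eq_sum_card_fiberwise (t := Finset.Iic k) (f := φ)
        (fun a ha => by simpa using ha)]
      refine Finset.sum_congr rfl fun i hi => ?_
      congr 1
      ext a
      simp only [Finset.mem_filter, Finset.mem_univ, true_and, and_iff_right_iff_imp]
      rintro rfl
      simpa using hi
    rw [e, e]
    exact Finset.sum_congr rfl fun i _ => h i
  have low : ∀ {φ : Fin r → Fin m}, Monotone φ → ∀ k,
      IsLowerSet ((Finset.univ.filter fun a => φ a ≤ k : Finset (Fin r)) : Set (Fin r)) := by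
    intro φ hφ k a b hab ha
    simp only [Finset.coe_filter, Finset.mem_univ, true_and, Set.mem_ofPred_eq] at ha ⊢
    exact (hφ hab).trans ha
  have iff : ∀ a k, ψ a ≤ k ↔ χ a ≤ k := by
    intro a k
    have h1 := mem_iff_lt_card_of_isLowerSet (low hψ k) a
    have h2 := mem_iff_lt_card_of_isLowerSet (low hχ k) a
    rw [key, ← h2] at h1
    simpa using h1
  ext a
  exact congrArg _ (le_antisymm ((iff a _).mpr le_rfl) ((iff a _).mp le_rfl))

theorem Composition.monotone_index {n : ℕ} (c : Composition n) : Monotone c.index := by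
  intro i j hij
  by_contra h
  have h1 := c.lt_sizeUpTo_index_succ j
  have h2 := c.sizeUpTo_index_le i
  have h3 : c.sizeUpTo (c.index j).succ ≤ c.sizeUpTo (c.index i) :=
    c.monotone_sizeUpTo (not_le.mp h)
  exact absurd (Fin.le_def.mp hij) (by omega)

theorem Composition.surjective_index {n : ℕ} (c : Composition n) : Function.Surjective c.index :=
  fun k => ⟨c.embedding k ⟨0, c.one_le_blocksFun k⟩, c.index_embedding _ _⟩

theorem Composition.card_index_fiber {n : ℕ} (c : Composition n) (k : Fin c.length) :
    (Finset.univ.filter fun a => c.index a = k).card = c.blocksFun k := by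
  have : (Finset.univ.filter fun a => c.index a = k) =
      Finset.univ.map (c.embedding k).toEmbedding := by
    ext a
    simp only [Finset.mem_filter, Finset.mem_univ, true_and, Finset.mem_map,
      RelEmbedding.coe_toEmbedding]
    constructor
    · rintro rfl
      exact ⟨_, c.embedding_comp_inv a⟩
    · rintro ⟨j, rfl⟩
      exact c.index_embedding _ _
  rw [this, Finset.card_map, Finset.card_univ, Fintype.card_fin]

open Classical in
/-- Monotone surjections between finite ordinals correspond to compositions. -/
theorem sum_monotone_surjective_eq {R : Type*} [AddCommMonoid R] {r : ℕ} (hr : 1 ≤ r)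
    (f : (m : ℕ) → (Fin r → Fin m) → R) :
    (∑ m ∈ Finset.Icc 1 r, ∑ ψ : Fin r → Fin m,
      if Monotone ψ ∧ Function.Surjective ψ then f m ψ else 0) =
      ∑ c : Composition r, f c.length c.index := by
  simp_rw [← Finset.sum_filter]
  rw [Finset.sum_sigma']
  symm
  let g : (Σ m, Fin r → Fin m) → List ℕ := fun p =>
    List.ofFn fun k => (Finset.univ.filter fun a => p.2 a = k).card
  have hg : ∀ c : Composition r, g ⟨c.length, c.index⟩ = c.blocks := fun c => by
    simp only [g, c.card_index_fiber, c.ofFn_blocksFun]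
  refine Finset.sum_bij (fun c _ => ⟨c.length, c.index⟩) (fun c _ => ?_) (fun c _ c' _ h => ?_)
    (fun p hp => ?_) (fun _ _ => rfl)
  · simp only [Finset.mem_sigma, Finset.mem_Icc, Finset.mem_filter, Finset.mem_univ, true_and]
    exact ⟨⟨c.length_pos_iff.mpr hr, c.length_le⟩, c.monotone_index, c.surjective_index⟩
  · exact Composition.ext (by rw [← hg c, ← hg c', h])
  · obtain ⟨m, ψ⟩ := p
    simp only [Finset.mem_sigma, Finset.mem_Icc, Finset.mem_filter, Finset.mem_univ,
      true_and] at hp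
    obtain ⟨-, hmono, hsurj⟩ := hp
    let c : Composition r :=
      { blocks := g ⟨m, ψ⟩
        blocks_pos := fun {i} hi => by
          obtain ⟨k, rfl⟩ := (List.mem_ofFn' _ _).mp hi
          obtain ⟨a, ha⟩ := hsurj k
          exact Finset.card_pos.mpr ⟨a, by simpa using ha⟩
        blocks_sum := by
          rw [List.sum_ofFn, ← Finset.card_eq_sum_card_fiberwise (fun a _ => Finset.mem_univ (ψ a)),
            Finset.card_univ, Fintype.card_fin] }
    have hlen : c.length = m := List.length_ofFn
    have key : ∀ (m' : ℕ) (h : m' = m) (χ : Fin r → Fin m'), Monotone χ →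
        g ⟨m', χ⟩ = g ⟨m, ψ⟩ → (⟨m', χ⟩ : Σ m, Fin r → Fin m) = ⟨m, ψ⟩ := by
      rintro m' rfl χ hχ he
      rw [monotone_eq_of_card_fiber_eq hχ hmono fun k => congrFun (List.ofFn_injective he) k]
    exact ⟨c, Finset.mem_univ _, key _ hlen _ c.monotone_index (hg c)⟩

end Compositions

/-! ### Exchanging the phases of neighbouring contours -/

section WallCrossingFormula
open MeasureTheory Set Filter Topology

theorem rayTransform_eq_of_continuousOn {ζ u : ℂ} {T : Set ℝ} (hT : _root_.IsPreconnected T) {f : ℝ → ℂ}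
    (hf : ContinuousOn f T) (hre : ∀ s ∈ T, 0 < (ζ * f s).re)
    (hu : ∀ s ∈ T, -u / f s ∈ Complex.slitPlane) {x y : ℝ} (hx : x ∈ T) (hy : y ∈ T) :
    rayTransform ζ (f x) u = rayTransform ζ (f y) u := by
  refine hT.induction₂ (fun x y => rayTransform ζ (f x) u = rayTransform ζ (f y) u)
    (fun x hx => ?_) (fun _ _ _ _ _ _ => Eq.trans) (fun _ _ _ _ => Eq.symm) hx hy
  have hev : ∀ᶠ b in 𝓝 (f x), 0 < (ζ * b).re ∧ -u / b ∈ Complex.slitPlane := by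
    have h0 : f x ≠ 0 := fun h => by have := hre x hx; simp [h] at this
    have h1 : ContinuousAt (fun b : ℂ => (ζ * b).re) (f x) :=
      (Complex.continuous_re.comp (continuous_const.mul continuous_id)).continuousAt
    have h2 : ContinuousAt (fun b : ℂ => -u / b) (f x) :=
      continuousAt_const.div continuousAt_id h0
    exact (h1.eventually_const_lt (hre x hx)).and
      (h2.eventually (Complex.isOpen_slitPlane.mem_nhds (hu x hx)))
  obtain ⟨r, hr, hball⟩ := Metric.eventually_nhds_iff_ball.mp hev
  filter_upwards [(hf x hx).eventually (Metric.ball_mem_nhds _ hr)] with y hy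
  exact rayTransform_eq_of_isPreconnected Metric.isOpen_ball (convex_ball _ _).isPreconnected
    (fun a ha => (hball a ha).1) (fun a ha => (hball a ha).2) (Metric.mem_ball_self hr) hy

/-- The contour swept between the phases t₂ - h and t₂ + h never meets the first one, and one scale
`ε` works for the whole sweep. -/
theorem eventually_not_sameRay_phaseSlope {w₁ w₂ : ℂ} (h₁ : w₁ ≠ 0) (h₂ : w₂ ≠ 0) {t₁ t₂ h : ℝ}
    (ht : SameRay ℝ w₁ w₂ → t₁ < t₂ - h) :
    ∀ᶠ ε in 𝓝[>] (0 : ℝ), ∀ s ∈ Icc (-h) h,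
      ¬ SameRay ℝ (Complex.exp (-((ε * t₁ : ℝ) * Complex.I)) / w₁)
        (Complex.exp (-((ε * (t₂ + s) : ℝ) * Complex.I)) / w₂) := by
  have hbd : ∀ s ∈ Icc (-h) h, ∀ ε : ℝ, |ε * (t₂ + s)| ≤ |ε * (|t₂| + h)| := by
    intro s hs ε
    rw [abs_mul, abs_mul]
    refine mul_le_mul_of_nonneg_left ?_ (abs_nonneg _)
    have h1 : |s| ≤ h := abs_le.mpr hs
    have h2 := abs_nonneg t₂
    have h3 := abs_nonneg s
    rw [abs_of_nonneg (by linarith : 0 ≤ |t₂| + h)]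
    exact (abs_add_le _ _).trans (by linarith)
  by_cases hray : SameRay ℝ w₁ w₂
  · filter_upwards [eventually_abs_mul_lt t₁ (show (0 : ℝ) < Real.pi / 2 by positivity),
      eventually_abs_mul_lt (|t₂| + h) (show (0 : ℝ) < Real.pi / 2 by positivity),
      self_mem_nhdsWithin] with ε e1 e2 (e3 : 0 < ε) s hs
    have hlt : t₁ < t₂ + s := by linarith [ht hray, hs.1]
    exact not_sameRay_phaseSlope h₁ h₂ hray (mul_lt_mul_of_pos_left hlt e3).ne
      ((abs_sub _ _).trans_lt (by linarith [hbd s hs ε]))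
  · obtain ⟨δ, hδ, hδ'⟩ := exists_not_sameRay_phaseSlope hray
    filter_upwards [eventually_abs_mul_lt t₁ hδ, eventually_abs_mul_lt (|t₂| + h) hδ]
      with ε e1 e2 s hs
    exact hδ' _ _ e1 ((hbd s hs ε).trans_lt e2)

/-- If the denominators share a ray, the quotient of the sums is a convex combination of the
quotients. -/
theorem re_add_div_add_pos {z₁ z₂ w₁ w₂ : ℂ} (h₁ : 0 < (z₁ / w₁).re) (h₂ : 0 < (z₂ / w₂).re)
    (h : SameRay ℝ w₁ w₂) : 0 < ((z₁ + z₂) / (w₁ + w₂)).re := by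
  have n1 := (ne_zero_of_div_re_pos h₁).2
  have n2 := (ne_zero_of_div_re_pos h₂).2
  obtain ⟨r, hr, rfl⟩ := h.exists_pos_left n1 n2
  have e : (z₁ + z₂) / (w₁ + r • w₁) =
      (((1 + r)⁻¹ : ℝ) : ℂ) * (z₁ / w₁ + (r : ℂ) * (z₂ / (r • w₁))) := by
    have hr0 : (r : ℂ) ≠ 0 := by exact_mod_cast hr.ne'
    have hr1 : (1 + r : ℂ) ≠ 0 := by exact_mod_cast (by positivity : (1 + r) ≠ 0)
    rw [Complex.real_smul]
    have : w₁ + r * w₁ = (1 + r) * w₁ := by ring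
    rw [this]
    push_cast
    field_simp
  rw [e, Complex.re_ofReal_mul, Complex.add_re, Complex.re_ofReal_mul]
  positivity

theorem sum_insertNth {n : ℕ} (k : Fin (n + 1)) (ζ : ℂ) (z : Fin n → ℂ) :
    ∑ i, Fin.insertNth (α := fun _ => ℂ) k ζ z i = ζ + ∑ i, z i := by
  rw [Fin.sum_univ_succAbove _ k]
  simp

theorem sum_update_add {n : ℕ} (k : Fin n) (ζ : ℂ) (z : Fin n → ℂ) :
    ∑ i, Function.update z k (z k + ζ) i = ζ + ∑ i, z i := by
  rw [← Finset.add_sum_erase _ _ (Finset.mem_univ k),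
    ← Finset.add_sum_erase (a := k) _ (fun i => z i) (Finset.mem_univ k),
    Function.update_self, Finset.sum_congr rfl fun i hi => by
      rw [Function.update_of_ne (Finset.ne_of_mem_erase hi)]]
  ring

theorem phaseSlopes_insertNth {n : ℕ} (k : Fin (n + 1)) (ω : ℂ) (w : Fin n → ℂ) (τ ε : ℝ)
    (t : Fin n → ℝ) :
    phaseSlopes (Fin.insertNth (α := fun _ => ℂ) k ω w)
        (fun i => ε * Fin.insertNth (α := fun _ => ℝ) k τ t i) =
      Fin.insertNth (α := fun _ => ℂ) k (Complex.exp (-((ε * τ : ℝ) * Complex.I)) / ω)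
        (phaseSlopes w fun i => ε * t i) := by
  symm
  rw [Fin.insertNth_eq_iff]
  constructor
  · simp [phaseSlopes]
  · ext j
    simp [phaseSlopes, Fin.removeNth]

/-- The wall crossing formula: interchanging the phases of two consecutive entries on a common
ray. -/
theorem phaseLimit_insertNth {m : ℕ} (k : Fin (m + 1)) {ζ ω : ℂ} {z w : Fin (m + 1) → ℂ}
    {t : Fin (m + 1) → ℝ} {h : ℝ} (hh : 0 < h) (hre : ∀ i, 0 < (z i / w i).re)
    (hζ : 0 < (ζ / ω).re) (hray : SameRay ℝ (w k) ω)
    (hsep : Separates (Fin.insertNth (α := fun _ => ℂ) k.castSucc ω w)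
      (Fin.insertNth (α := fun _ => ℝ) k.castSucc (t k + h) t))
    (hsep' : Separates (Fin.insertNth (α := fun _ => ℂ) k.castSucc ω w)
      (Fin.insertNth (α := fun _ => ℝ) k.castSucc (t k - h) t))
    (hsepu : Separates (Function.update w k (w k + ω)) t)
    (hprev : ∀ _h : 0 < (k : ℕ), SameRay ℝ (w ⟨k - 1, by omega⟩) ω →
      t ⟨k - 1, by omega⟩ < t k - h) :
    phaseLimit (Fin.insertNth (α := fun _ => ℂ) k.castSucc ζ z)
        (Fin.insertNth (α := fun _ => ℂ) k.castSucc ω w)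
        (Fin.insertNth (α := fun _ => ℝ) k.castSucc (t k + h) t) =
      phaseLimit (Fin.insertNth (α := fun _ => ℂ) k.castSucc ζ z)
        (Fin.insertNth (α := fun _ => ℂ) k.castSucc ω w)
        (Fin.insertNth (α := fun _ => ℝ) k.castSucc (t k - h) t) +
      phaseLimit (Function.update z k (z k + ζ)) (Function.update w k (w k + ω)) t := by
  have hω := (ne_zero_of_div_re_pos hζ).2
  have hw : ∀ i, w i ≠ 0 := fun i => (ne_zero_of_div_re_pos (hre i)).2
  have hreI : ∀ i, 0 < (Fin.insertNth (α := fun _ => ℂ) k.castSucc ζ z i /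
      Fin.insertNth (α := fun _ => ℂ) k.castSucc ω w i).re := by
    intro i
    refine Fin.succAboveCases k.castSucc ?_ (fun j => ?_) i
    · simpa using hζ
    · rw [Fin.insertNth_apply_succAbove, Fin.insertNth_apply_succAbove]
      exact hre j
  have hreU : ∀ i, 0 < (Function.update z k (z k + ζ) i /
      Function.update w k (w k + ω) i).re := by
    intro i
    rcases eq_or_ne i k with rfl | hi
    · simpa using re_add_div_add_pos (hre i) hζ hray
    · simpa [Function.update_of_ne hi] using hre i
  have v1 := eventually_chainValue_eq_phaseLimit hreI hsep
  have v2 := eventually_chainValue_eq_phaseLimit hreI hsep'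
  have v3 := eventually_chainValue_eq_phaseLimit hreU hsepu
  have v4 : ∀ᶠ ε in 𝓝[>] (0 : ℝ), |ε * h| < Real.pi / 2 :=
    eventually_abs_mul_lt _ (by positivity)
  -- The moving contour stays clear of the preceding one during the whole sweep, so only the
  -- crossing with the next contour contributes.
  have v5 : ∀ᶠ ε in 𝓝[>] (0 : ℝ), ∀ hk : 0 < (k : ℕ), ∀ s ∈ Icc (-h) h,
      ¬ SameRay ℝ (Complex.exp (-((ε * t ⟨k - 1, by omega⟩ : ℝ) * Complex.I)) / w ⟨k - 1, by omega⟩)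
        (Complex.exp (-((ε * (t k + s) : ℝ) * Complex.I)) / ω) := by
    by_cases hk : 0 < (k : ℕ)
    · filter_upwards [eventually_not_sameRay_phaseSlope (hw _) hω (hprev hk)] with ε hε _ using hε
    · exact Eventually.of_forall fun _ h => absurd h hk
  have v6 : ∀ᶠ ε in 𝓝[>] (0 : ℝ), |ε * (t k + h) - Complex.arg (ζ / ω)| < Real.pi / 2 ∧
      |ε * (t k - h) - Complex.arg (ζ / ω)| < Real.pi / 2 := by
    have key : ∀ τ : ℝ, ∀ᶠ ε in 𝓝[>] (0 : ℝ), |ε * τ - Complex.arg (ζ / ω)| < Real.pi / 2 := by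
      intro τ
      have h : ContinuousAt (fun ε : ℝ => |ε * τ - Complex.arg (ζ / ω)|) 0 := by fun_prop
      exact nhdsWithin_le_nhds (h.eventually_lt_const (by simpa using abs_arg_lt_of_re_pos hζ))
    exact (key _).and (key _)
  obtain ⟨ε, ⟨e1, e2, e3, e4, e5, e6⟩, (hε : 0 < ε)⟩ :=
    ((v1.and (v2.and (v3.and (v4.and (v5.and v6))))).and self_mem_nhdsWithin).exists
  rw [phaseSlopes_insertNth] at e1 e2
  obtain ⟨r, hr, hωr⟩ := hray.exists_pos_left (hw k) hω
  have hr0 : (r : ℂ) ≠ 0 := by exact_mod_cast hr.ne'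
  have hwk := hw k
  have hα : ∀ s : ℝ, Complex.exp (-((ε * (t k + s) : ℝ) * Complex.I)) / ω =
      ((r⁻¹ : ℝ) : ℂ) * phaseSlopes w (fun i => ε * t i) k *
        Complex.exp (-((ε * s : ℝ) * Complex.I)) := by
    intro s
    rw [← hωr, Complex.real_smul, phaseSlopes]
    push_cast
    rw [mul_add, add_mul, neg_add, Complex.exp_add]
    field_simp
  have hβ : Complex.exp (-((ε * (t k - h) : ℝ) * Complex.I)) / ω =
      ((r⁻¹ : ℝ) : ℂ) * phaseSlopes w (fun i => ε * t i) k *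
        Complex.exp ((ε * h : ℝ) * Complex.I) := by
    have := hα (-h)
    rw [← sub_eq_add_neg] at this
    rw [this]
    push_cast
    ring_nf
  have e4' := (abs_lt.mp e4).2
  have jump := chainIntegral_insertNth_sub k (ζ := ζ) (z := z) (inv_pos.mpr hr) (mul_pos hε hh)
    e4' (hα h) hβ e1.1 e2.1 (fun hk x hx => by
      refine rayTransform_eq_of_continuousOn (T := Icc (-h) h)
        (f := fun s => Complex.exp (-((ε * (t k + s) : ℝ) * Complex.I)) / ω)
        isPreconnected_Icc (by fun_prop) (fun s hs => ?_) (fun s hs => ?_)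
        (x := h) (y := -h) (right_mem_Icc.mpr (by linarith)) (left_mem_Icc.mpr (by linarith))
      · refine re_mul_phaseSlope_pos hζ ?_
        have h1 := mul_le_mul_of_nonneg_left hs.1 hε.le
        have h2 := mul_le_mul_of_nonneg_left hs.2 hε.le
        have h3 := abs_lt.mp e6.1
        have h4 := abs_lt.mp e6.2
        rw [abs_lt]
        constructor <;> linarith
      · exact neg_mul_ofReal_div_mem_slitPlane (div_ne_zero (Complex.exp_ne_zero _) hω)
          (div_ne_zero (Complex.exp_ne_zero _) (hw _)) (fun hs' => e5 hk s hs hs'.symm) hx)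
  -- Since w_k and w_k + ω lie on one ray, the two slopes at `k` differ by the positive factor 1 +
  -- r.
  have hU : chainIntegral (Function.update z k (z k + ζ)) (phaseSlopes w fun i => ε * t i) =
      chainIntegral (Function.update z k (z k + ζ))
        (phaseSlopes (Function.update w k (w k + ω)) fun i => ε * t i) := by
    rw [← chainIntegral_ofReal_mul (r := Function.update (fun _ => (1 : ℝ)) k (1 + r))
      (fun i => ?_) e3.1]
    · congr 1
      ext i
      rcases eq_or_ne i k with rfl | hi
      · have hr1 : (1 + r : ℂ) ≠ 0 := by exact_mod_cast (by positivity : (1 + r) ≠ 0)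
        simp only [phaseSlopes, Function.update_self, ← hωr, Complex.real_smul]
        have : w i + r * w i = (1 + r) * w i := by ring
        rw [this]
        push_cast
        field_simp
      · simp [phaseSlopes, Function.update_of_ne hi]
    · rcases eq_or_ne i k with rfl | hi
      · simp; positivity
      · simp [Function.update_of_ne hi]
  rw [hU] at jump
  rw [← e1.2, ← e2.2, ← e3.2, ← sub_eq_iff_eq_add']
  simp only [chainValue, sum_insertNth, sum_update_add]
  -- The residue factor 2πi cancels one of the normalising factors, as the merged chain has one
  -- variable fewer.
  rw [← mul_sub, ← mul_sub, jump, pow_succ]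
  have hpi : (2 * (Real.pi : ℂ) * Complex.I) ≠ 0 := Complex.two_pi_I_ne_zero
  field_simp

/-- The phase limit of a list of triples `(z, w, t)`. -/
noncomputable def listPhaseLimit (L : List (ℂ × ℂ × ℝ)) : ℂ :=
  phaseLimit (fun i => (L.get i).1) (fun i => (L.get i).2.1) (fun i => (L.get i).2.2)

/-- The length of `List.ofFn g` equals `n` only propositionally, so the transport goes through pairs
of a length and a tuple. -/
theorem apply_get_ofFn {α β : Type*} (F : ∀ n : ℕ, (Fin n → α) → β) {n : ℕ} (g : Fin n → α) :
    F (List.ofFn g).length (List.ofFn g).get = F n g :=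
  congrArg (fun p : Σ n, Fin n → α => F p.1 p.2) (List.equivSigmaTuple.right_inv ⟨n, g⟩)

theorem listPhaseLimit_ofFn {n : ℕ} (g : Fin n → ℂ × ℂ × ℝ) :
    listPhaseLimit (List.ofFn g) =
      phaseLimit (fun i => (g i).1) (fun i => (g i).2.1) (fun i => (g i).2.2) :=
  apply_get_ofFn (fun n (p : Fin n → ℂ × ℂ × ℝ) =>
    phaseLimit (fun i => (p i).1) (fun i => (p i).2.1) (fun i => (p i).2.2)) g

theorem append_cons_eq_ofFn_insertNth {α : Type*} (x : α) (B : List α) :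
    ∀ (A : List α) {n : ℕ} (g : Fin n → α) (hk : A.length < n + 1), A ++ B = List.ofFn g →
      A ++ x :: B = List.ofFn (Fin.insertNth (α := fun _ => α) ⟨A.length, hk⟩ x g)
  | [], n, g, hk, h => by
    simp only [List.nil_append] at h
    simp [h, Fin.insertNth_zero']
  | a :: A, 0, g, hk, h => by simp at h
  | a :: A, n + 1, g, hk, h => by
    rw [List.ofFn_succ, List.cons_append, List.cons.injEq] at h
    have ih := append_cons_eq_ofFn_insertNth x B A (fun i => g i.succ)
      (by simpa using hk) h.2
    have hg : g = Fin.cons (α := fun _ => α) a (fun i => g i.succ) := by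
      rw [h.1]; exact (Fin.cons_self_tail g).symm
    rw [List.cons_append, ih]
    conv_rhs => rw [hg]
    have : (⟨(a :: A).length, hk⟩ : Fin (n + 1 + 1)) =
        Fin.succ ⟨A.length, by simpa using hk⟩ := rfl
    rw [this, Fin.insertNth_succ_cons, List.ofFn_cons]

theorem append_cons_eq_ofFn_update {α : Type*} {A B : List α} {x y : α} {n : ℕ} {g : Fin n → α}
    (hk : A.length < n) (h : A ++ x :: B = List.ofFn g) :
    A ++ y :: B = List.ofFn (Function.update g ⟨A.length, hk⟩ y) := by
  have h1 : (A ++ x :: B).set A.length y = A ++ y :: B := by simp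
  rw [← h1, h]
  refine List.ext_getElem (by simp) fun i _ _ => ?_
  simp [List.getElem_set, Function.update_apply, Fin.ext_iff, eq_comm]

theorem exists_eq_ofFn {α : Type*} (L : List α) : ∃ (n : ℕ) (g : Fin n → α), L = List.ofFn g :=
  ⟨_, L.get, (List.ofFn_get L).symm⟩

/-- The phases of consecutive entries on a common ray are different. -/
def SeparatedPhases (p q : ℂ × ℂ × ℝ) : Prop := SameRay ℝ p.2.1 q.2.1 → p.2.2 ≠ q.2.2

/-- The phases of consecutive entries on a common ray increase. -/
def AscendingPhases (p q : ℂ × ℂ × ℝ) : Prop := SameRay ℝ p.2.1 q.2.1 → p.2.2 < q.2.2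

theorem listPhaseLimit_congr (M : List (ℂ × ℂ × ℝ × ℝ))
    (hre : ∀ p ∈ M, 0 < (p.1 / p.2.1).re)
    (h : M.IsChain fun p q => SameRay ℝ p.2.1 q.2.1 →
      0 < (q.2.2.1 - p.2.2.1) * (q.2.2.2 - p.2.2.2)) :
    listPhaseLimit (M.map fun p => (p.1, p.2.1, p.2.2.1)) =
      listPhaseLimit (M.map fun p => (p.1, p.2.1, p.2.2.2)) := by
  obtain ⟨n, g, hg⟩ := exists_eq_ofFn M
  rw [hg] at hre h ⊢
  rw [List.map_ofFn, List.map_ofFn, listPhaseLimit_ofFn, listPhaseLimit_ofFn]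
  rw [List.isChain_ofFn] at h
  exact phaseLimit_congr (fun i => hre _ ((List.mem_ofFn' _ _).mpr ⟨i, rfl⟩)) h

/-- The list form of `phaseLimit_insertNth`, suited to a recursion in which merging shortens the
list. -/
theorem listPhaseLimit_append_cons_cons {A r : List (ℂ × ℂ × ℝ)} {ζ ω z' w' : ℂ} {t' h : ℝ}
    (hh : 0 < h) (hre : ∀ p ∈ A ++ (z', w', t') :: r, 0 < (p.1 / p.2.1).re)
    (hζ : 0 < (ζ / ω).re) (hray : SameRay ℝ w' ω)
    (hsep : (A ++ (ζ, ω, t' + h) :: (z', w', t') :: r).IsChain SeparatedPhases)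
    (hsep' : (A ++ (ζ, ω, t' - h) :: (z', w', t') :: r).IsChain SeparatedPhases)
    (hsepu : (A ++ (z' + ζ, w' + ω, t') :: r).IsChain SeparatedPhases)
    (hprev : ∀ p ∈ A.getLast?, SameRay ℝ p.2.1 ω → p.2.2 < t' - h) :
    listPhaseLimit (A ++ (ζ, ω, t' + h) :: (z', w', t') :: r) =
      listPhaseLimit (A ++ (ζ, ω, t' - h) :: (z', w', t') :: r) +
      listPhaseLimit (A ++ (z' + ζ, w' + ω, t') :: r) := by
  obtain ⟨m, g, hg⟩ : ∃ (m : ℕ) (g : Fin (m + 1) → ℂ × ℂ × ℝ),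
      A ++ (z', w', t') :: r = List.ofFn g := by
    obtain ⟨n, g, hg⟩ := exists_eq_ofFn (A ++ (z', w', t') :: r)
    cases n with
    | zero => simp at hg
    | succ m => exact ⟨m, g, hg⟩
  have hlen : A.length + r.length + 1 = m + 1 := by
    have := congrArg List.length hg
    simp only [List.length_append, List.length_cons, List.length_ofFn] at this
    omega
  have hk : A.length < m + 1 := by omega
  set k : Fin (m + 1) := ⟨A.length, hk⟩ with hkdef
  have hgk : g k = (z', w', t') := by
    have h1 : (List.ofFn g)[A.length]'(by simpa using hk) = g k := by
      rw [List.getElem_ofFn]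
    rw [← h1]
    simp only [← hg]
    simp
  have hins : ∀ x, A ++ x :: (z', w', t') :: r =
      List.ofFn (Fin.insertNth (α := fun _ => ℂ × ℂ × ℝ) k.castSucc x g) := fun x =>
    append_cons_eq_ofFn_insertNth x _ A g (by omega) hg
  have hupd := append_cons_eq_ofFn_update (y := (z' + ζ, w' + ω, t')) hk hg
  rw [← hkdef] at hupd
  have hproj : ∀ {β : Type} (f : ℂ × ℂ × ℝ → β) (x : ℂ × ℂ × ℝ),
      (fun i => f (Fin.insertNth (α := fun _ => ℂ × ℂ × ℝ) k.castSucc x g i)) =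
        Fin.insertNth (α := fun _ => β) k.castSucc (f x) fun i => f (g i) := by
    intro β f x
    symm
    rw [Fin.insertNth_eq_iff]
    constructor
    · simp
    · ext j
      simp [Fin.removeNth]
  have hproju : ∀ {β : Type} (f : ℂ × ℂ × ℝ → β),
      (fun i => f (Function.update g k (z' + ζ, w' + ω, t') i)) =
        Function.update (fun i => f (g i)) k (f (z' + ζ, w' + ω, t')) := by
    intro β f
    exact Function.comp_update f g k _
  rw [hins] at hsep hsep' ⊢
  rw [hins (ζ, ω, t' - h)]
  rw [hupd] at hsepu ⊢
  rw [hg] at hre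
  rw [List.isChain_ofFn] at hsep hsep' hsepu
  rw [listPhaseLimit_ofFn, listPhaseLimit_ofFn, listPhaseLimit_ofFn]
  rw [hproj (fun p => p.1), hproj (fun p => p.2.1), hproj (fun p => p.2.2), hproj (fun p => p.1),
    hproj (fun p => p.2.1), hproj (fun p => p.2.2), hproju (fun p => p.1),
    hproju (fun p => p.2.1), hproju (fun p => p.2.2)]
  have s1 : Separates
      (fun i => (Fin.insertNth (α := fun _ => ℂ × ℂ × ℝ) k.castSucc (ζ, ω, t' + h) g i).2.1)
      (fun i => (Fin.insertNth (α := fun _ => ℂ × ℂ × ℝ) k.castSucc (ζ, ω, t' + h) g i).2.2) :=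
    hsep
  have s2 : Separates
      (fun i => (Fin.insertNth (α := fun _ => ℂ × ℂ × ℝ) k.castSucc (ζ, ω, t' - h) g i).2.1)
      (fun i => (Fin.insertNth (α := fun _ => ℂ × ℂ × ℝ) k.castSucc (ζ, ω, t' - h) g i).2.2) :=
    hsep'
  have s3 : Separates (fun i => (Function.update g k (z' + ζ, w' + ω, t') i).2.1)
      (fun i => (Function.update g k (z' + ζ, w' + ω, t') i).2.2) := hsepu
  rw [hproj (fun p => p.2.1), hproj (fun p => p.2.2)] at s1 s2
  rw [hproju (fun p => p.2.1), hproju (fun p => p.2.2)] at s3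
  have e1 : (g k).1 = z' := by rw [hgk]
  have e2 : (g k).2.1 = w' := by rw [hgk]
  have e3 : (g k).2.2 = t' := by rw [hgk]
  have hupd3 : Function.update (fun i => (g i).2.2) k t' = fun i => (g i).2.2 := by
    rw [← e3]; exact Function.update_eq_self k _
  have := phaseLimit_insertNth k (ζ := ζ) (ω := ω) (z := fun i => (g i).1) (w := fun i => (g i).2.1)
    (t := fun i => (g i).2.2) hh (fun i => hre _ ((List.mem_ofFn' _ _).mpr ⟨i, rfl⟩)) hζ
    (by simpa only [e2] using hray) (by simpa only [e3] using s1) (by simpa only [e3] using s2)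
    (by simpa only [e2, hupd3] using s3) (fun h0 => ?_)
  · simpa only [e1, e2, e3, hupd3] using this
  · have hA : A.length - 1 < (List.ofFn g).length := by rw [List.length_ofFn]; omega
    have hlast : g ⟨k - 1, by omega⟩ ∈ A.getLast? := by
      have h1 : (List.ofFn g)[A.length - 1]'hA = g ⟨k - 1, by omega⟩ := by
        rw [List.getElem_ofFn]
      have h2 : 0 < A.length := h0
      rw [← h1, List.getLast?_eq_getElem?, Option.mem_def]
      simp only [← hg]
      rw [List.getElem_append_left (by omega), List.getElem?_eq_getElem]
    simp only [e3]
    exact hprev _ hlast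

end WallCrossingFormula

/-! ### Expanding any order of the phases in ascending ones -/

section PhaseExpansion
open Set Filter Topology

theorem sameRay_add_left_iff {a b v : ℂ} (ha : a ≠ 0) (hb : b ≠ 0) (h : SameRay ℝ a b) :
    SameRay ℝ (a + b) v ↔ SameRay ℝ a v := by
  obtain ⟨r, hr, rfl⟩ := h.exists_pos_left ha hb
  have e : a + r • a = (1 + r) • a := by rw [add_smul, one_smul]
  have hr1 : 0 < 1 + r := by positivity
  rw [e]
  refine ⟨fun hv => ?_, fun hv => hv.pos_smul_left hr1⟩
  have := hv.pos_smul_left (inv_pos.mpr hr1)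
  rwa [inv_smul_smul₀ hr1.ne'] at this

open Classical in
/-- Whether the entries of a list lie on a common ray and have decreasing phases. -/
noncomputable def descWeight : List (ℂ × ℂ × ℝ) → ℂ
  | [] => 1
  | [_] => 1
  | x :: y :: l => if SameRay ℝ x.2.1 y.2.1 ∧ y.2.2 < x.2.2 then descWeight (y :: l) else 0

/-- Forgetting the phase. -/
def forgetPhase (p : ℂ × ℂ × ℝ) : ℂ × ℂ := (p.1, p.2.1)

/-- The phase limit of a list of pairs `(z, w)` for increasing phases. -/
noncomputable def ascendingLimit (l : List (ℂ × ℂ)) : ℂ :=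
  phaseLimit (fun i => (l.get i).1) (fun i => (l.get i).2) fun i => (i : ℝ)

theorem ascendingLimit_ofFn {n : ℕ} (g : Fin n → ℂ × ℂ) :
    ascendingLimit (List.ofFn g) =
      phaseLimit (fun i => (g i).1) (fun i => (g i).2) fun i => (i : ℝ) :=
  apply_get_ofFn (fun n (p : Fin n → ℂ × ℂ) =>
    phaseLimit (fun i => (p i).1) (fun i => (p i).2) fun i => (i : ℝ)) g

theorem listPhaseLimit_eq_ascendingLimit {L : List (ℂ × ℂ × ℝ)}
    (hre : ∀ p ∈ L, 0 < (p.1 / p.2.1).re) (h : L.IsChain AscendingPhases) :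
    listPhaseLimit L = ascendingLimit (L.map forgetPhase) := by
  obtain ⟨n, g, rfl⟩ := exists_eq_ofFn L
  rw [List.map_ofFn, listPhaseLimit_ofFn, ascendingLimit_ofFn]
  rw [List.isChain_ofFn] at h
  refine phaseLimit_congr (fun i => hre _ ((List.mem_ofFn' _ _).mpr ⟨i, rfl⟩))
    fun k hk hray => mul_pos (sub_pos.mpr (h k hk hray)) ?_
  simp

/-- The merged entry has the ray and the phase of `y`, hence the same comparison with what follows.
-/
theorem descWeight_add_cons {x y : ℂ × ℂ × ℝ} (hx : x.2.1 ≠ 0) (hy : y.2.1 ≠ 0)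
    (h : SameRay ℝ y.2.1 x.2.1) (l : List (ℂ × ℂ × ℝ)) :
    descWeight ((y.1 + x.1, y.2.1 + x.2.1, y.2.2) :: l) = descWeight (y :: l) := by
  cases l with
  | nil => rfl
  | cons q l =>
    have := sameRay_add_left_iff (v := q.2.1) hy hx h
    simp only [descWeight]
    by_cases hq : SameRay ℝ y.2.1 q.2.1 <;> simp [hq, this]

theorem isChain_separatedPhases_append {A B : List (ℂ × ℂ × ℝ)} (hA : A.IsChain AscendingPhases)
    (hB : B.IsChain SeparatedPhases)
    (hAB : ∀ a ∈ A.getLast?, ∀ b ∈ B.head?, AscendingPhases a b) :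
    (A ++ B).IsChain SeparatedPhases :=
  List.isChain_append.mpr ⟨hA.imp fun _ _ h hray => (h hray).ne, hB,
    fun a ha b hb hray => (hAB a ha b hb hray).ne⟩

/-- The prefix `A` is already ascending. If `x` and its successor form a descent on one ray, `x` is
flipped below the successor at the price of a residue merging the two; otherwise `x` is moved into
the prefix. Both operations shorten the remaining list. -/
theorem listPhaseLimit_append_cons : ∀ (r : List (ℂ × ℂ × ℝ)) (x : ℂ × ℂ × ℝ)
    (A : List (ℂ × ℂ × ℝ)), (∀ p ∈ A ++ x :: r, 0 < (p.1 / p.2.1).re) →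
    (A ++ [x]).IsChain AscendingPhases → (x :: r).IsChain SeparatedPhases →
    listPhaseLimit (A ++ x :: r) = ((headSegmentations r).map fun p =>
      ascendingLimit (A.map forgetPhase ++ ((x :: p.1).map forgetPhase).sum ::
        p.2.map fun s => (s.map forgetPhase).sum) *
      (descWeight (x :: p.1) * (p.2.map descWeight).prod)).sum := by
  intro r
  induction r with
  | nil =>
    intro x A hre hasc _
    rw [listPhaseLimit_eq_ascendingLimit hre hasc]
    simp [headSegmentations, descWeight]
  | cons y r ih =>
    intro x A hre hasc hsep
    rw [sum_headSegmentations_cons, List.sum_map_add]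
    obtain ⟨hA, -, hAx⟩ := List.isChain_append.mp hasc
    have hAx' : ∀ a ∈ A.getLast?, AscendingPhases a x := fun a ha => hAx a ha x (by simp)
    obtain ⟨hxy, hyr⟩ := List.isChain_cons_cons.mp hsep
    have hrex : 0 < (x.1 / x.2.1).re := hre x (by simp)
    have hrey : 0 < (y.1 / y.2.1).re := hre y (by simp)
    by_cases hd : SameRay ℝ x.2.1 y.2.1 ∧ y.2.2 < x.2.2
    · obtain ⟨hray, hlt⟩ := hd
      obtain ⟨ζ, ω, τ⟩ := x
      obtain ⟨z', w', t'⟩ := y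
      simp only at hray hlt hrex hrey
      have hω := (ne_zero_of_div_re_pos hrex).2
      have hw' := (ne_zero_of_div_re_pos hrey).2
      obtain ⟨h, hh, rfl⟩ : ∃ h : ℝ, 0 < h ∧ τ = t' + h := ⟨τ - t', by linarith, by ring⟩
      -- Lowering the whole prefix by 2h keeps its internal order. If its last entry shares the ray
      -- of `x`, its phase stays below t' - h, where `x` is about to go.
      set A' : List (ℂ × ℂ × ℝ) := A.map fun p => (p.1, p.2.1, p.2.2 - 2 * h) with hA'def
      have hA' : A'.IsChain AscendingPhases := by
        rw [hA'def, List.isChain_map]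
        exact hA.imp fun a b hab hr => sub_lt_sub_right (hab hr) _
      have hlast : ∀ a ∈ A'.getLast?, SameRay ℝ a.2.1 ω → a.2.2 < t' - h := by
        intro a ha hr
        rw [hA'def, List.getLast?_map, Option.mem_def, Option.map_eq_some_iff] at ha
        obtain ⟨a₀, ha₀, rfl⟩ := ha
        have := hAx' a₀ ha₀ hr
        simp only at this ⊢
        linarith
      have hreA' : ∀ p ∈ A', 0 < (p.1 / p.2.1).re := by
        intro p hp
        obtain ⟨q, hq, rfl⟩ := List.mem_map.mp hp
        exact hre q (by simp [hq])
      have hrer : ∀ p ∈ r, 0 < (p.1 / p.2.1).re := fun p hp => hre p (by simp [hp])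
      have hmap : A'.map forgetPhase = A.map forgetPhase := by
        rw [hA'def, List.map_map]; rfl
      -- The lowering changes no comparison between consecutive entries of a common ray.
      have hcongr : listPhaseLimit (A ++ (ζ, ω, t' + h) :: (z', w', t') :: r) =
          listPhaseLimit (A' ++ (ζ, ω, t' + h) :: (z', w', t') :: r) := by
        have := listPhaseLimit_congr (A.map (fun p => (p.1, p.2.1, p.2.2, p.2.2 - 2 * h)) ++
          ((ζ, ω, t' + h) :: (z', w', t') :: r).map fun p => (p.1, p.2.1, p.2.2, p.2.2))
          (fun p hp => by
            rw [List.mem_append] at hp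
            rcases hp with hp | hp <;> obtain ⟨q, hq, rfl⟩ := List.mem_map.mp hp
            · exact hre q (List.mem_append_left _ hq)
            · exact hre q (List.mem_append_right _ hq))
          (List.isChain_append.mpr ⟨by
            rw [List.isChain_map]
            exact hA.imp fun a b hab hr => mul_pos (sub_pos.mpr (hab hr))
              (sub_pos.mpr (sub_lt_sub_right (hab hr) _)), by
            rw [List.isChain_map]
            exact hsep.imp fun a b hab hr =>
              mul_self_pos.mpr (sub_ne_zero.mpr (hab hr).symm), by
            intro a ha b hb hr
            rw [List.getLast?_map, Option.mem_def, Option.map_eq_some_iff] at ha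
            obtain ⟨a₀, ha₀, rfl⟩ := ha
            simp only [List.map_cons, List.head?_cons, Option.mem_def, Option.some.injEq] at hb
            subst hb
            have := hAx' a₀ ha₀ hr
            simp only at this ⊢
            exact mul_pos (by linarith) (by linarith)⟩)
        simpa [List.map_append, List.map_map, Function.comp_def] using this
      have hyr' : ((z' + ζ, w' + ω, t') :: r).IsChain SeparatedPhases := by
        cases r with
        | nil => simp
        | cons q r =>
          obtain ⟨h1, h2⟩ := List.isChain_cons_cons.mp hyr
          refine List.isChain_cons_cons.mpr ⟨fun hr => h1 ?_, h2⟩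
          exact (sameRay_add_left_iff hw' hω hray.symm).mp hr
      have hasc1 : ∀ a ∈ A'.getLast?, AscendingPhases a (ζ, ω, t' - h) := fun a ha hr =>
        hlast a ha hr
      have hasc2 : ∀ a ∈ A'.getLast?, AscendingPhases a (z' + ζ, w' + ω, t') := by
        intro a ha hr
        have h1 : SameRay ℝ (ω + w') a.2.1 := by rw [add_comm]; exact hr.symm
        have := hlast a ha ((sameRay_add_left_iff hω hw' hray).mp h1).symm
        simp only
        linarith
      have hasc3 : AscendingPhases (ζ, ω, t' - h) (z', w', t') := fun _ => by
        simp only; linarith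
      have hflip := listPhaseLimit_append_cons_cons (A := A') (r := r) (ζ := ζ) (ω := ω) (z' := z')
        (w' := w') (t' := t') hh (fun p hp => by
          simp only [List.mem_append, List.mem_cons] at hp
          rcases hp with hp | rfl | hp
          exacts [hreA' p hp, hrey, hrer p hp]) hrex hray.symm
        (isChain_separatedPhases_append hA' hsep fun a ha b hb hr => by
          simp only [List.head?_cons, Option.mem_def, Option.some.injEq] at hb
          subst hb
          have := hlast a ha hr
          simp only
          linarith)
        (isChain_separatedPhases_append hA'
          (List.isChain_cons_cons.mpr ⟨fun hr => (hasc3 hr).ne, hyr⟩) fun a ha b hb => by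
          simp only [List.head?_cons, Option.mem_def, Option.some.injEq] at hb
          exact hb ▸ hasc1 a ha)
        (isChain_separatedPhases_append hA' hyr' fun a ha b hb => by
          simp only [List.head?_cons, Option.mem_def, Option.some.injEq] at hb
          exact hb ▸ hasc2 a ha)
        hlast
      have ih1 := ih (z', w', t') (A' ++ [(ζ, ω, t' - h)]) (fun p hp => by
          simp only [List.mem_append, List.mem_cons, List.not_mem_nil, or_false] at hp
          rcases hp with (hp | rfl) | rfl | hp
          exacts [hreA' p hp, hrex, hrey, hrer p hp])
        (List.isChain_append.mpr ⟨List.isChain_append.mpr ⟨hA', by simp, fun a ha b hb => by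
          simp only [List.head?_cons, Option.mem_def, Option.some.injEq] at hb
          exact hb ▸ hasc1 a ha⟩, by simp, fun a ha b hb => by
          simp only [List.getLast?_append, List.getLast?_singleton, Option.some_or,
            List.head?_cons, Option.mem_def, Option.some.injEq] at ha hb
          rw [← ha, ← hb]
          exact hasc3⟩) hyr
      have ih2 := ih (z' + ζ, w' + ω, t') A' (fun p hp => by
          simp only [List.mem_append, List.mem_cons] at hp
          rcases hp with hp | rfl | hp
          exacts [hreA' p hp, re_add_div_add_pos hrey hrex hray.symm, hrer p hp])
        (List.isChain_append.mpr ⟨hA', by simp, fun a ha b hb => by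
          simp only [List.head?_cons, Option.mem_def, Option.some.injEq] at hb
          exact hb ▸ hasc2 a ha⟩) hyr'
      -- The flipped term yields the cuttings in which `x` is a block by itself, and the residue
      -- term those in which `x` shares a block with its successor.
      rw [hcongr, hflip, ih2]
      rw [List.append_assoc, List.singleton_append] at ih1
      rw [ih1, hmap]
      congr 2
      · refine List.map_congr_left fun p _ => ?_
        simp [hmap, forgetPhase, descWeight]
      · refine List.map_congr_left fun p _ => ?_
        rw [descWeight_add_cons (x := (ζ, ω, t' + h)) (y := (z', w', t')) hω hw' hray.symm]
        simp only [List.map_cons, List.sum_cons, forgetPhase, descWeight, hray, hlt, and_self,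
          if_true, ← add_assoc, Prod.mk_add_mk, add_comm z' ζ, add_comm w' ω]
    -- No descent: cuttings that join `x` to its successor have weight zero, and `x` extends the
    -- ascending prefix.
    · have hasc' : AscendingPhases x y := fun hr =>
        lt_of_le_of_ne (not_lt.mp fun hlt => hd ⟨hr, hlt⟩) (hxy hr)
      have h2 : ∀ p ∈ headSegmentations r, ascendingLimit (A.map forgetPhase ++
          ((x :: y :: p.1).map forgetPhase).sum :: p.2.map fun s => (s.map forgetPhase).sum) *
          (descWeight (x :: y :: p.1) * (p.2.map descWeight).prod) = 0 := by
        intro p _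
        simp [descWeight, hd]
      rw [List.map_congr_left h2]
      have ih1 := ih y (A ++ [x]) (by simpa using hre)
        (List.isChain_append.mpr ⟨hasc, by simp, fun a ha b hb => by
          simp only [List.getLast?_append, List.getLast?_singleton, Option.some_or,
            List.head?_cons, Option.mem_def, Option.some.injEq] at ha hb
          rw [← ha, ← hb]
          exact hasc'⟩) hyr
      rw [List.append_assoc, List.singleton_append] at ih1
      rw [ih1]
      simp only [List.map_const', List.sum_replicate, smul_zero, add_zero]
      congr 1
      refine List.map_congr_left fun p _ => ?_
      simp [descWeight]

/-- A phase limit in terms of the phase limits for increasing phases. -/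
theorem listPhaseLimit_eq_sum {L : List (ℂ × ℂ × ℝ)} (hL : L ≠ [])
    (hre : ∀ p ∈ L, 0 < (p.1 / p.2.1).re) (hsep : L.IsChain SeparatedPhases) :
    listPhaseLimit L = ((segmentations L).map fun S =>
      ascendingLimit (S.map fun s => (s.map forgetPhase).sum) * (S.map descWeight).prod).sum := by
  obtain ⟨x, r, rfl⟩ := List.exists_cons_of_ne_nil hL
  have := listPhaseLimit_append_cons r x [] hre (by simp) hsep
  rw [sum_segmentations_cons]
  simpa using this

end PhaseExpansion

/-! ### Moulds supported on collinear lists -/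

section RayMoulds
open Set Filter Topology

/-- The second entries of a list of pairs all have the same argument. -/
def CollinearSnd (l : List (ℂ × ℂ)) : Prop := ∀ p ∈ l, ∀ q ∈ l, Complex.arg p.2 = Complex.arg q.2

theorem arg_add_of_arg_eq {x y : ℂ} (h : Complex.arg x = Complex.arg y) :
    Complex.arg (x + y) = Complex.arg x := by
  rcases eq_or_ne x 0 with rfl | hx
  · rw [zero_add, h]
  rcases eq_or_ne y 0 with rfl | hy
  · rw [add_zero]
  obtain ⟨r, hr, rfl⟩ := (Complex.sameRay_of_arg_eq h).exists_pos_left hx hy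
  have e : x + r • x = ((1 + r : ℝ) : ℂ) * x := by
    rw [Complex.real_smul]; push_cast; ring
  rw [e, Complex.arg_real_mul _ (by positivity)]

theorem arg_sum_snd_eq {θ : ℝ} : ∀ {l : List (ℂ × ℂ)}, l ≠ [] →
    (∀ p ∈ l, Complex.arg p.2 = θ) → Complex.arg l.sum.2 = θ
  | [], h, _ => absurd rfl h
  | [x], _, h => by simpa using h x (by simp)
  | x :: y :: l, _, h => by
    have ih := arg_sum_snd_eq (l := y :: l) (by simp) fun p hp => h p (List.mem_cons_of_mem _ hp)
    have hx := h x (by simp)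
    rw [List.sum_cons, Prod.snd_add, arg_add_of_arg_eq (hx.trans ih.symm), hx]

theorem arg_sum_snd_of_mem {l : List (ℂ × ℂ)} (h : CollinearSnd l) {p : ℂ × ℂ} (hp : p ∈ l) :
    Complex.arg l.sum.2 = Complex.arg p.2 :=
  arg_sum_snd_eq (List.ne_nil_of_mem hp) fun q hq => h q hq p hp

/-- The sum of a collinear block has the argument of its members. Hence moulds supported on
collinear lists are closed under composition. -/
theorem collinear_flatten_iff {S : List (List (ℂ × ℂ))} (hS : [] ∉ S) :
    CollinearSnd S.flatten ↔ CollinearSnd (S.map List.sum) ∧ ∀ s ∈ S, CollinearSnd s := by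
  constructor
  · intro h
    have h2 : ∀ s ∈ S, CollinearSnd s := fun s hs p hp q hq =>
      h p (List.mem_flatten_of_mem hs hp) q (List.mem_flatten_of_mem hs hq)
    refine ⟨?_, h2⟩
    intro a ha b hb
    obtain ⟨s, hs, rfl⟩ := List.mem_map.mp ha
    obtain ⟨s', hs', rfl⟩ := List.mem_map.mp hb
    obtain ⟨p, hp⟩ := List.exists_mem_of_ne_nil s fun h0 => hS (h0 ▸ hs)
    obtain ⟨q, hq⟩ := List.exists_mem_of_ne_nil s' fun h0 => hS (h0 ▸ hs')
    rw [arg_sum_snd_of_mem (h2 s hs) hp, arg_sum_snd_of_mem (h2 s' hs') hq]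
    exact h p (List.mem_flatten_of_mem hs hp) q (List.mem_flatten_of_mem hs' hq)
  · rintro ⟨h1, h2⟩ p hp q hq
    obtain ⟨s, hs, hp⟩ := List.mem_flatten.mp hp
    obtain ⟨s', hs', hq⟩ := List.mem_flatten.mp hq
    rw [← arg_sum_snd_of_mem (h2 s hs) hp, ← arg_sum_snd_of_mem (h2 s' hs') hq]
    exact h1 _ (List.mem_map_of_mem hs) _ (List.mem_map_of_mem hs')

theorem mouldComp_eq_zero_of_not_collinear {M E : List (ℂ × ℂ) → ℂ}
    (hM : ∀ l, ¬ CollinearSnd l → M l = 0) (hE : ∀ l, ¬ CollinearSnd l → E l = 0)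
    {l : List (ℂ × ℂ)} (hl : ¬ CollinearSnd l) : mouldComp M E l = 0 := by
  rw [mouldComp]
  refine List.sum_eq_zero fun a ha => ?_
  obtain ⟨S, hS, rfl⟩ := List.mem_map.mp ha
  obtain ⟨rfl, h0⟩ := flatten_of_mem_segmentations hS
  rw [collinear_flatten_iff h0, not_and_or] at hl
  rcases hl with hl | hl
  · rw [hM _ hl, zero_mul]
  · push Not at hl
    obtain ⟨s, hs, hs'⟩ := hl
    rw [List.prod_eq_zero (List.mem_map.mpr ⟨s, hs, hE s hs'⟩), mul_zero]

open Classical in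
/-- The coefficients of the exponential, on collinear lists. -/
noncomputable def expMould (l : List (ℂ × ℂ)) : ℂ :=
  if CollinearSnd l then (l.length.factorial : ℂ)⁻¹ else 0

open Classical in
/-- The coefficients of the logarithm, on collinear lists. -/
noncomputable def logMould (l : List (ℂ × ℂ)) : ℂ :=
  if CollinearSnd l then -(-1 : ℂ) ^ l.length / l.length else 0

/-- On a collinear list all blocks and the list of block sums are collinear, so only lengths matter
and `sum_composition_exp_log` applies. A non-collinear list gives zero, and has more than one entry.
-/
theorem mouldComp_expMould_logMould {l : List (ℂ × ℂ)} (hl : l ≠ []) :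
    mouldComp expMould logMould l = if l.length = 1 then 1 else 0 := by
  by_cases hc : CollinearSnd l
  · have h1 : mouldComp expMould logMould l = ((segmentations l).map fun S =>
        (S.length.factorial : ℂ)⁻¹ *
          ((S.map List.length).map fun k : ℕ => -(-1 : ℂ) ^ k / k).prod).sum := by
      rw [mouldComp]
      congr 1
      refine List.map_congr_left fun S hS => ?_
      obtain ⟨rfl, h0⟩ := flatten_of_mem_segmentations hS
      rw [collinear_flatten_iff h0] at hc
      rw [expMould, if_pos hc.1, List.length_map, List.map_map]
      congr 2
      refine List.map_congr_left fun s hs => ?_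
      rw [logMould, if_pos (hc.2 s hs)]
      rfl
    rw [h1, sum_segmentations_eq_sum_composition rfl]
    have h2 := sum_composition_exp_log l.length
    have hlen := List.length_pos_of_ne_nil hl
    have h3 : (if l.length = 1 then (1 : ℂ) else 0) = if l.length ≤ 1 then 1 else 0 := by
      split_ifs <;> first | rfl | omega
    rw [h3, ← h2]
    refine Finset.sum_congr rfl fun c _ => ?_
    rw [List.length_splitWrtComposition, List.map_length_splitWrtComposition,
      ← c.ofFn_blocksFun, List.map_ofFn, List.prod_ofFn]
    rfl
  · rw [mouldComp_eq_zero_of_not_collinear (M := expMould) (E := logMould) (fun l h => if_neg h) (fun l h => if_neg h) hc, if_neg]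
    intro h
    apply hc
    obtain ⟨x, rfl⟩ := List.length_eq_one_iff.mp h
    intro p hp q hq
    simp only [List.mem_singleton] at hp hq
    rw [hp, hq]

theorem mouldComp_expMould_logMould_cancel (M : List (ℂ × ℂ) → ℂ) :
    mouldComp (mouldComp M expMould) logMould = M := by
  ext l
  rw [mouldComp_assoc, ← mouldComp_unit M l]
  refine mouldComp_congr fun S hS => ?_
  congr 2
  refine List.map_congr_left fun s hs => mouldComp_expMould_logMould fun h => ?_
  exact (flatten_of_mem_segmentations hS).2 (h ▸ hs)

/-- Sums of pairs `(z, w)` with `w` on a fixed ray and `z / w` in a convex cone. -/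
theorem sum_div_mem_of_sameRay {Q : ℂ → Prop} (hadd : ∀ x y, Q x → Q y → Q (x + y))
    (hmul : ∀ (r : ℝ) (x : ℂ), 0 < r → Q x → Q (r * x)) {v : ℂ} (hv : v ≠ 0) :
    ∀ {l : List (ℂ × ℂ)}, l ≠ [] → (∀ p ∈ l, p.2 ≠ 0 ∧ SameRay ℝ v p.2 ∧ Q (p.1 / p.2)) →
      l.sum.2 ≠ 0 ∧ SameRay ℝ v l.sum.2 ∧ Q (l.sum.1 / l.sum.2)
  | [], h, _ => absurd rfl h
  | [x], _, h => by simpa using h x (by simp)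
  | x :: y :: l, _, h => by
    obtain ⟨h1, h2, h3⟩ := sum_div_mem_of_sameRay hadd hmul hv (l := y :: l) (by simp)
      fun p hp => h p (List.mem_cons_of_mem _ hp)
    obtain ⟨k1, k2, k3⟩ := h x (by simp)
    rw [List.sum_cons, Prod.fst_add, Prod.snd_add]
    generalize (y :: l).sum = q at h1 h2 h3
    obtain ⟨r, hr, hr'⟩ := h2.exists_pos_left hv h1
    obtain ⟨s, hs, hs'⟩ := k2.exists_pos_left hv k1
    have e : x.2 + q.2 = ((s + r : ℝ) : ℂ) * v := by
      rw [← hr', ← hs', Complex.real_smul, Complex.real_smul]; push_cast; ring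
    have hsr : (s + r : ℂ) ≠ 0 := by exact_mod_cast (by positivity : s + r ≠ 0)
    have hs0 : (s : ℂ) ≠ 0 := by exact_mod_cast hs.ne'
    have hr0 : (r : ℂ) ≠ 0 := by exact_mod_cast hr.ne'
    refine ⟨?_, k2.add_right h2, ?_⟩
    · rw [e]
      push_cast
      exact mul_ne_zero hsr hv
    · have e2 : (x.1 + q.1) / (x.2 + q.2) = ((s / (s + r) : ℝ) : ℂ) * (x.1 / x.2) +
          ((r / (s + r) : ℝ) : ℂ) * (q.1 / q.2) := by
        rw [e, ← hr', ← hs', Complex.real_smul, Complex.real_smul]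
        push_cast
        field_simp
      rw [e2]
      exact hadd _ _ (hmul _ _ (by positivity) k3) (hmul _ _ (by positivity) h3)

theorem sameRay_iff_arg_eq {x y : ℂ} (hx : x ≠ 0) (hy : y ≠ 0) :
    SameRay ℝ x y ↔ Complex.arg x = Complex.arg y := by
  simp [Complex.sameRay_iff, hx, hy]

open Classical in
theorem descWeight_eq (L : List (ℂ × ℂ × ℝ)) :
    descWeight L = if L.IsChain (fun p q => SameRay ℝ p.2.1 q.2.1 ∧ q.2.2 < p.2.2) then 1 else 0 := by
  induction L with
  | nil => simp [descWeight]
  | cons x l ih =>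
    cases l with
    | nil => simp [descWeight]
    | cons y l =>
      simp only [descWeight, List.isChain_cons_cons]
      by_cases h : SameRay ℝ x.2.1 y.2.1 ∧ y.2.2 < x.2.2
      · rw [if_pos h, ih]
        simp [h]
      · rw [if_neg h, if_neg fun h' => h h'.1]

/-- `w`-collinear pairs with decreasing argument of `z / w`. -/
def DecreasingArg (p q : ℂ × ℂ) : Prop :=
  Complex.arg p.2 = Complex.arg q.2 ∧ Complex.arg (q.1 / q.2) < Complex.arg (p.1 / p.2)

instance : IsTrans (ℂ × ℂ) DecreasingArg :=
  ⟨fun _ _ _ h1 h2 => ⟨h1.1.trans h2.1, h2.2.trans h1.2⟩⟩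

open Classical in
/-- The indicator function of the lists with decreasing arguments of `z / w`. -/
noncomputable def descMould (l : List (ℂ × ℂ)) : ℂ := if l.IsChain DecreasingArg then 1 else 0

open Classical in
/-- The coefficients of the exponential on lists with constant arguments of `w` and `z / w`. -/
noncomputable def equalMould (l : List (ℂ × ℂ)) : ℂ :=
  if CollinearSnd l ∧ ∀ p ∈ l, ∀ q ∈ l, Complex.arg (p.1 / p.2) = Complex.arg (q.1 / q.2) then
    (l.length.factorial : ℂ)⁻¹ else 0

theorem collinear_of_isChain {R : ℂ × ℂ → ℂ × ℂ → Prop}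
    (hR : ∀ p q, R p q → Complex.arg p.2 = Complex.arg q.2) {l : List (ℂ × ℂ)}
    (h : l.IsChain R) : CollinearSnd l := by
  have h1 : l.IsChain fun p q => Complex.arg p.2 = Complex.arg q.2 := h.imp fun p q => hR p q
  have : IsTrans (ℂ × ℂ) fun p q => Complex.arg p.2 = Complex.arg q.2 :=
    ⟨fun _ _ _ => Eq.trans⟩
  have h2 := h1.pairwise
  rw [List.pairwise_iff_getElem] at h2
  intro p hp q hq
  obtain ⟨i, hi, rfl⟩ := List.getElem_of_mem hp
  obtain ⟨j, hj, rfl⟩ := List.getElem_of_mem hq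
  rcases lt_trichotomy i j with hij | rfl | hij
  · exact h2 i j hi hj hij
  · rfl
  · exact (h2 j i hj hi hij).symm

theorem infix_of_mem_of_flatten_eq {α : Type*} {S : List (List α)} {s : List α} (hs : s ∈ S) :
    s <:+: S.flatten := by
  obtain ⟨A, B, rfl⟩ := List.append_of_mem hs
  exact ⟨A.flatten, B.flatten, by simp⟩

/-- Changing the base point of the phase limits with increasing phases. -/
theorem ascendingLimit_self_eq {n : ℕ} (hn : 1 ≤ n) {z w : Fin n → ℂ} {δ : ℝ}
    (hδ : IsPhaseRadius w δ) (hre : ∀ i, 0 < (z i / w i).re)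
    (harg : ∀ i, |Complex.arg (z i / w i)| < δ) :
    ascendingLimit (List.ofFn fun i => (z i, z i)) =
      mouldComp ascendingLimit descMould (List.ofFn fun i => (z i, w i)) := by
  have hw : ∀ i, w i ≠ 0 := fun i => (ne_zero_of_div_re_pos (hre i)).2
  have h1 := eventually_phaseLimit_self_eq (t := fun i => (i : ℝ)) hδ hre harg (by simp)
  -- A small ascending perturbation preserves strict inequalities and turns ties into ascents, so
  -- descents of the phases are exactly strict descents of arg(z/w).
  have h2 : ∀ᶠ η in 𝓝[>] (0 : ℝ), ∀ k : Fin n, ∀ hk : (k : ℕ) + 1 < n,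
      (Complex.arg (z k / w k) + η * (k : ℕ) ≠
        Complex.arg (z ⟨k + 1, hk⟩ / w ⟨k + 1, hk⟩) + η * ((k : ℕ) + 1 : ℕ)) ∧
      (Complex.arg (z ⟨k + 1, hk⟩ / w ⟨k + 1, hk⟩) + η * ((k : ℕ) + 1 : ℕ) <
        Complex.arg (z k / w k) + η * (k : ℕ) ↔
      Complex.arg (z ⟨k + 1, hk⟩ / w ⟨k + 1, hk⟩) < Complex.arg (z k / w k)) := by
    refine eventually_all.mpr fun k => ?_
    by_cases hk : (k : ℕ) + 1 < n
    · by_cases hlt : Complex.arg (z ⟨k + 1, hk⟩ / w ⟨k + 1, hk⟩) < Complex.arg (z k / w k)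
      · filter_upwards [Ioo_mem_nhdsGT (sub_pos.mpr hlt)] with η hη _
        have := hη.2
        push_cast
        refine ⟨fun h => by linarith, fun _ => hlt, fun _ => by linarith⟩
      · filter_upwards [self_mem_nhdsWithin] with η (hη : 0 < η) _
        push_cast
        rw [not_lt] at hlt
        refine ⟨fun h => by linarith, fun h => by linarith, fun h => by linarith⟩
    · exact Eventually.of_forall fun _ h => absurd h hk
  obtain ⟨η, e1, e2⟩ := (h1.and h2).exists
  set g : Fin n → ℂ × ℂ × ℝ := fun i => (z i, w i, Complex.arg (z i / w i) + η * (i : ℕ)) with hg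
  have hforget : (List.ofFn g).map forgetPhase = List.ofFn fun i => (z i, w i) := by
    rw [List.map_ofFn]; rfl
  have e3 : phaseLimit z w (fun i => Complex.arg (z i / w i) + η * (i : ℕ)) =
      listPhaseLimit (List.ofFn g) := (listPhaseLimit_ofFn g).symm
  rw [ascendingLimit_ofFn, e1, e3, listPhaseLimit_eq_sum
    (by rw [Ne, List.ofFn_eq_nil_iff]; omega)
    (fun p hp => by obtain ⟨i, rfl⟩ := (List.mem_ofFn' _ _).mp hp; exact hre i)
    (List.isChain_ofFn.mpr fun k hk _ => (e2 ⟨k, by omega⟩ hk).1), mouldComp, ← hforget,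
    segmentations_map, List.map_map]
  congr 1
  refine List.map_congr_left fun S hS => ?_
  simp only [Function.comp_apply, List.map_map]
  congr 2
  refine List.map_congr_left fun s hs => ?_
  have hinf : s <:+: List.ofFn g := (flatten_of_mem_segmentations hS).1 ▸
    infix_of_mem_of_flatten_eq hs
  have hiff : (List.ofFn g).IsChain fun p q =>
      ((SameRay ℝ p.2.1 q.2.1 ∧ q.2.2 < p.2.2) ↔ DecreasingArg (forgetPhase p) (forgetPhase q)) :=
    List.isChain_ofFn.mpr fun k hk => by
      simp only [hg, forgetPhase, DecreasingArg, sameRay_iff_arg_eq (hw _) (hw _),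
        (e2 ⟨k, by omega⟩ hk).2]
  have hiff' := hiff.infix hinf
  simp only [Function.comp_apply]
  rw [descWeight_eq, descMould]
  have key : ∀ {R R' : ℂ × ℂ × ℝ → ℂ × ℂ × ℝ → Prop} {s : List (ℂ × ℂ × ℝ)},
      s.IsChain (fun p q => (R p q ↔ R' p q)) → (s.IsChain R ↔ s.IsChain R') := by
    intro R R' s hs
    rw [List.isChain_iff_getElem] at hs ⊢
    rw [List.isChain_iff_getElem]
    exact forall_congr' fun i => forall_congr' fun hi => hs i hi
  have hfin := (key hiff').trans (List.isChain_map (R := DecreasingArg) forgetPhase (l := s)).symm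
  split_ifs with c1 c2 c2
  · rfl
  · exact absurd (hfin.mp c1) c2
  · exact absurd (hfin.mpr c2) c1
  · rfl

end RayMoulds

/-! ### The combinatorial weights as a mould -/

section BlockWeights
open Set Filter Topology

theorem sum_pair {ι : Type*} (s : Finset ι) (f g : ι → ℂ) :
    ∑ j ∈ s, (f j, g j) = (∑ j ∈ s, f j, ∑ j ∈ s, g j) :=
  Prod.ext Prod.fst_sum Prod.snd_sum

theorem collinearSnd_ofFn {n : ℕ} {g : Fin n → ℂ × ℂ} :
    CollinearSnd (List.ofFn g) ↔ ∀ i j, Complex.arg (g i).2 = Complex.arg (g j).2 := by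
  simp only [CollinearSnd, List.mem_ofFn', Set.forall_mem_range]

theorem expMould_ofFn_of_collinear {n : ℕ} {g : Fin n → ℂ × ℂ}
    (h : ∀ i j, Complex.arg (g i).2 = Complex.arg (g j).2) :
    expMould (List.ofFn g) = (n.factorial : ℂ)⁻¹ := by
  rw [expMould, if_pos (collinearSnd_ofFn.mpr h), List.length_ofFn]

theorem equalMould_ofFn_of_pos {n : ℕ} {g : Fin n → ℂ × ℂ}
    (h : ∀ i j, Complex.arg (g i).2 = Complex.arg (g j).2)
    (h' : ∀ i j, Complex.arg ((g i).1 / (g i).2) = Complex.arg ((g j).1 / (g j).2)) :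
    equalMould (List.ofFn g) = (n.factorial : ℂ)⁻¹ := by
  rw [equalMould, if_pos ⟨collinearSnd_ofFn.mpr h, by
    simpa only [List.mem_ofFn', Set.forall_mem_range] using h'⟩, List.length_ofFn]

theorem equalMould_ofFn_of_neg {n : ℕ} {g : Fin n → ℂ × ℂ}
    (h : ¬ ((∀ i j, Complex.arg (g i).2 = Complex.arg (g j).2) ∧
      ∀ i j, Complex.arg ((g i).1 / (g i).2) = Complex.arg ((g j).1 / (g j).2))) :
    equalMould (List.ofFn g) = 0 := by
  rw [equalMould, if_neg]
  rintro ⟨h1, h2⟩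
  exact h ⟨collinearSnd_ofFn.mp h1, by
    simpa only [List.mem_ofFn', Set.forall_mem_range] using h2⟩

theorem isChain_decreasingArg_ofFn {n : ℕ} {g : Fin n → ℂ × ℂ}
    (h : ∀ i j, Complex.arg (g i).2 = Complex.arg (g j).2) :
    (List.ofFn g).IsChain DecreasingArg ↔
      ∀ i j, i < j → Complex.arg ((g j).1 / (g j).2) < Complex.arg ((g i).1 / (g i).2) := by
  rw [List.isChain_iff_pairwise, List.pairwise_ofFn]
  exact forall_congr' fun i => forall_congr' fun j => forall_congr' fun _ =>
    ⟨fun h => h.2, fun h' => ⟨h i j, h'⟩⟩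

/-- The argument of the quotient of the sums over a block. -/
theorem arg_sum_div_sum {r : ℕ} (hr : 1 ≤ r) {z w : Fin r → ℂ} (hre : ∀ i, 0 < (z i / w i).re)
    (hw : ∀ i j, Complex.arg (w i) = Complex.arg (w j)) {θ : ℝ}
    (hθ : ∀ i, Complex.arg (z i / w i) = θ) :
    Complex.arg ((∑ i, z i) / ∑ i, w i) = θ := by
  have hw0 : ∀ i, w i ≠ 0 := fun i => (ne_zero_of_div_re_pos (hre i)).2
  have := sum_div_mem_of_sameRay (Q := fun x => x ≠ 0 ∧ Complex.arg x = θ)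
    (fun x y hx hy => ?_) (fun r x hr hx => ?_) (hw0 ⟨0, hr⟩)
    (l := List.ofFn fun i => (z i, w i)) (by rw [Ne, List.ofFn_eq_nil_iff]; omega)
    (fun p hp => ?_)
  · rw [List.sum_ofFn, sum_pair] at this
    exact this.2.2.2
  · have h := arg_add_of_arg_eq (hx.2.trans hy.2.symm)
    refine ⟨fun h0 => ?_, h.trans hx.2⟩
    obtain ⟨r, hr, rfl⟩ := (Complex.sameRay_of_arg_eq (hx.2.trans hy.2.symm)).exists_pos_left
      hx.1 hy.1
    rw [show x + r • x = (1 + r) • x by rw [add_smul, one_smul]] at h0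
    rcases smul_eq_zero.mp h0 with h1 | h1
    · linarith
    · exact hx.1 h1
  · exact ⟨mul_ne_zero (by exact_mod_cast hr.ne') hx.1, by rw [Complex.arg_real_mul _ hr, hx.2]⟩
  · obtain ⟨i, rfl⟩ := (List.mem_ofFn' _ _).mp hp
    exact ⟨hw0 i, Complex.sameRay_of_arg_eq (hw _ _), ne_zero_of_re_pos (hre i), hθ i⟩

theorem arg_sum_of_arg_eq {r : ℕ} (hr : 1 ≤ r) {w : Fin r → ℂ} {θ : ℝ}
    (hw : ∀ i, Complex.arg (w i) = θ) : Complex.arg (∑ i, w i) = θ := by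
  have := arg_sum_snd_eq (l := List.ofFn fun i => (w i, w i))
    (by rw [Ne, List.ofFn_eq_nil_iff]; omega) (θ := θ)
    (fun p hp => by obtain ⟨i, rfl⟩ := (List.mem_ofFn' _ _).mp hp; exact hw i)
  rwa [List.sum_ofFn, sum_pair] at this

/-- The mould whose values on collinear lists are the block weights. -/
noncomputable def weightMould : List (ℂ × ℂ) → ℂ :=
  mouldComp (mouldComp logMould descMould) equalMould

theorem weightMould_eq_zero {l : List (ℂ × ℂ)} (hl : ¬ CollinearSnd l) : weightMould l = 0 :=
  mouldComp_eq_zero_of_not_collinear (fun _ h => mouldComp_eq_zero_of_not_collinear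
    (fun _ h => if_neg h) (fun _ h => if_neg fun h' => h (collinear_of_isChain
      (fun _ _ h => h.1) h')) h) (fun _ h => if_neg fun h' => h h'.1) hl

/-- The composition plays the role of ξ: its number of blocks gives the logarithmic coefficient, and
each block must have strictly decreasing arguments. -/
theorem mouldComp_logMould_descMould_ofFn {r : ℕ} {z w : Fin r → ℂ} {θ : ℝ}
    (hw : ∀ i, Complex.arg (w i) = θ) [∀ c : Composition r, Decidable (∀ a b,
      a < b → c.index a = c.index b → Complex.arg (z b / w b) < Complex.arg (z a / w a))] :
    mouldComp logMould descMould (List.ofFn fun i => (z i, w i)) = ∑ c : Composition r,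
      if ∀ a b, a < b → c.index a = c.index b →
        Complex.arg (z b / w b) < Complex.arg (z a / w a) then
        -(-1 : ℂ) ^ c.length / c.length else 0 := by
  rw [mouldComp_ofFn]
  refine Finset.sum_congr rfl fun c _ => ?_
  have hlog : logMould (List.ofFn fun k => ∑ j, (z (c.embedding k j), w (c.embedding k j))) =
      -(-1 : ℂ) ^ c.length / c.length := by
    rw [logMould, if_pos, List.length_ofFn]
    rw [collinearSnd_ofFn]
    intro i j
    simp only [sum_pair]
    rw [arg_sum_of_arg_eq (c.one_le_blocksFun i) fun _ => hw _,
      arg_sum_of_arg_eq (c.one_le_blocksFun j) fun _ => hw _]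
  rw [hlog]
  split_ifs with h
  · rw [Finset.prod_eq_one, mul_one]
    intro k _
    rw [descMould, if_pos]
    rw [isChain_decreasingArg_ofFn fun i j => (hw _).trans (hw _).symm]
    exact fun i j hij => h _ _ ((c.embedding k).strictMono hij)
      (by rw [c.index_embedding, c.index_embedding])
  · obtain ⟨a, b, hab, hidx, hnot⟩ : ∃ a b, a < b ∧ c.index a = c.index b ∧
        ¬ Complex.arg (z b / w b) < Complex.arg (z a / w a) := by
      push Not at h
      obtain ⟨a, b, h1, h2, h3⟩ := h
      exact ⟨a, b, h1, h2, not_lt.mpr h3⟩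
    rw [Finset.prod_eq_zero (Finset.mem_univ (c.index a)), mul_zero]
    rw [descMould, if_neg]
    rw [isChain_decreasingArg_ofFn fun i j => (hw _).trans (hw _).symm]
    intro h'
    obtain ⟨i, hi⟩ := c.mem_range_embedding a
    obtain ⟨j, hj⟩ : b ∈ Set.range (c.embedding (c.index a)) := hidx ▸ c.mem_range_embedding b
    have hij : i < j := by
      rw [← (c.embedding (c.index a)).lt_iff_lt, hi, hj]
      exact hab
    have := h' i j hij
    rw [hi, hj] at this
    exact hnot this

open Classical in
-- A monotone surjection is the index map of a composition, so ψ becomes a composition of `r` and ξ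
-- one of the number of its blocks.
theorem blockWeight_eq_sum_composition {r : ℕ} (hr : 1 ≤ r) (z w : Fin r → ℂ) :
    blockWeight z w = ∑ c : Composition r, ∑ c' : Composition c.length,
      if (∀ a b, c.index a = c.index b → Complex.arg (z a / w a) = Complex.arg (z b / w b)) ∧
          (∀ a b, c.index a < c.index b → c'.index (c.index a) = c'.index (c.index b) →
            Complex.arg (z b / w b) < Complex.arg (z a / w a))
      then (-1 : ℂ) ^ (c'.length - 1) / (c'.length : ℂ) *
          ∏ k, (1 : ℂ) / ((c.blocksFun k).factorial : ℂ)
      else 0 := by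
  have h1 : blockWeight z w = ∑ m ∈ Finset.Icc 1 r, ∑ ψ : Fin r → Fin m,
      if Monotone ψ ∧ Function.Surjective ψ then
        ∑ l ∈ Finset.Icc 1 m, ∑ ξ : Fin m → Fin l,
          if Monotone ξ ∧ Function.Surjective ξ then
            if (∀ a b, ψ a = ψ b → Complex.arg (z a / w a) = Complex.arg (z b / w b)) ∧
              (∀ a b, ψ a < ψ b → ξ (ψ a) = ξ (ψ b) →
                Complex.arg (z b / w b) < Complex.arg (z a / w a))
            then (-1 : ℂ) ^ (l - 1) / (l : ℂ) *
              ∏ c : Fin m, (1 : ℂ) / ((Finset.univ.filter fun a => ψ a = c).card.factorial : ℂ)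
            else 0
          else 0
      else 0 := by
    rw [blockWeight]
    refine Finset.sum_congr rfl fun m _ => ?_
    rw [Finset.sum_comm]
    refine Finset.sum_congr rfl fun ψ _ => ?_
    split_ifs with h
    · refine Finset.sum_congr rfl fun l _ => Finset.sum_congr rfl fun ξ _ => ?_
      rw [← ite_and]
      refine if_congr ?_ rfl rfl
      tauto
    · refine Finset.sum_eq_zero fun l _ => Finset.sum_eq_zero fun ξ _ => if_neg ?_
      tauto
  rw [h1, sum_monotone_surjective_eq hr (fun m ψ => ∑ l ∈ Finset.Icc 1 m, ∑ ξ : Fin m → Fin l,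
          if Monotone ξ ∧ Function.Surjective ξ then
            if (∀ a b, ψ a = ψ b → Complex.arg (z a / w a) = Complex.arg (z b / w b)) ∧
              (∀ a b, ψ a < ψ b → ξ (ψ a) = ξ (ψ b) →
                Complex.arg (z b / w b) < Complex.arg (z a / w a))
            then (-1 : ℂ) ^ (l - 1) / (l : ℂ) *
              ∏ c : Fin m, (1 : ℂ) / ((Finset.univ.filter fun a => ψ a = c).card.factorial : ℂ)
            else 0
          else 0)]
  refine Finset.sum_congr rfl fun c _ => ?_
  rw [sum_monotone_surjective_eq (c.length_pos_iff.mpr hr) fun l ξ =>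
            if (∀ a b, c.index a = c.index b → Complex.arg (z a / w a) = Complex.arg (z b / w b)) ∧
              (∀ a b, c.index a < c.index b → ξ (c.index a) = ξ (c.index b) →
                Complex.arg (z b / w b) < Complex.arg (z a / w a))
            then (-1 : ℂ) ^ (l - 1) / (l : ℂ) *
              ∏ k, (1 : ℂ) / ((Finset.univ.filter fun a => c.index a = k).card.factorial : ℂ)
            else 0]
  simp_rw [c.card_index_fiber]

/-- The innermost mould merges entries of equal argument, which is ψ with its factorials. The merged
quotient keeps that argument, so the logarithmic and descending moulds reproduce the condition on ξ.
-/
theorem weightMould_ofFn {r : ℕ} (hr : 1 ≤ r) {z w : Fin r → ℂ} (hre : ∀ i, 0 < (z i / w i).re)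
    (hw : ∀ i j, Complex.arg (w i) = Complex.arg (w j)) :
    weightMould (List.ofFn fun i => (z i, w i)) = blockWeight z w := by
  classical
  rw [weightMould, mouldComp_ofFn, blockWeight_eq_sum_composition hr]
  refine Finset.sum_congr rfl fun c _ => ?_
  simp only [sum_pair]
  rw [mouldComp_logMould_descMould_ofFn (θ := Complex.arg (w ⟨0, hr⟩))
    fun k => arg_sum_of_arg_eq (c.one_le_blocksFun k) fun _ => hw _ _]
  by_cases h1 : ∀ a b, c.index a = c.index b → Complex.arg (z a / w a) = Complex.arg (z b / w b)
  · have hprod : ∏ k, equalMould (List.ofFn fun j => (z (c.embedding k j), w (c.embedding k j))) =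
        ∏ k, (1 : ℂ) / ((c.blocksFun k).factorial : ℂ) := by
      refine Finset.prod_congr rfl fun k _ => ?_
      rw [equalMould_ofFn_of_pos (fun i j => hw _ _) fun i j => h1 _ _
        (by rw [c.index_embedding, c.index_embedding]), one_div]
    have harg : ∀ a, Complex.arg ((∑ j, z (c.embedding (c.index a) j)) /
        ∑ j, w (c.embedding (c.index a) j)) = Complex.arg (z a / w a) := fun a =>
      arg_sum_div_sum (c.one_le_blocksFun _) (fun i => hre _) (fun i j => hw _ _)
        fun i => h1 _ _ (c.index_embedding _ _)
    rw [hprod, Finset.sum_mul]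
    refine Finset.sum_congr rfl fun c' _ => ?_
    have hpos : 1 ≤ c'.length := c'.length_pos_iff.mpr (c.length_pos_iff.mpr hr)
    rw [ite_mul, zero_mul]
    refine if_congr ?_ ?_ rfl
    · constructor
      · refine fun h => ⟨h1, fun a b hab he => ?_⟩
        have := h _ _ hab he
        rwa [harg, harg] at this
      · rintro ⟨-, h⟩ k k' hk he
        obtain ⟨a, rfl⟩ := c.surjective_index k
        obtain ⟨b, rfl⟩ := c.surjective_index k'
        rw [harg, harg]
        exact h a b hk he
    -- As the length is positive, the truncated exponent is harmless and (-1)^{l-1} = -(-1)^l.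
    · obtain ⟨l, hl⟩ : ∃ l, c'.length = l + 1 := ⟨c'.length - 1, by omega⟩
      rw [hl, Nat.add_sub_cancel, pow_succ]
      simp
  · have hprod : ∏ k, equalMould (List.ofFn fun j => (z (c.embedding k j), w (c.embedding k j))) =
        0 := by
      push Not at h1
      obtain ⟨a, b, hab, hne⟩ := h1
      refine Finset.prod_eq_zero (Finset.mem_univ (c.index a)) (equalMould_ofFn_of_neg ?_)
      rintro ⟨-, h⟩
      obtain ⟨i, hi⟩ := c.mem_range_embedding a
      obtain ⟨j, hj⟩ : b ∈ Set.range (c.embedding (c.index a)) := hab ▸ c.mem_range_embedding b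
      have := h i j
      rw [hi, hj] at this
      exact hne this
    rw [hprod, mul_zero]
    exact (Finset.sum_eq_zero fun c' _ => if_neg fun h => h1 h.1).symm

end BlockWeights

/-! ### The family `joyceF` and its wall-crossing property -/

section JoyceFamily
open Set Filter Topology

/-- The functions `G_n` of the wall-crossing condition. -/
noncomputable def joyceG (n : ℕ) (y u : Fin n → ℂ) : ℂ :=
  mouldComp ascendingLimit expMould (List.ofFn fun i => (y i, u i))

/-- The functions `F_n`. -/
noncomputable def joyceF (n : ℕ) (z : Fin n → ℂ) : ℂ := joyceG n z z

theorem joyceG_eq (n : ℕ) (y u : Fin n → ℂ) :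
    joyceG n y u = ∑ c : Composition n,
      phaseLimit (fun k => ∑ j, y (c.embedding k j)) (fun k => ∑ j, u (c.embedding k j))
        (fun k => (k : ℝ)) *
      ∏ k, expMould (List.ofFn fun j => (y (c.embedding k j), u (c.embedding k j))) := by
  rw [joyceG, mouldComp_ofFn]
  simp only [sum_pair, ascendingLimit_ofFn]

theorem expMould_ofFn_congr {n : ℕ} (y y' u : Fin n → ℂ) :
    expMould (List.ofFn fun i => (y i, u i)) = expMould (List.ofFn fun i => (y' i, u i)) := by
  simp only [expMould, collinearSnd_ofFn, List.length_ofFn]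

/-- The cone Re > 0, |Im| < κ Re is convex, so it contains the quotient of the block sums. -/
theorem re_sum_div_sum_pos {r : ℕ} (hr : 1 ≤ r) {z w : Fin r → ℂ} {κ : ℝ}
    (hz : ∀ i, 0 < (z i / w i).re ∧ |(z i / w i).im| < κ * (z i / w i).re)
    (hw : ∀ i j, Complex.arg (w i) = Complex.arg (w j)) :
    ∑ i, w i ≠ 0 ∧ 0 < ((∑ i, z i) / ∑ i, w i).re ∧
      |((∑ i, z i) / ∑ i, w i).im| < κ * ((∑ i, z i) / ∑ i, w i).re := by
  have hw0 : ∀ i, w i ≠ 0 := fun i => (ne_zero_of_div_re_pos (hz i).1).2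
  have := sum_div_mem_of_sameRay (Q := fun x => 0 < x.re ∧ |x.im| < κ * x.re)
    (fun x y hx hy => ?_) (fun r x hr hx => ?_) (hw0 ⟨0, hr⟩)
    (l := List.ofFn fun i => (z i, w i)) (by rw [Ne, List.ofFn_eq_nil_iff]; omega)
    (fun p hp => ?_)
  · rw [List.sum_ofFn, sum_pair] at this
    exact ⟨this.1, this.2.2⟩
  · refine ⟨add_pos hx.1 hy.1, ?_⟩
    rw [Complex.add_im, Complex.add_re, mul_add]
    exact (abs_add_le _ _).trans_lt (add_lt_add hx.2 hy.2)
  · rw [Complex.re_ofReal_mul, Complex.im_ofReal_mul, abs_mul, abs_of_pos hr, mul_left_comm]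
    exact ⟨mul_pos hr hx.1, mul_lt_mul_of_pos_left hx.2 hr⟩
  · obtain ⟨i, rfl⟩ := (List.mem_ofFn' _ _).mp hp
    exact ⟨hw0 i, Complex.sameRay_of_arg_eq (hw _ _), hz i⟩

theorem exists_cone_bound {z : ℂ} (h : 0 < z.re) : ∃ κ : ℝ, |z.im| < κ * z.re :=
  ⟨|z.im| / z.re + 1, by rw [add_mul, div_mul_cancel₀ _ h.ne']; linarith⟩

theorem re_sum_div_sum_pos' {r : ℕ} (hr : 1 ≤ r) {z w : Fin r → ℂ}
    (hz : ∀ i, 0 < (z i / w i).re) (hw : ∀ i j, Complex.arg (w i) = Complex.arg (w j)) :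
    0 < ((∑ i, z i) / ∑ i, w i).re := by
  choose κ hκ using fun i => exists_cone_bound (hz i)
  refine (re_sum_div_sum_pos hr (κ := ∑ i, |κ i|) (fun i => ⟨hz i, (hκ i).trans_le ?_⟩) hw).2.1
  refine mul_le_mul_of_nonneg_right ?_ (hz i).le
  exact (le_abs_self _).trans (Finset.single_le_sum (f := fun i => |κ i|)
    (fun _ _ => abs_nonneg _) (Finset.mem_univ i))

/-- The exponential weights depend on `u` only, so this is a finite linear combination of phase
limits precomposed with the linear block sums. -/
theorem differentiableOn_joyceG {n : ℕ} (hn : 1 ≤ n) (u : Fin n → ℂ) :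
    DifferentiableOn ℂ (fun y => joyceG n y u) {y | ∀ i, 0 < (y i / u i).re} := by
  simp only [joyceG_eq]
  refine DifferentiableOn.fun_sum fun c _ => ?_
  by_cases hc : ∀ k i j, Complex.arg (u (c.embedding k i)) = Complex.arg (u (c.embedding k j))
  · have hsep : Separates (fun k => ∑ j, u (c.embedding k j)) fun k : Fin c.length => (k : ℝ) := by
      intro k hk _
      simp
    have h1 := (differentiableOn_phaseLimit (c.length_pos_iff.mpr hn) hsep).comp
      (g := fun y : Fin c.length → ℂ =>
        phaseLimit y (fun k => ∑ j, u (c.embedding k j)) fun k => (k : ℝ))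
      (f := fun y : Fin n → ℂ => fun k => ∑ j, y (c.embedding k j))
      (s := {y | ∀ i, 0 < (y i / u i).re}) (by fun_prop) fun y hy k =>
        re_sum_div_sum_pos' (c.one_le_blocksFun k) (fun j => hy _) (hc k)
    have h2 : ∀ (y : Fin n → ℂ) (k : Fin c.length),
        expMould (List.ofFn fun j => (y (c.embedding k j), u (c.embedding k j))) =
          expMould (List.ofFn fun j => (u (c.embedding k j), u (c.embedding k j))) :=
      fun y k => expMould_ofFn_congr _ _ _
    simp only [h2]
    exact h1.mul_const _
  · push Not at hc
    obtain ⟨k, i, j, hij⟩ := hc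
    have h2 : ∀ y : Fin n → ℂ, ∏ k, expMould (List.ofFn fun j =>
        (y (c.embedding k j), u (c.embedding k j))) = 0 := fun y =>
      Finset.prod_eq_zero (Finset.mem_univ k) (if_neg fun h =>
        hij (collinearSnd_ofFn.mp h i j))
    simp only [h2, mul_zero]
    exact differentiableOn_const _

/-- The admissible apertures of the wall-crossing neighbourhoods of `w`. -/
def IsWallAperture {n : ℕ} (w : Fin n → ℂ) (κ : ℝ) : Prop :=
  0 < κ ∧ ∃ δ : ℝ, (∀ x : ℂ, 0 < x.re → |x.im| < κ * x.re → |Complex.arg x| < δ) ∧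
    ∀ c : Composition n, (∀ k, ∑ j, w (c.embedding k j) ≠ 0) →
      IsPhaseRadius (fun k => ∑ j, w (c.embedding k j)) δ

/-- There are finitely many compositions, so one phase radius serves them all; the argument is
controlled by Im/Re after scaling the real part to 1. -/
theorem exists_isWallAperture {n : ℕ} (w : Fin n → ℂ) : ∃ κ, IsWallAperture w κ := by
  have h1 : ∀ᶠ δ in 𝓝[>] (0 : ℝ), ∀ c : Composition n, (∀ k, ∑ j, w (c.embedding k j) ≠ 0) →
      IsPhaseRadius (fun k => ∑ j, w (c.embedding k j)) δ := by
    refine eventually_all.mpr fun c => ?_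
    by_cases hc : ∀ k, ∑ j, w (c.embedding k j) ≠ 0
    · obtain ⟨δ₀, h0, h⟩ := exists_isPhaseRadius hc
      filter_upwards [Ioo_mem_nhdsGT h0] with δ hδ _
      exact ⟨hδ.1, fun φ hφ => h φ fun i => (hφ i).trans hδ.2⟩
    · exact Eventually.of_forall fun _ h => absurd h hc
  obtain ⟨δ, h2, (hδ : 0 < δ)⟩ := (h1.and self_mem_nhdsWithin).exists
  have hcont : ContinuousAt (fun y : ℝ => |Complex.arg (1 + y * Complex.I)|) 0 := by
    have h3 : ContinuousAt Complex.arg (1 + (0 : ℝ) * Complex.I) :=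
      Complex.continuousAt_arg (by simp [Complex.mem_slitPlane_iff])
    have h4 : ContinuousAt (fun y : ℝ => (1 + y * Complex.I : ℂ)) 0 := by fun_prop
    exact (ContinuousAt.comp' (f := fun y : ℝ => (1 + y * Complex.I : ℂ)) h3 h4).abs
  obtain ⟨κ, hκ, hball⟩ := Metric.eventually_nhds_iff.mp
    (hcont.eventually_lt_const (u := δ) (by simpa using hδ))
  refine ⟨κ, hκ, δ, fun x hx hx' => ?_, h2⟩
  have e : x = (x.re : ℂ) * (1 + ((x.im / x.re : ℝ) : ℂ) * Complex.I) := by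
    have : (x.re : ℂ) ≠ 0 := by exact_mod_cast hx.ne'
    conv_lhs => rw [← Complex.re_add_im x]
    push_cast
    field_simp
  rw [e, Complex.arg_real_mul _ hx]
  refine hball ?_
  rw [Real.dist_eq, sub_zero, abs_div, abs_of_pos hx, div_lt_iff₀ hx]
  exact hx'

/-- The neighbourhoods of the wall-crossing condition. -/
def wallNeighborhood {n : ℕ} (w : Fin n → ℂ) (κ : ℝ) : Set (Fin n → ℂ) :=
  {z | (∀ i, 0 < (z i / w i).re ∧ |(z i / w i).im| < κ * (z i / w i).re) ∧
    ∀ (k : ℕ) (hk : k + 1 < n), ¬ SameRay ℝ (w ⟨k, by omega⟩) (w ⟨k + 1, hk⟩) →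
      ¬ SameRay ℝ (z ⟨k, by omega⟩) (z ⟨k + 1, hk⟩)}

theorem isOpen_wallNeighborhood {n : ℕ} (w : Fin n → ℂ) (κ : ℝ) :
    IsOpen (wallNeighborhood w κ) := by
  rw [isOpen_iff_mem_nhds]
  intro z hz
  have hz0 : ∀ i, z i ≠ 0 := fun i => (ne_zero_of_div_re_pos (hz.1 i).1).1
  have h1 : ∀ᶠ y in 𝓝 z, ∀ i, 0 < (y i / w i).re ∧ |(y i / w i).im| < κ * (y i / w i).re := by
    refine eventually_all.mpr fun i => ?_
    have hc : Continuous fun y : Fin n → ℂ => y i / w i := (continuous_apply i).div_const _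
    have h2 := (Complex.continuous_re.comp hc).continuousAt (x := z)
    have h3 := (Complex.continuous_im.comp hc).abs.continuousAt (x := z)
    exact (h2.eventually_const_lt (hz.1 i).1).and
      (h3.eventually_lt (h2.const_mul κ) (hz.1 i).2)
  have h2 : ∀ᶠ y in 𝓝 z, ∀ k : Fin n, ∀ hk : (k : ℕ) + 1 < n,
      ¬ SameRay ℝ (w k) (w ⟨k + 1, hk⟩) → -y ⟨k + 1, hk⟩ / y k ∈ Complex.slitPlane := by
    refine eventually_all.mpr fun k => ?_
    by_cases hk : (k : ℕ) + 1 < n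
    · by_cases hray : SameRay ℝ (w k) (w ⟨k + 1, hk⟩)
      · exact Eventually.of_forall fun _ _ h => absurd hray h
      · have hc : ContinuousAt (fun y : Fin n → ℂ => -y ⟨k + 1, hk⟩ / y k) z :=
          ContinuousAt.div (continuous_apply _).neg.continuousAt (continuous_apply _).continuousAt
            (hz0 k)
        have := (not_sameRay_iff_neg_div_mem_slitPlane (hz0 _) (hz0 _)).mp (hz.2 k hk hray)
        filter_upwards [hc.eventually (Complex.isOpen_slitPlane.mem_nhds this)] with y hy _ _
          using hy
    · exact Eventually.of_forall fun _ h => absurd h hk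
  filter_upwards [h1, h2] with y hy1 hy2
  refine ⟨hy1, fun k hk hray => ?_⟩
  have hy0 : ∀ i, y i ≠ 0 := fun i => (ne_zero_of_div_re_pos (hy1 i).1).1
  rw [not_sameRay_iff_neg_div_mem_slitPlane (hy0 _) (hy0 _)]
  exact hy2 ⟨k, by omega⟩ hk hray

theorem mem_wallNeighborhood_self {n : ℕ} {w : Fin n → ℂ} (hw : ∀ i, w i ≠ 0) {κ : ℝ}
    (hκ : 0 < κ) : w ∈ wallNeighborhood w κ :=
  ⟨fun i => by rw [div_self (hw i)]; simpa using hκ, fun _ _ h => h⟩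

theorem arg_div_eq_of_arg_eq {z₁ z₂ w₁ w₂ : ℂ} (h₁ : 0 < (z₁ / w₁).re) (h₂ : 0 < (z₂ / w₂).re)
    (hz : Complex.arg z₁ = Complex.arg z₂) (hw : Complex.arg w₁ = Complex.arg w₂) :
    Complex.arg (z₁ / w₁) = Complex.arg (z₂ / w₂) := by
  obtain ⟨z1, w1⟩ := ne_zero_of_div_re_pos h₁
  obtain ⟨z2, w2⟩ := ne_zero_of_div_re_pos h₂
  obtain ⟨r, hr, rfl⟩ := (Complex.sameRay_of_arg_eq hz).exists_pos_left z1 z2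
  obtain ⟨s, hs, rfl⟩ := (Complex.sameRay_of_arg_eq hw).exists_pos_left w1 w2
  have e : r • z₁ / s • w₁ = ((r / s : ℝ) : ℂ) * (z₁ / w₁) := by
    rw [Complex.real_smul, Complex.real_smul]
    have : (s : ℂ) ≠ 0 := by exact_mod_cast hs.ne'
    push_cast
    field_simp
  rw [e, Complex.arg_real_mul _ (by positivity)]

theorem arg_eq_of_arg_div_eq {z₁ z₂ w₁ w₂ : ℂ} (h₁ : 0 < (z₁ / w₁).re) (h₂ : 0 < (z₂ / w₂).re)
    (hz : Complex.arg (z₁ / w₁) = Complex.arg (z₂ / w₂)) (hw : Complex.arg w₁ = Complex.arg w₂) :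
    Complex.arg z₁ = Complex.arg z₂ := by
  obtain ⟨z1, w1⟩ := ne_zero_of_div_re_pos h₁
  obtain ⟨z2, w2⟩ := ne_zero_of_div_re_pos h₂
  obtain ⟨r, hr, hr'⟩ := (Complex.sameRay_of_arg_eq hz).exists_pos_left
    (div_ne_zero z1 w1) (div_ne_zero z2 w2)
  obtain ⟨s, hs, rfl⟩ := (Complex.sameRay_of_arg_eq hw).exists_pos_left w1 w2
  have e : z₂ = ((r * s : ℝ) : ℂ) * z₁ := by
    rw [Complex.real_smul, Complex.real_smul, eq_div_iff
      (mul_ne_zero (by exact_mod_cast hs.ne') w1)] at hr'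
    rw [← hr']
    push_cast
    field_simp
  rw [e, Complex.arg_real_mul _ (by positivity)]

/-- The entries of `z` share a ray exactly when those of `w` do and arg(z/w) is constant. The
adjacency hypothesis excludes new alignments of `z` over unaligned entries of `w`. -/
theorem expMould_self_eq_equalMould {r : ℕ} {z w : Fin r → ℂ} (hre : ∀ i, 0 < (z i / w i).re)
    (hadj : ∀ (k : ℕ) (hk : k + 1 < r), SameRay ℝ (z ⟨k, by omega⟩) (z ⟨k + 1, hk⟩) →
      SameRay ℝ (w ⟨k, by omega⟩) (w ⟨k + 1, hk⟩)) :
    expMould (List.ofFn fun i => (z i, z i)) = equalMould (List.ofFn fun i => (z i, w i)) := by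
  by_cases h : ∀ i j, Complex.arg (z i) = Complex.arg (z j)
  · have hw : ∀ i j, Complex.arg (w i) = Complex.arg (w j) := by
      have : (List.ofFn fun i => (z i, w i)).IsChain
          fun p q => Complex.arg p.2 = Complex.arg q.2 := by
        rw [List.isChain_ofFn]
        intro k hk
        exact (sameRay_iff_arg_eq (ne_zero_of_div_re_pos (hre _)).2
          (ne_zero_of_div_re_pos (hre _)).2).mp
          (hadj k hk (Complex.sameRay_of_arg_eq (h _ _)))
      exact collinearSnd_ofFn.mp (collinear_of_isChain (fun _ _ => id) this)
    rw [expMould_ofFn_of_collinear h, equalMould_ofFn_of_pos hw fun i j =>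
      arg_div_eq_of_arg_eq (hre _) (hre _) (h _ _) (hw _ _)]
  · rw [expMould, if_neg fun h' => h (collinearSnd_ofFn.mp h'), equalMould_ofFn_of_neg]
    rintro ⟨h1, h2⟩
    exact h fun i j => arg_eq_of_arg_div_eq (hre _) (hre _) (h2 i j) (h1 i j)

/-- Moving the base point from `z` to `w` turns the exponential weights into the mould of equal
arguments and the ascending values into ascending values composed with descents. Inserting exp ∘ log
= 1 then separates a part independent of chambers from the block weights. -/
theorem joyceF_eq_mouldComp {n : ℕ} {z w : Fin n → ℂ} {κ : ℝ} (hκ : IsWallAperture w κ)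
    (hz : z ∈ wallNeighborhood w κ) :
    joyceF n z = mouldComp (mouldComp ascendingLimit expMould) weightMould
      (List.ofFn fun i => (z i, w i)) := by
  obtain ⟨-, δ, hδ1, hδ2⟩ := hκ
  have h1 : joyceF n z = mouldComp (mouldComp ascendingLimit descMould) equalMould
      (List.ofFn fun i => (z i, w i)) := by
    rw [joyceF, joyceG, mouldComp_ofFn, mouldComp_ofFn]
    refine Finset.sum_congr rfl fun c _ => ?_
    have hexp : ∀ k, expMould (List.ofFn fun j => (z (c.embedding k j), z (c.embedding k j))) =
        equalMould (List.ofFn fun j => (z (c.embedding k j), w (c.embedding k j))) := by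
      intro k
      refine expMould_self_eq_equalMould (fun i => (hz.1 _).1) fun j hj hray => ?_
      by_contra hnot
      have hs : c.embedding k ⟨j + 1, hj⟩ =
          ⟨(c.embedding k ⟨j, by omega⟩ : ℕ) + 1, by
            have := (c.embedding k ⟨j + 1, hj⟩).isLt
            simp only [Composition.coe_embedding] at this ⊢
            omega⟩ := by
        ext
        simp only [Composition.coe_embedding]
        omega
      rw [hs] at hnot hray
      exact hz.2 _ _ hnot hray
    simp only [hexp, sum_pair]
    by_cases hcol : ∀ k i j, Complex.arg (w (c.embedding k i)) = Complex.arg (w (c.embedding k j))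
    · congr 1
      have hs := fun k => re_sum_div_sum_pos (c.one_le_blocksFun k)
        (fun j => hz.1 (c.embedding k j)) (hcol k)
      -- An empty composition occurs only for n = 0, which is not excluded by the hypotheses.
      rcases Nat.eq_zero_or_pos c.length with h0 | h0
      · have : IsEmpty (Fin c.length) := by rw [h0]; infer_instance
        have e : ∀ g : Fin c.length → ℂ × ℂ, List.ofFn g = [] := fun g =>
          List.ofFn_eq_nil_iff.mpr h0
        rw [e, e]
        simp [mouldComp, segmentations]
      · exact ascendingLimit_self_eq h0 (hδ2 c fun k => (hs k).1) (fun k => (hs k).2.1)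
          fun k => hδ1 _ (hs k).2.1 (hs k).2.2
    · push Not at hcol
      obtain ⟨k, i, j, hij⟩ := hcol
      have : ∏ k, equalMould (List.ofFn fun j => (z (c.embedding k j), w (c.embedding k j))) = 0 :=
        Finset.prod_eq_zero (Finset.mem_univ k) (equalMould_ofFn_of_neg fun h => hij (h.1 i j))
      rw [this, mul_zero, mul_zero]
  rw [h1, weightMould, ← mouldComp_assoc, ← mouldComp_assoc, mouldComp_expMould_logMould_cancel]

theorem rayBlocks_iff {n : ℕ} (c : Composition n) {w : Fin n → ℂ} (hw : ∀ i, w i ≠ 0) :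
    RayBlocks c w ↔
      ∀ k i j, Complex.arg (w (c.embedding k i)) = Complex.arg (w (c.embedding k j)) := by
  constructor
  · intro h k i j
    obtain ⟨θ, -, -, hθ⟩ := h k
    obtain ⟨r, hr, hri⟩ := hθ i
    obtain ⟨s, hs, hsj⟩ := hθ j
    simp only [blockPart] at hri hsj
    rw [hri, hsj, Complex.arg_real_mul _ hr, Complex.arg_real_mul _ hs]
  · intro h k
    have hpi := Real.pi_pos
    set w₀ := w (c.embedding k ⟨0, c.one_le_blocksFun k⟩) with hw₀
    -- `Complex.arg` takes values in (-π, π]; negative values are shifted by a full turn.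
    have key : ∃ θ : ℝ, 0 ≤ θ ∧ θ < 2 * Real.pi ∧
        Complex.exp (θ * Complex.I) = Complex.exp (Complex.arg w₀ * Complex.I) := by
      have h1 := Complex.neg_pi_lt_arg w₀
      have h2 := Complex.arg_le_pi w₀
      by_cases h0 : 0 ≤ Complex.arg w₀
      · exact ⟨Complex.arg w₀, h0, by linarith, rfl⟩
      · refine ⟨Complex.arg w₀ + 2 * Real.pi, by linarith, by linarith, ?_⟩
        push_cast
        rw [add_mul, Complex.exp_add, Complex.exp_two_pi_mul_I, mul_one]
    obtain ⟨θ, h1, h2, h3⟩ := key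
    refine ⟨θ, h1, h2, fun j => ⟨‖w (c.embedding k j)‖, norm_pos_iff.mpr (hw _), ?_⟩⟩
    rw [h3, hw₀, h k _ j, Complex.norm_mul_exp_arg_mul_I]
    rfl

theorem wallCrossing_joyceF : WallCrossing joyceF := by
  choose κ hκ using fun (n : ℕ) (w : Fin n → ℂ) => exists_isWallAperture w
  refine ⟨fun n w => wallNeighborhood w (κ n w), joyceG, fun n hn w hw =>
    ⟨isOpen_wallNeighborhood _ _, mem_wallNeighborhood_self hw (hκ n w).1, fun z hz =>
    ⟨fun k => (hz.1 k).1, ?_⟩⟩, fun m hm u hu => ?_⟩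
  · rw [joyceF_eq_mouldComp (hκ n w) hz, mouldComp_ofFn]
    refine Finset.sum_congr rfl fun c _ => ?_
    by_cases hc : RayBlocks c w
    · rw [if_pos hc]
      rw [rayBlocks_iff c hw] at hc
      simp only [sum_pair]
      congr 1
      refine Finset.prod_congr rfl fun k _ => ?_
      exact weightMould_ofFn (c.one_le_blocksFun k) (fun j => (hz.1 _).1) (hc k)
    · rw [if_neg hc]
      rw [rayBlocks_iff c hw] at hc
      push Not at hc
      obtain ⟨k, i, j, hij⟩ := hc
      rw [Finset.prod_eq_zero (Finset.mem_univ k) (weightMould_eq_zero fun h =>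
        hij (collinearSnd_ofFn.mp h i j)), mul_zero]
  · refine (differentiableOn_joyceG hm u).mono ?_
    -- Wherever a value is requested, `y` and `u` are block sums over common rays, so Re(y/u) > 0,
    -- whatever the tuple they come from.
    rintro y ⟨n, w, z, c, rfl, hn, hw, hz, hc, hy, hu'⟩
    rw [rayBlocks_iff c hw] at hc
    intro k
    have h1 := hy k
    have h2 := hu' k
    simp only [Fin.cast_eq_self] at h1 h2
    rw [← h1, ← h2]
    exact re_sum_div_sum_pos' (c.one_le_blocksFun k) (fun j => (hz.1 _).1) (hc k)

end JoyceFamily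

/-! ### `joyceF` as an average over the orders of the phases -/

section PhaseAverage
open Set Filter Topology

/-- Exactly one rearrangement of an injective tuple is decreasing. -/
theorem exists_unique_perm_strictAnti {α : Type*} [LinearOrder α] {m : ℕ} {g : Fin m → α}
    (hg : Function.Injective g) : ∃! τ : Equiv.Perm (Fin m), StrictAnti (g ∘ τ) := by
  let h : Fin m → αᵒᵈ := OrderDual.toDual ∘ g
  have hm : Monotone (h ∘ Tuple.sort h) := Tuple.monotone_sort h
  have hs : StrictMono (h ∘ Tuple.sort h) :=
    hm.strictMono_of_injective ((OrderDual.toDual.injective.comp hg).comp (Tuple.sort h).injective)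
  refine ⟨Tuple.sort h, fun i j hij => hs hij, fun τ hτ => ?_⟩
  have h1 : StrictMono (h ∘ τ) := fun i j hij => hτ hij
  have h2 : h ∘ τ = h ∘ Tuple.sort h := (h1.range_inj hs).mp (by
    rw [EquivLike.range_comp, EquivLike.range_comp])
  ext i
  exact congrArg Fin.val (hg (OrderDual.toDual.injective (congrFun h2 i)))

open Classical in
-- For each permutation exactly one rearrangement inside the blocks makes it decreasing on every
-- block; summing over both in two orders gives the count.
theorem sum_perm_strictAnti_mul_factorial {n : ℕ} (c : Composition n) :
    (∑ ρ : Equiv.Perm (Fin n), ∏ k, if StrictAnti fun j => ρ (c.embedding k j) then (1 : ℂ) else 0) *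
      ∏ k, ((c.blocksFun k).factorial : ℂ) = (n.factorial : ℂ) := by
  let Φ (τ : ∀ k, Equiv.Perm (Fin (c.blocksFun k))) : Equiv.Perm (Fin n) :=
    c.blocksFinEquiv.permCongr (Equiv.Perm.sigmaCongrRight τ)
  have hΦ : ∀ τ k j, Φ τ (c.embedding k j) = c.embedding k (τ k j) := by
    intro τ k j
    have h1 : c.blocksFinEquiv.symm (c.embedding k j) = ⟨k, j⟩ := by
      rw [Equiv.symm_apply_eq]
      rfl
    simp only [Φ, Equiv.permCongr_apply, h1]
    rfl
  have h1 : ∀ ρ : Equiv.Perm (Fin n), (1 : ℂ) = ∑ τ : ∀ k, Equiv.Perm (Fin (c.blocksFun k)),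
      ∏ k, if StrictAnti fun j => (ρ * Φ τ) (c.embedding k j) then (1 : ℂ) else 0 := by
    intro ρ
    simp only [Equiv.Perm.mul_apply, hΦ]
    have := Finset.prod_univ_sum (fun k => (Finset.univ : Finset (Equiv.Perm (Fin (c.blocksFun k)))))
      fun k τ => if StrictAnti fun j => ρ (c.embedding k (τ j)) then (1 : ℂ) else 0
    rw [Fintype.piFinset_univ] at this
    rw [← this]
    symm
    refine Finset.prod_eq_one fun k _ => ?_
    obtain ⟨τ, hτ, huniq⟩ := exists_unique_perm_strictAnti
      (g := fun j => ρ (c.embedding k j)) (ρ.injective.comp (c.embedding k).injective)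
    exact (Finset.sum_eq_single τ (fun τ' _ h => if_neg fun h' => h (huniq τ' h'))
      (fun h => absurd (Finset.mem_univ _) h)).trans (if_pos hτ)
  calc _ = ∑ τ : ∀ k, Equiv.Perm (Fin (c.blocksFun k)), ∑ ρ : Equiv.Perm (Fin n),
        ∏ k, if StrictAnti fun j => (ρ * Φ τ) (c.embedding k j) then (1 : ℂ) else 0 := by
        have h2 : ∀ τ, (∑ ρ : Equiv.Perm (Fin n), ∏ k,
            if StrictAnti fun j => (ρ * Φ τ) (c.embedding k j) then (1 : ℂ) else 0) =
            ∑ ρ : Equiv.Perm (Fin n), ∏ k,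
              if StrictAnti fun j => ρ (c.embedding k j) then (1 : ℂ) else 0 := fun τ =>
          Equiv.sum_comp (Equiv.mulRight (Φ τ)) fun ρ : Equiv.Perm (Fin n) =>
            ∏ k, if StrictAnti fun j => ρ (c.embedding k j) then (1 : ℂ) else 0
        simp only [h2, Finset.sum_const, Finset.card_univ, Fintype.card_pi, Fintype.card_perm,
          Fintype.card_fin, nsmul_eq_mul]
        push_cast
        ring
    _ = ∑ ρ : Equiv.Perm (Fin n), (1 : ℂ) := by
        rw [Finset.sum_comm]
        exact Finset.sum_congr rfl fun ρ _ => (h1 ρ).symm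
    _ = _ := by simp [Fintype.card_perm]

open Classical in
theorem descWeight_ofFn {m : ℕ} {z w : Fin m → ℂ} (hw : ∀ i, w i ≠ 0) (t : Fin m → ℝ) :
    descWeight (List.ofFn fun i => (z i, w i, t i)) =
      if (∀ i j, Complex.arg (w i) = Complex.arg (w j)) ∧ StrictAnti t then 1 else 0 := by
  rw [descWeight_eq]
  refine if_congr ?_ rfl rfl
  rw [List.isChain_ofFn]
  cases m with
  | zero => simp [StrictAnti]
  | succ m =>
    constructor
    · intro h
      have hlast : ∀ i, Complex.arg (w i) = Complex.arg (w 0) := by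
        intro i
        induction i using Fin.induction with
        | zero => rfl
        | succ i ih =>
          rw [← ih]
          exact ((sameRay_iff_arg_eq (hw _) (hw _)).mp (h i (by omega)).1).symm
      exact ⟨fun i j => (hlast i).trans (hlast j).symm,
        Fin.strictAnti_iff_succ_lt.mpr fun i => (h i (by omega)).2⟩
    · rintro ⟨h1, h2⟩ i hi
      exact ⟨(sameRay_iff_arg_eq (hw _) (hw _)).mpr (h1 _ _), h2 (by simp [Fin.lt_def])⟩

/-- `F_n` is the average of the limiting values over all orderings of the phases. -/
theorem joyceF_eq_average {n : ℕ} (hn : 1 ≤ n) {z : Fin n → ℂ} (hz : ∀ i, z i ≠ 0) :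
    joyceF n z = (n.factorial : ℂ)⁻¹ *
      ∑ ρ : Equiv.Perm (Fin n), phaseLimit z z fun i => ((ρ i : ℕ) : ℝ) := by
  classical
  have h1 : ∀ ρ : Equiv.Perm (Fin n), phaseLimit z z (fun i => ((ρ i : ℕ) : ℝ)) =
      ∑ c : Composition n,
        phaseLimit (fun k => ∑ j, z (c.embedding k j)) (fun k => ∑ j, z (c.embedding k j))
          (fun k => (k : ℝ)) *
        ∏ k, if (∀ i j, Complex.arg (z (c.embedding k i)) = Complex.arg (z (c.embedding k j))) ∧
          StrictAnti (fun j => ρ (c.embedding k j)) then (1 : ℂ) else 0 := by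
    intro ρ
    have h2 := listPhaseLimit_eq_sum (L := List.ofFn fun i => (z i, z i, ((ρ i : ℕ) : ℝ)))
      (by rw [Ne, List.ofFn_eq_nil_iff]; omega)
      (fun p hp => by
        obtain ⟨i, rfl⟩ := (List.mem_ofFn' _ _).mp hp
        simp [hz i])
      (by
        rw [List.isChain_ofFn]
        intro i hi _ he
        have := ρ.injective (Fin.ext (Nat.cast_injective he))
        simp [Fin.ext_iff] at this)
    rw [listPhaseLimit_ofFn, sum_segmentations_eq_sum_composition (List.length_ofFn)] at h2
    refine h2.trans (Finset.sum_congr rfl fun c _ => ?_)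
    rw [splitWrtComposition_ofFn, List.map_ofFn, List.map_ofFn, List.prod_ofFn]
    congr 1
    · have : (fun s : List (ℂ × ℂ × ℝ) => (s.map forgetPhase).sum) ∘ (fun k => List.ofFn fun j =>
          (z (c.embedding k j), z (c.embedding k j), ((ρ (c.embedding k j) : ℕ) : ℝ))) =
          fun k => (∑ j, z (c.embedding k j), ∑ j, z (c.embedding k j)) := by
        funext k
        simp only [Function.comp_def, List.map_ofFn, List.sum_ofFn, forgetPhase, sum_pair]
      rw [this, ascendingLimit_ofFn]
    · refine Finset.prod_congr rfl fun k _ => ?_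
      rw [Function.comp_apply, descWeight_ofFn fun i => hz _]
      refine if_congr (and_congr_right fun _ => ?_) rfl rfl
      simp [StrictAnti]
  simp only [h1]
  rw [Finset.sum_comm, Finset.mul_sum, joyceF, joyceG_eq]
  refine Finset.sum_congr rfl fun c _ => ?_
  rw [← Finset.mul_sum, mul_left_comm]
  congr 1
  have hfac : (n.factorial : ℂ) ≠ 0 := by exact_mod_cast n.factorial_ne_zero
  by_cases hc : ∀ k, ∀ i j, Complex.arg (z (c.embedding k i)) = Complex.arg (z (c.embedding k j))
  -- On collinear blocks the proportion of orders that descend on every block is ∏ 1/|block|!, which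
  -- is the exponential weight.
  · have h3 : ∀ k, expMould (List.ofFn fun j => (z (c.embedding k j), z (c.embedding k j))) =
        ((c.blocksFun k).factorial : ℂ)⁻¹ := fun k => expMould_ofFn_of_collinear (hc k)
    simp only [h3, Finset.prod_inv_distrib]
    have h4 := sum_perm_strictAnti_mul_factorial c
    have h5 : ∏ k, ((c.blocksFun k).factorial : ℂ) ≠ 0 := Finset.prod_ne_zero_iff.mpr
      fun k _ => by exact_mod_cast (c.blocksFun k).factorial_ne_zero
    rw [eq_inv_mul_iff_mul_eq₀ hfac, ← h4, mul_assoc, mul_inv_cancel₀ h5, mul_one]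
    refine Finset.sum_congr rfl fun ρ _ => Finset.prod_congr rfl fun k _ => ?_
    exact if_congr (and_iff_right (hc k)).symm rfl rfl
  · push Not at hc
    obtain ⟨k, i, j, hij⟩ := hc
    rw [Finset.prod_eq_zero (Finset.mem_univ k) (if_neg fun h => hij (collinearSnd_ofFn.mp h i j))]
    symm
    refine mul_eq_zero_of_right _ (Finset.sum_eq_zero fun ρ _ => ?_)
    exact Finset.prod_eq_zero (Finset.mem_univ k) (if_neg fun h => hij (h.1 i j))

/-- The symmetrised sums of the `F_n` as averages of symmetrised sums of chain values. -/
theorem exists_sum_joyceF_smul_eq {M : Type*} [AddCommGroup M] [Module ℂ M] {n : ℕ} (hn : 1 ≤ n)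
    {z : Fin n → ℂ} (hz : ∀ i, z i ≠ 0) (y : Equiv.Perm (Fin n) → M) :
    ∃ a : Equiv.Perm (Fin n) → Fin n → ℂ,
      (∀ ρ σ : Equiv.Perm (Fin n), a ρ ∘ σ ∈ admissibleSlopes (z ∘ σ)) ∧
      ∑ σ : Equiv.Perm (Fin n), joyceF n (z ∘ σ) • y σ = (n.factorial : ℂ)⁻¹ •
        ∑ ρ : Equiv.Perm (Fin n), ∑ σ : Equiv.Perm (Fin n),
          chainValue (z ∘ σ) (a ρ ∘ σ) • y σ := by
  have h1 : ∀ᶠ ε in 𝓝[>] (0 : ℝ), ∀ ρ σ : Equiv.Perm (Fin n),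
      (phaseSlopes (z ∘ σ) fun i => ε * (((ρ * σ) i : ℕ) : ℝ)) ∈ admissibleSlopes (z ∘ σ) ∧
      chainValue (z ∘ σ) (phaseSlopes (z ∘ σ) fun i => ε * (((ρ * σ) i : ℕ) : ℝ)) =
        phaseLimit (z ∘ σ) (z ∘ σ) fun i => (((ρ * σ) i : ℕ) : ℝ) := by
    refine eventually_all.mpr fun ρ => eventually_all.mpr fun σ => ?_
    refine eventually_chainValue_eq_phaseLimit (fun i => by simp [hz]) fun k hk _ he => ?_
    have := (ρ * σ).injective (Fin.ext (Nat.cast_injective he))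
    simp [Fin.ext_iff] at this
  obtain ⟨ε, hε⟩ := h1.exists
  have h2 : ∀ ρ σ : Equiv.Perm (Fin n),
      (phaseSlopes z fun i => ε * ((ρ i : ℕ) : ℝ)) ∘ σ =
        phaseSlopes (z ∘ σ) fun i => ε * (((ρ * σ) i : ℕ) : ℝ) := fun ρ σ => rfl
  -- The phases are attached to indices and not to positions, so permuting the tuple permutes the
  -- contours along with it. A single `ε` serves the finitely many permutations.
  refine ⟨fun ρ => phaseSlopes z fun i => ε * ((ρ i : ℕ) : ℝ), fun ρ σ => ?_, ?_⟩
  · rw [h2]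
    exact (hε ρ σ).1
  · rw [Finset.sum_comm, Finset.smul_sum]
    refine Finset.sum_congr rfl fun σ _ => ?_
    rw [joyceF_eq_average (z := z ∘ σ) hn fun i => hz _, ← Finset.sum_smul, smul_smul]
    congr 2
    -- The average over all orders is invariant under right translation by `σ`.
    rw [← Equiv.sum_comp (Equiv.mulRight σ)]
    exact Finset.sum_congr rfl fun ρ _ => by rw [h2]; exact (hε ρ σ).2.symm

end PhaseAverage

/-! ### `joyceF` on the slit domain: existence of the family -/

section SlitDomain
open Set Filter Topology

theorem sameRay_iff_div_eq {a b : ℂ} (ha : a ≠ 0) (hb : b ≠ 0) :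
    SameRay ℝ a b ↔ ∃ r : ℝ, 0 < r ∧ b / a = r := by
  constructor
  · intro h
    obtain ⟨r, hr, rfl⟩ := h.exists_pos_left ha hb
    exact ⟨r, hr, by rw [Complex.real_smul, mul_div_assoc, div_self ha, mul_one]⟩
  · rintro ⟨r, hr, h⟩
    rw [div_eq_iff ha, ← Complex.real_smul] at h
    rw [h]
    exact SameRay.sameRay_pos_smul_right a hr

theorem mem_slitDomain_iff {n : ℕ} {z : Fin n → ℂ} :
    z ∈ slitDomain n ↔ (∀ i, z i ≠ 0) ∧ ChainGeneric z := by
  refine and_congr_right fun h0 => forall_congr' fun k => forall_congr' fun hk => ?_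
  rw [sameRay_iff_div_eq (h0 _) (h0 _)]

theorem isOpen_slitDomain (n : ℕ) : IsOpen (slitDomain n) := by
  rw [isOpen_iff_mem_nhds]
  intro z hz
  obtain ⟨h0, hg⟩ := mem_slitDomain_iff.mp hz
  have h1 : ∀ᶠ y in 𝓝 z, ∀ i, y i ≠ 0 := by
    refine eventually_all.mpr fun i => ?_
    exact ((continuous_apply i).continuousAt (x := z)).eventually_ne (h0 i)
  have h2 : ∀ᶠ y in 𝓝 z, ∀ k : Fin n, ∀ hk : (k : ℕ) + 1 < n,
      -y ⟨k + 1, hk⟩ / y k ∈ Complex.slitPlane := by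
    refine eventually_all.mpr fun k => ?_
    by_cases hk : (k : ℕ) + 1 < n
    · have hc : ContinuousAt (fun y : Fin n → ℂ => -y ⟨k + 1, hk⟩ / y k) z :=
        ContinuousAt.div (continuous_apply _).neg.continuousAt (continuous_apply _).continuousAt
          (h0 k)
      have := (not_sameRay_iff_neg_div_mem_slitPlane (h0 _) (h0 _)).mp (hg k hk)
      filter_upwards [hc.eventually (Complex.isOpen_slitPlane.mem_nhds this)] with y hy _ using hy
    · exact Eventually.of_forall fun _ h => absurd h hk
  filter_upwards [h1, h2] with y e1 e2
  exact mem_slitDomain_iff.mpr ⟨e1, fun k hk =>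
    (not_sameRay_iff_neg_div_mem_slitPlane (e1 _) (e1 _)).mpr (e2 ⟨k, by omega⟩ hk)⟩

theorem tupleSlice_zero_mem_slitDomain {n : ℕ} {z : Fin n → ℂ} (hz : z ∈ slitDomain n) {k : ℕ}
    (hk : k ≤ n) : tupleSlice z 0 k ∈ slitDomain k := by
  obtain ⟨q, rfl⟩ := Nat.exists_eq_add_of_le hk
  rw [tupleSlice_castAdd]
  exact ⟨fun i => hz.1 _, fun i hi => hz.2 i (by omega)⟩

theorem tupleSlice_mem_slitDomain {n : ℕ} {z : Fin n → ℂ} (hz : z ∈ slitDomain n) {k : ℕ}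
    (hk : k ≤ n) : tupleSlice z k (n - k) ∈ slitDomain (n - k) := by
  obtain ⟨q, rfl⟩ := Nat.exists_eq_add_of_le hk
  rw [Nat.add_sub_cancel_left, tupleSlice_natAdd]
  exact ⟨fun i => hz.1 _, fun i hi => hz.2 (k + i) (by omega)⟩

theorem tupleSlice_inv {n : ℕ} (z : Fin n → ℂ) (a m : ℕ) :
    tupleSlice (fun i => (z i)⁻¹) a m = fun i => (tupleSlice z a m i)⁻¹ := by
  ext i
  simp only [tupleSlice]
  split <;> simp

/-- No consecutive entries share a ray, so all orders of the phases give the same value and the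
average is trivial. -/
theorem joyceF_eq_phaseLimit {n : ℕ} (hn : 1 ≤ n) {z : Fin n → ℂ} (hz : z ∈ slitDomain n)
    (t : Fin n → ℝ) : joyceF n z = phaseLimit z z t := by
  obtain ⟨h0, hg⟩ := mem_slitDomain_iff.mp hz
  have h1 : ∀ ρ : Equiv.Perm (Fin n),
      phaseLimit z z (fun i => ((ρ i : ℕ) : ℝ)) = phaseLimit z z t := fun ρ =>
    phaseLimit_congr (fun i => by simp [h0]) fun k hk h => absurd h (hg k hk)
  have hfac : (n.factorial : ℂ) ≠ 0 := by exact_mod_cast n.factorial_ne_zero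
  rw [joyceF_eq_average hn h0]
  simp only [h1, Finset.sum_const, Finset.card_univ, Fintype.card_perm, Fintype.card_fin,
    nsmul_eq_mul]
  rw [inv_mul_cancel_left₀ hfac]

/-- Near a point `w` of the slit domain, `F_n` is the chain value for the fixed slopes `1 / w`. -/
theorem eventually_joyceF_eq_chainValue {n : ℕ} (hn : 1 ≤ n) {w : Fin n → ℂ}
    (hw : w ∈ slitDomain n) :
    ∀ᶠ z in 𝓝 w, (fun i => (w i)⁻¹) ∈ admissibleSlopes z ∧
      joyceF n z = chainValue z fun i => (w i)⁻¹ := by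
  obtain ⟨h0, hg⟩ := mem_slitDomain_iff.mp hw
  obtain ⟨δ, hδ⟩ := exists_isPhaseRadius h0
  have hcont : ∀ i, ContinuousAt (fun z : Fin n → ℂ => z i / w i) w := fun i =>
    ((continuous_apply i).div_const _).continuousAt
  have h1 : ∀ᶠ z in 𝓝 w, ∀ i, 0 < (z i / w i).re := by
    refine eventually_all.mpr fun i => ?_
    exact (Complex.continuous_re.continuousAt.comp (hcont i)).eventually_const_lt (by simp [h0])
  have h2 : ∀ᶠ z in 𝓝 w, ∀ i, |Complex.arg (z i / w i)| < δ := by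
    refine eventually_all.mpr fun i => ?_
    have h4 : ContinuousAt Complex.arg (w i / w i) :=
      Complex.continuousAt_arg (by simp [h0])
    have h5 : ContinuousAt (fun z : Fin n → ℂ => Complex.arg (z i / w i)) w :=
      ContinuousAt.comp' (f := fun z : Fin n → ℂ => z i / w i) h4 (hcont i)
    exact h5.abs.eventually_lt_const (by simpa [h0] using hδ.1)
  filter_upwards [h1, h2, (isOpen_slitDomain n).mem_nhds hw] with z e1 e2 e3
  have hslope : (phaseSlopes w fun _ => 0) = fun i => (w i)⁻¹ := by
    ext i
    simp [phaseSlopes]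
  -- The ordering condition of a chamber is vacuous here, so zero phases belong to every chamber.
  have hmem : ∀ t : Fin n → ℝ, (fun _ => 0) ∈ phaseChamber z w δ t := fun t =>
    ⟨fun _ => by simpa using hδ.1, fun i => by
      simpa using abs_arg_lt_of_re_pos (e1 i), fun k hk h => absurd h (hg k hk)⟩
  refine ⟨?_, ?_⟩
  · rw [← hslope]
    exact phaseSlopes_mem_of_mem_phaseChamber hδ e1 (hmem fun _ => 0)
  · obtain ⟨η, hη⟩ := (eventually_phaseLimit_self_eq (t := fun i => (i : ℝ)) hδ e1 e2
      fun k hk => by simp).exists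
    rw [joyceF_eq_phaseLimit hn e3, hη, ← hslope]
    exact (chainValue_eq_phaseLimit hδ e1 (fun k hk h => absurd h (hg k hk)) (hmem _)).symm

theorem joyceF_eq_chainValue_self {n : ℕ} (hn : 1 ≤ n) {w : Fin n → ℂ} (hw : w ∈ slitDomain n) :
    joyceF n w = chainValue w fun i => (w i)⁻¹ :=
  (eventually_joyceF_eq_chainValue hn hw).self_of_nhds.2

theorem differentiableOn_joyceF {n : ℕ} (hn : 1 ≤ n) :
    DifferentiableOn ℂ (joyceF n) (slitDomain n) := by
  intro w hw
  have h := eventually_joyceF_eq_chainValue hn hw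
  have hadm := h.self_of_nhds.1
  refine DifferentiableAt.differentiableWithinAt ?_
  refine DifferentiableAt.congr_of_eventuallyEq ?_ (h.mono fun z hz => hz.2)
  have := (hasFDerivAt_chainIntegral hn hadm.2 hadm.1).2.differentiableAt
  unfold chainValue
  fun_prop

/-- With the slopes frozen at 1/w the function is locally a chain value. The partial sums contained
in the lower values turn the polynomial form of the derivative into the one with denominators. -/
theorem satisfiesPDE_joyceF {n : ℕ} (hn : 1 ≤ n) : SatisfiesPDE joyceF n := by
  intro w hw hden v
  have h := eventually_joyceF_eq_chainValue hn hw
  have hadm := h.self_of_nhds.1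
  have hd : DifferentiableAt ℂ (fun z => (∑ i, z i) * chainIntegral z fun i => (w i)⁻¹) w := by
    have := (hasFDerivAt_chainIntegral hn hadm.2 hadm.1).2.differentiableAt
    fun_prop
  have h1 : fderiv ℂ (joyceF n) w = ((2 * (Real.pi : ℂ) * Complex.I)⁻¹) ^ n •
      fderiv ℂ (fun z => (∑ i, z i) * chainIntegral z fun i => (w i)⁻¹) w := by
    rw [(EventuallyEq.fderiv_eq (h.mono fun z hz => hz.2))]
    exact fderiv_const_mul hd _
  rw [h1, smul_apply, sum_mul_chainIntegral_deriv hn hadm.2 hadm.1,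
    smul_eq_mul, Finset.mul_sum]
  refine Finset.sum_congr rfl fun k hk => ?_
  obtain ⟨hk1, hkn⟩ := Finset.mem_Ico.mp hk
  obtain ⟨d1, d2⟩ := hden k hk
  rw [joyceF_eq_chainValue_self hk1 (tupleSlice_zero_mem_slitDomain hw hkn.le),
    joyceF_eq_chainValue_self (by omega) (tupleSlice_mem_slitDomain hw hkn.le), chainValue,
    chainValue, tupleSlice_inv, tupleSlice_inv]
  rw [← pow_mul_pow_sub (2 * (Real.pi : ℂ) * Complex.I)⁻¹ hkn.le]
  generalize (2 * (Real.pi : ℂ) * Complex.I)⁻¹ = C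
  field_simp

theorem joyceF_one {z : Fin 1 → ℂ} (hz : z 0 ≠ 0) :
    joyceF 1 z = (2 * (Real.pi : ℂ) * Complex.I)⁻¹ := by
  have hmem : z ∈ slitDomain 1 := ⟨fun k => by rwa [Subsingleton.elim k 0], fun k hk => by omega⟩
  rw [joyceF_eq_chainValue_self le_rfl hmem, chainValue, chainIntegral_one (by simp [hz])]
  simp [hz]

theorem joyceF_eq_zero {n : ℕ} (hn : 1 ≤ n) {z : Fin n → ℂ} (hz : z ∈ slitDomain n)
    (h : ∑ i, z i = 0) : joyceF n z = 0 := by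
  rw [joyceF_eq_chainValue_self hn hz, chainValue, h, zero_mul, mul_zero]

theorem isJoyceFamily_joyceF : IsJoyceFamily joyceF where
  one _ := joyceF_one
  holomorphic _ := differentiableOn_joyceF
  pde _ := satisfiesPDE_joyceF
  vanishing _ hn _ := joyceF_eq_zero (by omega)
  wallCrossing := wallCrossing_joyceF

end SlitDomain

/-! ### Symmetrised chain kernels are Lie polynomials -/

section LiePolynomials
open MeasureTheory Set Filter Topology

variable {ι : Type*} {H : Type*} [Ring H] [Algebra ℂ H]

/-- The derivation replacing one factor `x i` by `(u_i - u_b)⁻¹ [x_i, x_b]`, applied to a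
product. -/
noncomputable def kernelDerivation (u : ι → ℂ) (x : ι → H) (b : ι) : List ι → H
  | [] => 0
  | d :: s => (u d - u b)⁻¹ • ((x d * x b - x b * x d) * (s.map x).prod) +
      x d * kernelDerivation u x b s

/-- The letter `b` is inserted at every place after a fixed first letter `c`. Partial fractions
collect the insertions into commutators, except for one boundary term next to `c`, which the
induction carries along. -/
theorem sum_cons_permutations'Aux (u : ι → ℂ) (x : ι → H) (b : ι) : ∀ (s : List ι) (c : ι),
    u c ≠ u b → (∀ d ∈ s, u d ≠ u b) → (c :: s).Nodup → (∀ p ∈ c :: s, ∀ q ∈ c :: s, u p = u q → p = q) →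
    ((s.permutations'Aux b).map fun r =>
      chainKernelList ((c :: r).map u) • (r.map x).prod).sum =
    chainKernelList ((c :: s).map u) •
      ((u c - u b)⁻¹ • (x b * (s.map x).prod) + kernelDerivation u x b s)
  | [], c, hc, _, _, _ => by simp [chainKernelList, kernelDerivation]
  | d :: s, c, hc, hs, hnd, hinj => by
    have hdb := hs d (by simp)
    have ih := sum_cons_permutations'Aux u x b s d hdb (fun e he => hs e (by simp [he]))
      hnd.of_cons (fun p hp q hq => hinj p (by simp [hp]) q (by simp [hq]))
    have hcd : u c - u d ≠ 0 := sub_ne_zero.mpr fun h => by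
      have := hinj c (by simp) d (by simp) h
      simp [this] at hnd
    have h1 : ∀ r : List ι, chainKernelList ((c :: d :: r).map u) • ((d :: r).map x).prod =
        (u c - u d)⁻¹ • (x d * (chainKernelList ((d :: r).map u) • (r.map x).prod)) := fun r => by
      simp only [List.map_cons, chainKernelList, List.prod_cons, mul_smul_comm, smul_smul]
    rw [List.permutations'Aux, List.map_cons, List.sum_cons, List.map_map]
    simp only [Function.comp_def, h1]
    have h2 : (List.map (fun r => (u c - u d)⁻¹ •
        (x d * (chainKernelList ((d :: r).map u) • (r.map x).prod))) (s.permutations'Aux b)).sum =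
        (u c - u d)⁻¹ • (x d * (List.map (fun r => chainKernelList ((d :: r).map u) •
          (r.map x).prod) (s.permutations'Aux b)).sum) := by
      rw [← List.sum_map_mul_left, List.smul_sum, List.map_map]
      rfl
    rw [h2, ih]
    generalize hP : (s.map x).prod = P
    generalize hD : kernelDerivation u x b s = D
    have e0 : ((b :: d :: s).map x).prod = x b * (x d * P) := by
      rw [List.map_cons, List.prod_cons, List.map_cons, List.prod_cons, hP]
    have e1 : ((d :: s).map x).prod = x d * P := by rw [List.map_cons, List.prod_cons, hP]
    have e2 : chainKernelList ((c :: b :: d :: s).map u) =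
        (u c - u b)⁻¹ * ((u b - u d)⁻¹ * chainKernelList ((d :: s).map u)) := rfl
    have e3 : chainKernelList ((c :: d :: s).map u) =
        (u c - u d)⁻¹ * chainKernelList ((d :: s).map u) := rfl
    rw [e0, e1, e2, e3, kernelDerivation, hP, hD]
    generalize chainKernelList ((d :: s).map u) = k
    -- The first summand is the new boundary term; the second combines with the boundary term after
    -- `d` to the commutator of x_d and x_b.
    have f1 : (u c - u b)⁻¹ * (u b - u d)⁻¹ =
        (u c - u d)⁻¹ * (u c - u b)⁻¹ - (u c - u d)⁻¹ * (u d - u b)⁻¹ := by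
      have h3 : u c - u b ≠ 0 := sub_ne_zero.mpr hc
      have h4 : u d - u b ≠ 0 := sub_ne_zero.mpr hdb
      have h5 : u b - u d ≠ 0 := sub_ne_zero.mpr hdb.symm
      field_simp
      ring
    rw [← mul_assoc, f1]
    simp only [sub_mul, smul_sub, smul_add, mul_add, mul_smul_comm, smul_smul, mul_assoc, sub_smul]
    module

/-- The insertion in front of the first letter completes the remaining boundary term to a
commutator. -/
theorem sum_permutations'Aux {u : ι → ℂ} (x : ι → H) {b : ι} {s : List ι} (hs : s ≠ [])
    (hub : ∀ d ∈ s, u d ≠ u b) (hnd : s.Nodup) (hinj : ∀ p ∈ s, ∀ q ∈ s, u p = u q → p = q) :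
    ((s.permutations'Aux b).map fun r => chainKernelList (r.map u) • (r.map x).prod).sum =
      chainKernelList (s.map u) • kernelDerivation u x b s := by
  obtain ⟨d, s, rfl⟩ := List.exists_cons_of_ne_nil hs
  have hdb := hub d (by simp)
  have ih := sum_cons_permutations'Aux u x b s d hdb (fun e he => hub e (by simp [he])) hnd hinj
  have h1 : ∀ r : List ι, chainKernelList ((d :: r).map u) • ((d :: r).map x).prod =
      x d * (chainKernelList ((d :: r).map u) • (r.map x).prod) := fun r => by
    rw [List.map_cons (f := x), List.prod_cons, mul_smul_comm]
  rw [List.permutations'Aux, List.map_cons, List.sum_cons, List.map_map]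
  simp only [Function.comp_def, h1]
  rw [List.sum_map_mul_left, ih]
  have e2 : chainKernelList ((b :: d :: s).map u) =
      (u b - u d)⁻¹ * chainKernelList ((d :: s).map u) := rfl
  rw [e2, kernelDerivation, List.map_cons (f := x), List.prod_cons, List.map_cons (f := x),
    List.prod_cons]
  generalize chainKernelList ((d :: s).map u) = k
  have f1 : (u b - u d)⁻¹ = -(u d - u b)⁻¹ := by rw [← neg_sub, inv_neg]
  rw [f1]
  simp only [sub_mul, smul_sub, smul_add, mul_add, mul_smul_comm, smul_smul, mul_assoc]
  module

theorem kernelDerivation_eq_sum [DecidableEq ι] (u : ι → ℂ) (x : ι → H) (b : ι) {s : List ι} (hs : s.Nodup) :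
    kernelDerivation u x b s = (s.map fun i => (u i - u b)⁻¹ •
      (s.map (Function.update x i (x i * x b - x b * x i))).prod).sum := by
  induction s with
  | nil => simp [kernelDerivation]
  | cons d s ih =>
    obtain ⟨hd, hs'⟩ := List.nodup_cons.mp hs
    rw [kernelDerivation, ih hs', List.map_cons, List.sum_cons, List.map_cons, List.prod_cons,
      Function.update_self, ← List.sum_map_mul_left]
    congr 1
    · refine congrArg (fun r : List H => (u d - u b)⁻¹ • ((x d * x b - x b * x d) * r.prod))
        (List.map_congr_left fun e he => ?_)
      rw [Function.update_of_ne]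
      rintro rfl
      exact hd he
    · refine congrArg List.sum (List.map_congr_left fun i hi => ?_)
      rw [List.map_cons, List.prod_cons, mul_smul_comm, Function.update_of_ne]
      rintro rfl
      exact hd hi

/-- The symmetrised product `∑ K(u_σ) x_σ` over the rearrangements of a list. -/
noncomputable def kernelProduct (u : ι → ℂ) (x : ι → H) (l : List ι) : H :=
  (l.permutations'.map fun s => chainKernelList (s.map u) • (s.map x).prod).sum

/-- Every rearrangement arises by inserting `b` into a rearrangement of `l`. The coefficient of the
commutator of x_i and x_b does not depend on that rearrangement, so the sum over rearrangements can
be carried out for each `i`. -/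
theorem kernelProduct_cons [DecidableEq ι] {u : ι → ℂ} (x : ι → H) {b : ι} {l : List ι} (hl : l ≠ [])
    (hnd : (b :: l).Nodup) (hinj : ∀ p ∈ b :: l, ∀ q ∈ b :: l, u p = u q → p = q) :
    kernelProduct u x (b :: l) = (l.map fun i => (u i - u b)⁻¹ •
      kernelProduct u (Function.update x i (x i * x b - x b * x i)) l).sum := by
  obtain ⟨hb, hl'⟩ := List.nodup_cons.mp hnd
  rw [kernelProduct, List.permutations', List.map_flatMap, List.flatMap, List.sum_flatten,
    List.map_map]
  have h1 : ∀ s ∈ l.permutations', (List.sum ∘ fun s => (s.permutations'Aux b).map fun r =>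
      chainKernelList (r.map u) • (r.map x).prod) s =
      (l.map fun i => (u i - u b)⁻¹ • (chainKernelList (s.map u) •
        (s.map (Function.update x i (x i * x b - x b * x i))).prod)).sum := by
    intro s hs
    have hp : s.Perm l := List.mem_permutations'.mp hs
    have hne : s ≠ [] := fun h => hl (by rw [h] at hp; exact hp.nil_eq.symm)
    have hsnd := hp.nodup_iff.mpr hl'
    rw [Function.comp_apply, sum_permutations'Aux x hne (fun d hd h => hb ?_) hsnd
      (fun p hp' q hq => hinj p (by simp [hp.mem_iff.mp hp']) q (by simp [hp.mem_iff.mp hq])),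
      kernelDerivation_eq_sum u x b hsnd, List.smul_sum, List.map_map,
      ← (hp.map fun i => (u i - u b)⁻¹ • (chainKernelList (s.map u) •
        (s.map (Function.update x i (x i * x b - x b * x i))).prod)).sum_eq]
    · refine congrArg _ (List.map_congr_left fun i _ => ?_)
      rw [Function.comp_apply, smul_comm]
    · have := hinj d (by simp [hp.mem_iff.mp hd]) b (by simp) h
      rw [← this]
      exact hp.mem_iff.mp hd
  rw [List.map_congr_left h1]
  have h2 := Multiset.sum_map_sum_map (l.permutations' : Multiset (List ι)) (l : Multiset ι)
    (f := fun s i => (u i - u b)⁻¹ • (chainKernelList (s.map u) •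
        (s.map (Function.update x i (x i * x b - x b * x i))).prod))
  simp only [Multiset.map_coe, Multiset.sum_coe] at h2
  rw [h2]
  refine congrArg _ (List.map_congr_left fun i _ => ?_)
  rw [kernelProduct, List.smul_sum, List.map_map]
  rfl

variable {K : Type*} [AddCommMonoid K]

/-- A family of submodules, indexed by a semigroup, that is closed under commutators. -/
structure IsCommutatorClosed (C : Set K) (V : K → Submodule ℂ H) : Prop where
  add_mem : ∀ α ∈ C, ∀ β ∈ C, α + β ∈ C
  commutator_mem : ∀ α ∈ C, ∀ β ∈ C, ∀ x ∈ V α, ∀ y ∈ V β, x * y - y * x ∈ V (α + β)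

/-- Induction on the length: a letter disappears into a commutator, and its degree is added to that
of its partner, so the total degree is kept. The points `u` are not changed. -/
theorem kernelProduct_mem [DecidableEq ι] {C : Set K} {V : K → Submodule ℂ H} (hV : IsCommutatorClosed C V)
    (u : ι → ℂ) : ∀ (l : List ι) (_ : l ≠ []) (_ : l.Nodup)
    (_ : ∀ p ∈ l, ∀ q ∈ l, u p = u q → p = q) (x : ι → H) (β : ι → K) (_ : ∀ i, β i ∈ C)
    (_ : ∀ i, x i ∈ V (β i)), kernelProduct u x l ∈ V (l.map β).sum
  | [], h, _, _, _, _, _, _ => absurd rfl h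
  | [a], _, _, _, x, β, _, hx => by simpa [kernelProduct, chainKernelList] using hx a
  | b :: a :: l, _, hnd, hinj, x, β, hβ, hx => by
    rw [kernelProduct_cons x (by simp) hnd hinj]
    refine list_sum_mem fun y hy => ?_
    obtain ⟨i, hi, rfl⟩ := List.mem_map.mp hy
    refine Submodule.smul_mem _ _ ?_
    have := kernelProduct_mem hV u (a :: l) (by simp) hnd.of_cons
      (fun p hp q hq => hinj p (List.mem_cons_of_mem _ hp) q (List.mem_cons_of_mem _ hq))
      (Function.update x i (x i * x b - x b * x i)) (Function.update β i (β i + β b))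
      (fun j => ?_) (fun j => ?_)
    · have hsum : ((a :: l).map (Function.update β i (β i + β b))).sum =
          ((b :: a :: l).map β).sum := by
        rw [List.map_cons (f := β) (a := b), List.sum_cons,
          ((List.perm_cons_erase hi).map (Function.update β i (β i + β b))).sum_eq,
          ((List.perm_cons_erase hi).map β).sum_eq, List.map_cons, List.map_cons, List.sum_cons,
          List.sum_cons, Function.update_self]
        have : List.map (Function.update β i (β i + β b)) ((a :: l).erase i) =
            List.map β ((a :: l).erase i) := List.map_congr_left fun j hj => by
          rw [Function.update_of_ne]
          rintro rfl
          exact hnd.of_cons.not_mem_erase hj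
        rw [this]
        abel
      rwa [hsum] at this
    · rcases eq_or_ne j i with rfl | h
      · rw [Function.update_self]
        exact hV.add_mem _ (hβ _) _ (hβ _)
      · rw [Function.update_of_ne h]
        exact hβ j
    · rcases eq_or_ne j i with rfl | h
      · rw [Function.update_self, Function.update_self]
        exact hV.commutator_mem _ (hβ _) _ (hβ _) _ (hx _) _ (hx _)
      · rw [Function.update_of_ne h, Function.update_of_ne h]
        exact hx j

end LiePolynomials

/-! ### Symmetrised products of `joyceF` -/

section SymmetrizedProducts
open MeasureTheory Set Filter Topology

theorem sum_permutations'_finRange {M : Type*} [AddCommMonoid M] {n : ℕ} (f : List (Fin n) → M) :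
    ((List.finRange n).permutations'.map f).sum =
      ∑ σ : Equiv.Perm (Fin n), f (List.ofFn σ) := by
  classical
  have hnd : (List.finRange n).permutations'.Nodup :=
    (List.permutations_perm_permutations' _).nodup_iff.mp
      (List.nodup_permutations _ (List.nodup_finRange n))
  rw [← List.sum_toFinset f hnd]
  symm
  refine Finset.sum_bij (fun σ _ => List.ofFn σ) (fun σ _ => ?_) (fun σ _ τ _ h => ?_)
    (fun s hs => ?_) (fun _ _ => rfl)
  · rw [List.mem_toFinset, List.mem_permutations', List.finRange]
    exact Equiv.Perm.ofFn_comp_perm σ id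
  · exact Equiv.ext fun i => congrFun (List.ofFn_injective h) i
  · rw [List.mem_toFinset, List.mem_permutations'] at hs
    obtain ⟨m, g, rfl⟩ := exists_eq_ofFn s
    obtain rfl : m = n := by simpa using hs.length_eq
    have hg : Function.Injective g := List.nodup_ofFn.mp (hs.nodup_iff.mpr (List.nodup_finRange _))
    exact ⟨Equiv.ofBijective g (Finite.injective_iff_bijective.mp hg), Finset.mem_univ _, rfl⟩

variable {H : Type*} [Ring H] [Algebra ℂ H]

theorem kernelProduct_finRange {n : ℕ} (u : Fin n → ℂ) (x : Fin n → H) :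
    kernelProduct u x (List.finRange n) =
      ∑ σ : Equiv.Perm (Fin n), chainKernel (u ∘ σ) • (List.ofFn fun i => x (σ i)).prod := by
  rw [kernelProduct, sum_permutations'_finRange]
  refine Finset.sum_congr rfl fun σ _ => ?_
  rw [chainKernel_eq_chainKernelList, List.map_ofFn, List.map_ofFn]
  rfl

/-- Integrating a linear combination whose values lie in a subspace. -/
theorem sum_integral_smul_mem {Ω ι M : Type*} [MeasurableSpace Ω] {μ : Measure Ω} [Fintype ι]
    [AddCommGroup M] [Module ℂ M] (W : Submodule ℂ M) {f : ι → Ω → ℂ} (y : ι → M)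
    (hf : ∀ i, Integrable (f i) μ) (h : ∀ᵐ ω ∂μ, ∑ i, f i ω • y i ∈ W) :
    ∑ i, (∫ ω, f i ω ∂μ) • y i ∈ W := by
  -- The space `M` carries no topology: membership is tested by linear functionals vanishing on `W`,
  -- which leaves scalar integrals.
  by_contra hn
  obtain ⟨φ, hφ, hW⟩ := Submodule.exists_le_ker_of_notMem hn
  apply hφ
  have h1 : ∀ c : ι → ℂ, φ (∑ i, c i • y i) = ∑ i, c i * φ (y i) := fun c => by
    simp only [map_sum, map_smul, smul_eq_mul]
  rw [h1]
  simp only [← integral_mul_const]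
  rw [← integral_finsetSum _ fun i _ => (hf i).mul_const _]
  refine integral_eq_zero_of_ae (h.mono fun ω hω => ?_)
  have h2 := hW hω
  rw [LinearMap.mem_ker, h1] at h2
  exact h2

theorem measurePreserving_comp_perm {n : ℕ} (σ : Equiv.Perm (Fin n)) :
    MeasurePreserving (MeasurableEquiv.arrowCongr' σ.symm (MeasurableEquiv.refl ℝ))
      (orthantMeasure n) (orthantMeasure n) :=
  measurePreserving_arrowCongr' (fun _ => volume.restrict (Ioi 0)) (fun _ => volume.restrict (Ioi 0))
    σ.symm (MeasurableEquiv.refl ℝ) fun _ => MeasurePreserving.id _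

theorem chainIntegrand_comp_perm {n : ℕ} (z a : Fin n → ℂ) (σ : Equiv.Perm (Fin n))
    (y : Fin n → ℝ) :
    chainIntegrand (z ∘ σ) (a ∘ σ) (MeasurableEquiv.arrowCongr' σ.symm (MeasurableEquiv.refl ℝ) y) =
      (Complex.exp (-∑ i, z i * (a i * y i)) * ∏ i, a i) *
        chainKernel ((fun i => a i * (y i : ℂ)) ∘ σ) := by
  have h : MeasurableEquiv.arrowCongr' σ.symm (MeasurableEquiv.refl ℝ) y = y ∘ σ := rfl
  rw [h, chainIntegrand]
  simp only [Function.comp_apply]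
  rw [Equiv.sum_comp σ fun i => z i * (a i * y i), Equiv.prod_comp σ a]
  simp only [Function.comp_def]
  ring

variable {K : Type*} [AddCommMonoid K] {C : Set K} {V : K → Submodule ℂ H}

/-- A change of variables brings all permuted integrals to the same product of rays with the same
exponential. Only the kernel still depends on the permutation, and its symmetrisation is
`kernelProduct`. -/
theorem sum_chainIntegral_smul_mem (hV : IsCommutatorClosed C V) {n : ℕ} (hn : 1 ≤ n)
    {z a : Fin n → ℂ} (ha : ∀ σ : Equiv.Perm (Fin n), a ∘ σ ∈ admissibleSlopes (z ∘ σ))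
    {x : Fin n → H} {β : Fin n → K} (hβ : ∀ i, β i ∈ C) (hx : ∀ i, x i ∈ V (β i)) :
    ∑ σ : Equiv.Perm (Fin n), chainIntegral (z ∘ σ) (a ∘ σ) •
      (List.ofFn fun i => x (σ i)).prod ∈ V (∑ i, β i) := by
  have h1 : ∀ σ : Equiv.Perm (Fin n), chainIntegral (z ∘ σ) (a ∘ σ) =
      ∫ y, (Complex.exp (-∑ i, z i * (a i * y i)) * ∏ i, a i) *
        chainKernel ((fun i => a i * (y i : ℂ)) ∘ σ) ∂(orthantMeasure n) := fun σ => by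
    simp only [← chainIntegrand_comp_perm]
    rw [(measurePreserving_comp_perm σ).integral_comp' (g := chainIntegrand (z ∘ σ) (a ∘ σ))]
    rfl
  simp only [h1]
  refine sum_integral_smul_mem _ _ (fun σ => ?_) ?_
  · simp only [← chainIntegrand_comp_perm]
    exact (measurePreserving_comp_perm σ).integrable_comp_of_integrable
      (integrable_chainIntegrand hn (ha σ).2 (ha σ).1)
  · have ha0 : ∀ i, a i ≠ 0 := ne_zero_of_mem_admissibleSlopes (ha 1)
    -- The algebraic identity needs all points distinct, not only neighbours; this holds off a null
    -- set.
    have hne : ∀ᵐ y ∂(orthantMeasure n), ∀ i j, i ≠ j → a i * (y i : ℂ) ≠ a j * y j := by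
      refine ae_all_iff.mpr fun i => ae_all_iff.mpr fun j => ?_
      by_cases hij : i = j
      · exact Eventually.of_forall fun _ h => absurd hij h
      · exact (ae_orthantMeasure_mul_ne hij (ha0 i) (a j)).mono fun y hy _ => hy
    refine hne.mono fun y hy => ?_
    have h2 : ∑ σ : Equiv.Perm (Fin n), ((Complex.exp (-∑ i, z i * (a i * y i)) * ∏ i, a i) *
        chainKernel ((fun i => a i * (y i : ℂ)) ∘ σ)) • (List.ofFn fun i => x (σ i)).prod =
        (Complex.exp (-∑ i, z i * (a i * y i)) * ∏ i, a i) •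
          kernelProduct (fun i => a i * (y i : ℂ)) x (List.finRange n) := by
      rw [kernelProduct_finRange, Finset.smul_sum]
      exact Finset.sum_congr rfl fun σ _ => mul_smul _ _ _
    rw [h2]
    refine Submodule.smul_mem _ _ ?_
    have h3 := kernelProduct_mem hV (fun i => a i * (y i : ℂ)) (List.finRange n)
      (by rw [Ne, List.finRange_eq_nil_iff]; omega) (List.nodup_finRange n)
      (fun i _ j _ h => by_contra fun hij => hy i j hij h) x β hβ hx
    rwa [← List.ofFn_eq_map, List.sum_ofFn] at h3

/-- The symmetrised products of the `F_n` lie in any graded family of subspaces closed under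
commutators. -/
theorem symmetrizedProduct_joyceF_mem (hV : IsCommutatorClosed C V) {n : ℕ} (hn : 1 ≤ n)
    {z : Fin n → ℂ} (hz : ∀ i, z i ≠ 0) {x : Fin n → H} {β : Fin n → K} (hβ : ∀ i, β i ∈ C)
    (hx : ∀ i, x i ∈ V (β i)) : symmetrizedProduct joyceF z x ∈ V (∑ i, β i) := by
  obtain ⟨a, ha, h⟩ := exists_sum_joyceF_smul_eq hn hz
    fun σ : Equiv.Perm (Fin n) => (List.ofFn fun i => x (σ i)).prod
  have h1 : symmetrizedProduct joyceF z x = ∑ σ : Equiv.Perm (Fin n), joyceF n (z ∘ σ) •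
      (List.ofFn fun i => x (σ i)).prod := rfl
  rw [h1, h]
  refine Submodule.smul_mem _ _ (Submodule.sum_mem _ fun ρ _ => ?_)
  -- The prefactor (2πi)^{-n} ∑ z_i is symmetric, hence common to all permutations.
  have h2 : ∀ σ : Equiv.Perm (Fin n), chainValue (z ∘ σ) (a ρ ∘ σ) •
      (List.ofFn fun i => x (σ i)).prod =
      (((2 * (Real.pi : ℂ) * Complex.I)⁻¹) ^ n * ∑ i, z i) •
        (chainIntegral (z ∘ σ) (a ρ ∘ σ) • (List.ofFn fun i => x (σ i)).prod) := fun σ => by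
    rw [chainValue, ← mul_assoc, mul_smul]
    simp only [Function.comp_apply]
    rw [Equiv.sum_comp σ z]
  simp only [h2, ← Finset.smul_sum]
  exact Submodule.smul_mem _ _ (sum_chainIntegral_smul_mem hV hn (ha ρ) hβ hx)

/-- Use the constant family equal to the generated Lie subalgebra; the grading plays no role. -/
theorem symmetrizedProduct_joyceF_mem_lieSpan {n : ℕ} (hn : 1 ≤ n) {z : Fin n → ℂ}
    (hz : ∀ i, z i ≠ 0) (x : Fin n → H) :
    symmetrizedProduct joyceF z x ∈ LieSubalgebra.lieSpan ℂ H (Set.range x) := by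
  have hV : IsCommutatorClosed (univ : Set ℕ) fun _ =>
      (LieSubalgebra.lieSpan ℂ H (Set.range x)).toSubmodule :=
    ⟨fun _ _ _ _ => mem_univ _, fun _ _ _ _ p hp q hq => by
      have := (LieSubalgebra.lieSpan ℂ H (Set.range x)).lie_mem hp hq
      rwa [LieRing.of_associative_ring_bracket] at this⟩
  exact symmetrizedProduct_joyceF_mem hV hn hz (β := fun _ => 0) (fun _ => mem_univ _)
    fun i => LieSubalgebra.subset_lieSpan ⟨i, rfl⟩

/-- Take the commutative algebra ℂ with everything in degree 1 and zero in other degrees. This is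
closed under commutators because they all vanish, and the symmetrised product has degree `n`. -/
theorem sum_perm_joyceF {n : ℕ} (hn : 2 ≤ n) {z : Fin n → ℂ} (hz : ∀ i, z i ≠ 0) :
    ∑ σ : Equiv.Perm (Fin n), joyceF n (fun i => z (σ i)) = 0 := by
  have hV : IsCommutatorClosed {k : ℕ | 1 ≤ k}
      fun k => if k = 1 then (⊤ : Submodule ℂ ℂ) else ⊥ :=
    ⟨fun α (hα : 1 ≤ α) β _ => hα.trans (Nat.le_add_right α β), fun α _ β _ p _ q _ => by
      rw [mul_comm, sub_self]
      exact zero_mem _⟩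
  have h := symmetrizedProduct_joyceF_mem hV (by omega) hz (x := fun _ => 1) (β := fun _ => 1)
    (fun _ => by simp) fun _ => by simp
  rw [Finset.sum_const, Finset.card_univ, Fintype.card_fin, smul_eq_mul, mul_one,
    if_neg (by omega), Submodule.mem_bot] at h
  simpa [symmetrizedProduct] using h

end SymmetrizedProducts

/-! ### The difference of two families is holomorphic -/

section WallCrossingDifference
open Set Filter Topology

theorem blockWeight_of_eq_one {r : ℕ} (hr : r = 1) (z w : Fin r → ℂ) : blockWeight z w = 1 := by
  subst hr
  have h : ∀ (ψ : Fin 1 → Fin 1) (ξ : Fin 1 → Fin 1), Monotone ψ ∧ Function.Surjective ψ ∧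
      Monotone ξ ∧ Function.Surjective ξ ∧
      (∀ a b, ψ a = ψ b → Complex.arg (z a / w a) = Complex.arg (z b / w b)) ∧
      (∀ a b, ψ a < ψ b → ξ (ψ a) = ξ (ψ b) →
        Complex.arg (z b / w b) < Complex.arg (z a / w a)) := fun ψ ξ =>
    ⟨Subsingleton.monotone ψ, Function.surjective_to_subsingleton ψ, Subsingleton.monotone ξ,
      Function.surjective_to_subsingleton ξ, fun a b _ => by rw [Subsingleton.elim a b],
      fun a b h => absurd (Subsingleton.elim _ _) h.ne⟩
  have hc : ∀ (ψ : Fin 1 → Fin 1) (c : Fin 1), (Finset.univ.filter fun a => ψ a = c).card = 1 := by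
    intro ψ c
    rw [Finset.filter_true_of_mem fun a _ => Subsingleton.elim _ _]
    simp
  simp only [blockWeight, Finset.Icc_self, Finset.sum_singleton]
  simp only [if_pos (h _ _), hc]
  simp

theorem blockSum_ones {n : ℕ} (z : Fin n → ℂ) (k : Fin (Composition.ones n).length) :
    blockSum (Composition.ones n) z k = z (Fin.cast (Composition.ones_length n) k) := by
  have h0 := Composition.ones_blocksFun n k
  rw [blockSum, Finset.sum_eq_single ⟨0, by omega⟩ (fun j _ hj => absurd (Fin.ext (by
    have := j.2
    change (j : ℕ) = 0
    omega)) hj) (fun h => absurd (Finset.mem_univ _) h), blockPart, Composition.ones_embedding]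
  rfl

theorem apply_fin_cast {β : Type*} (G : ∀ n : ℕ, (Fin n → ℂ) → (Fin n → ℂ) → β) {m n : ℕ}
    (h : m = n) (f g : Fin n → ℂ) :
    G m (fun i => f (Fin.cast h i)) (fun i => g (Fin.cast h i)) = G n f g := by
  subst h
  rfl

theorem rayBlocks_ones {n : ℕ} {w : Fin n → ℂ} (hw : ∀ i, w i ≠ 0) :
    RayBlocks (Composition.ones n) w := by
  rw [rayBlocks_iff _ hw]
  intro k i j
  have h0 := Composition.ones_blocksFun n k
  have : i = j := Fin.ext (by have := i.2; have := j.2; omega)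
  rw [this]

theorem blockSum_ne_zero {n : ℕ} {c : Composition n} {w : Fin n → ℂ} (hw : ∀ i, w i ≠ 0)
    (hc : RayBlocks c w) (k : Fin c.length) : blockSum c w k ≠ 0 :=
  (re_sum_div_sum_pos (c.one_le_blocksFun k) (κ := 1) (z := blockPart c w k)
    (fun i => by simp [blockPart, hw]) ((rayBlocks_iff c hw).mp hc k)).1

theorem continuous_blockSum {n : ℕ} (c : Composition n) : Continuous (blockSum c) := by
  unfold blockSum blockPart
  fun_prop

open Classical in
/-- The expression of `F_n` near `w` in the wall-crossing condition. -/
noncomputable def wallCrossingSum (G : (n : ℕ) → (Fin n → ℂ) → (Fin n → ℂ) → ℂ) {n : ℕ}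
    (w z : Fin n → ℂ) : ℂ :=
  ∑ c : Composition n, if RayBlocks c w then
    G c.length (blockSum c z) (blockSum c w) * ∏ k, blockWeight (blockPart c z k) (blockPart c w k)
  else 0

/-- The functions `G_m( · ; · )` express `F_n` near every point. -/
def ExpressesNear (F : (n : ℕ) → (Fin n → ℂ) → ℂ)
    (G : (n : ℕ) → (Fin n → ℂ) → (Fin n → ℂ) → ℂ) : Prop :=
  ∀ n, 1 ≤ n → ∀ w : Fin n → ℂ, (∀ k, w k ≠ 0) → ∀ᶠ z in 𝓝 w, F n z = wallCrossingSum G w z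

/-- The composition into single entries evaluates G_n( · ; w) on all of N n w, so it is holomorphic
near `w`. -/
theorem WallCrossing.exists_expressesNear {F : (n : ℕ) → (Fin n → ℂ) → ℂ} (hF : WallCrossing F) :
    ∃ G : (n : ℕ) → (Fin n → ℂ) → (Fin n → ℂ) → ℂ, ExpressesNear F G ∧
      ∀ n, 1 ≤ n → ∀ w : Fin n → ℂ, (∀ k, w k ≠ 0) → DifferentiableAt ℂ (fun y => G n y w) w := by
  obtain ⟨N, G, h1, h2⟩ := hF
  refine ⟨G, fun n hn w hw => ?_, fun n hn w hw => ?_⟩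
  · obtain ⟨ho, hm, h⟩ := h1 n hn w hw
    filter_upwards [ho.mem_nhds hm] with z hz
    exact (h z hz).2
  · obtain ⟨ho, hm, -⟩ := h1 n hn w hw
    refine (h2 n hn w hw).differentiableAt (mem_of_superset (ho.mem_nhds hm) fun z hz => ?_)
    exact ⟨n, w, z, Composition.ones n, Composition.ones_length n, hn, hw, hz, rayBlocks_ones hw,
      blockSum_ones z, blockSum_ones w⟩

/-- Where the shorter `G_m` agree, the difference of the `F_n` is the difference of the `G_n`. -/
theorem ExpressesNear.eventually_sub_eq {F F' : (n : ℕ) → (Fin n → ℂ) → ℂ}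
    {G G' : (n : ℕ) → (Fin n → ℂ) → (Fin n → ℂ) → ℂ} (hF : ExpressesNear F G)
    (hF' : ExpressesNear F' G') {n : ℕ} (hn : 1 ≤ n)
    (h : ∀ m, 1 ≤ m → m < n → ∀ u : Fin m → ℂ, (∀ k, u k ≠ 0) → ∀ᶠ y in 𝓝 u, G m y u = G' m y u)
    {w : Fin n → ℂ} (hw : ∀ k, w k ≠ 0) :
    ∀ᶠ z in 𝓝 w, F n z - F' n z = G n z w - G' n z w := by
  classical
  -- Any other composition has fewer than `n` blocks, so its terms cancel near `w`.
  have h1 : ∀ᶠ z in 𝓝 w, ∀ c : Composition n, RayBlocks c w → c ≠ Composition.ones n →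
      G c.length (blockSum c z) (blockSum c w) = G' c.length (blockSum c z) (blockSum c w) := by
    refine eventually_all.mpr fun c => ?_
    by_cases hc : RayBlocks c w ∧ c ≠ Composition.ones n
    · have hlt : c.length < n :=
        c.length_le.lt_of_ne fun he => hc.2 (Composition.eq_ones_iff_length.mpr he)
      have := (continuous_blockSum c).continuousAt.eventually
        (h c.length (c.length_pos_iff.mpr hn) hlt (blockSum c w) (blockSum_ne_zero hw hc.1))
      exact this.mono fun z hz _ _ => hz
    · exact Eventually.of_forall fun z h2 h3 => absurd ⟨h2, h3⟩ hc
  filter_upwards [hF n hn w hw, hF' n hn w hw, h1] with z e1 e2 e3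
  rw [e1, e2, wallCrossingSum, wallCrossingSum, ← Finset.sum_sub_distrib,
    Finset.sum_eq_single (Composition.ones n) (fun c _ hc => ?_)
      (fun h => absurd (Finset.mem_univ _) h)]
  · have hprod : ∏ k, blockWeight (blockPart (Composition.ones n) z k)
        (blockPart (Composition.ones n) w k) = 1 :=
      Finset.prod_eq_one fun k _ => blockWeight_of_eq_one (Composition.ones_blocksFun n k) _ _
    rw [if_pos (rayBlocks_ones hw), if_pos (rayBlocks_ones hw), hprod, mul_one, mul_one,
      funext (blockSum_ones z), funext (blockSum_ones w), apply_fin_cast G, apply_fin_cast G']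
  · by_cases hray : RayBlocks c w
    · rw [if_pos hray, if_pos hray, e3 c hray hc, sub_self]
    · rw [if_neg hray, if_neg hray, sub_self]

/-- In the expression for F_m the term of single entries is G_m with weight 1, so G_m is recovered
recursively from F_m and the shorter functions. -/
theorem ExpressesNear.eventually_eq {F F' : (n : ℕ) → (Fin n → ℂ) → ℂ}
    {G G' : (n : ℕ) → (Fin n → ℂ) → (Fin n → ℂ) → ℂ} (hF : ExpressesNear F G)
    (hF' : ExpressesNear F' G') {n : ℕ}
    (h : ∀ m, 1 ≤ m → m < n → ∀ z : Fin m → ℂ, (∀ k, z k ≠ 0) → F m z = F' m z) :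
    ∀ m, 1 ≤ m → m < n → ∀ u : Fin m → ℂ, (∀ k, u k ≠ 0) → ∀ᶠ y in 𝓝 u, G m y u = G' m y u := by
  intro m
  induction m using Nat.strong_induction_on with
  | _ m ih =>
    intro hm hmn u hu
    have h1 : ∀ᶠ y in 𝓝 u, ∀ k, y k ≠ 0 := by
      refine eventually_all.mpr fun k => ?_
      exact ((continuous_apply k).continuousAt (x := u)).eventually_ne (hu k)
    filter_upwards [h1, hF.eventually_sub_eq hF' hm (fun k hk hkm => ih k hkm hk (hkm.trans hmn)) hu]
      with y e1 e2
    rw [h m hm hmn y e1, sub_self] at e2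
    exact (sub_eq_zero.mp e2.symm)

/-- If two families agree for fewer variables, their difference is holomorphic. -/
theorem differentiableAt_sub_of_wallCrossing {F F' : (n : ℕ) → (Fin n → ℂ) → ℂ}
    (hF : WallCrossing F) (hF' : WallCrossing F') {n : ℕ} (hn : 1 ≤ n)
    (h : ∀ m, 1 ≤ m → m < n → ∀ z : Fin m → ℂ, (∀ k, z k ≠ 0) → F m z = F' m z)
    {w : Fin n → ℂ} (hw : ∀ k, w k ≠ 0) : DifferentiableAt ℂ (fun z => F n z - F' n z) w := by
  obtain ⟨G, h1, hd⟩ := hF.exists_expressesNear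
  obtain ⟨G', h1', hd'⟩ := hF'.exists_expressesNear
  exact ((hd n hn w hw).sub (hd' n hn w hw)).congr_of_eventuallyEq
    (h1.eventually_sub_eq h1' hn (h1.eventually_eq h1' h) hw)

end WallCrossingDifference

/-! ### Uniqueness of the family -/

section Uniqueness
open Set Filter Topology

/-- A function holomorphic on a convex open set and locally constant somewhere is constant. -/
theorem eq_of_differentiableOn_of_eventually_eq {E : Type*} [NormedAddCommGroup E]
    [NormedSpace ℂ E] {f : E → ℂ} {s : Set E} (hs : IsOpen s) (hconv : Convex ℝ s)
    (hf : DifferentiableOn ℂ f s) {p q : E} (hp : p ∈ s) (hq : q ∈ s)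
    (h : ∀ᶠ x in 𝓝 p, f x = f p) : f q = f p := by
  -- Restricting to the complex line through `p` and `q` reduces the claim to the identity theorem
  -- in one variable.
  let γ : ℂ → E := fun t => p + t • (q - p)
  have hγ : Differentiable ℂ γ := by fun_prop
  let T : Set ℂ := γ ⁻¹' s
  have hT : IsOpen T := hs.preimage hγ.continuous
  have hTc : Convex ℝ T := by
    intro a ha b hb α β hα hβ hαβ
    have := hconv ha hb hα hβ hαβ
    have e : γ (α • a + β • b) = α • γ a + β • γ b := by
      have e1 : (α : ℂ) + β = 1 := by exact_mod_cast hαβ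
      simp only [γ, ← Complex.coe_smul, smul_add, smul_smul, smul_eq_mul, add_smul]
      have : p = ((α : ℂ) + β) • p := by rw [e1, one_smul]
      rw [add_add_add_comm, ← add_smul (α : ℂ) β p, ← this]
    change γ _ ∈ s
    rwa [e]
  have h0 : γ 0 = p := by simp [γ]
  have h1 : γ 1 = q := by simp [γ]
  have han : AnalyticOnNhd ℂ (f ∘ γ) T :=
    (hf.comp hγ.differentiableOn (mapsTo_preimage γ s)).analyticOnNhd hT
  have hev : f ∘ γ =ᶠ[𝓝 0] fun _ => f p := by
    have hc : Tendsto γ (𝓝 0) (𝓝 p) := by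
      have := hγ.continuous.tendsto 0
      rwa [h0] at this
    exact hc.eventually h
  have := han.eqOn_of_preconnected_of_eventuallyEq analyticOnNhd_const hTc.isPreconnected
    (show γ 0 ∈ s by rwa [h0]) hev (show γ 1 ∈ s by rwa [h1])
  simpa [h1] using this

/-- The points of the slit domain where no denominator of the differential equation vanishes. -/
def regularDomain (n : ℕ) : Set (Fin n → ℂ) :=
  {z | z ∈ slitDomain n ∧ ∀ k ∈ Finset.Ico 1 n,
    ∑ i, tupleSlice z 0 k i ≠ 0 ∧ ∑ i, tupleSlice z k (n - k) i ≠ 0}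

theorem continuous_sum_tupleSlice {n : ℕ} (a m : ℕ) :
    Continuous fun z : Fin n → ℂ => ∑ i, tupleSlice z a m i := by
  refine continuous_finsetSum _ fun i _ => ?_
  unfold tupleSlice
  split
  · exact continuous_apply _
  · exact continuous_const

theorem isOpen_regularDomain (n : ℕ) : IsOpen (regularDomain n) := by
  have : regularDomain n = slitDomain n ∩ ⋂ k ∈ Finset.Ico 1 n,
      ({z | ∑ i, tupleSlice z 0 k i ≠ 0} ∩ {z | ∑ i, tupleSlice z k (n - k) i ≠ 0}) := by
    ext z
    simp [regularDomain]
  rw [this]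
  refine (isOpen_slitDomain n).inter (isOpen_biInter_finset fun k _ => ?_)
  exact ((isOpen_ne_fun (continuous_sum_tupleSlice 0 k) continuous_const)).inter
    (isOpen_ne_fun (continuous_sum_tupleSlice k (n - k)) continuous_const)

theorem eventually_quadratic_ne_zero {a b c : ℝ} (h : b ≠ 0 ∨ c ≠ 0) :
    ∀ᶠ t in 𝓝[>] (0 : ℝ), a + b * t + c * t ^ 2 ≠ 0 := by
  have hcont : ∀ a b : ℝ, a ≠ 0 → ∀ᶠ t in 𝓝[>] (0 : ℝ), a + b * t + c * t ^ 2 ≠ 0 := by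
    intro a b ha
    have hc : ContinuousAt (fun t : ℝ => a + b * t + c * t ^ 2) 0 := by fun_prop
    exact nhdsWithin_le_nhds (hc.eventually_ne (by simpa using ha))
  have hpos : ∀ᶠ t in 𝓝[>] (0 : ℝ), 0 < t := self_mem_nhdsWithin
  rcases ne_or_eq a 0 with ha | rfl
  · exact hcont a b ha
  rcases ne_or_eq b 0 with hb | rfl
  · have hc : ContinuousAt (fun t : ℝ => b + c * t) 0 := by fun_prop
    have : ∀ᶠ t in 𝓝[>] (0 : ℝ), b + c * t ≠ 0 :=
      nhdsWithin_le_nhds (hc.eventually_ne (by simpa using hb))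
    filter_upwards [hpos, this] with t h1 h2
    have e : 0 + b * t + c * t ^ 2 = t * (b + c * t) := by ring
    rw [e]
    exact mul_ne_zero h1.ne' h2
  · have hc : c ≠ 0 := by simpa using h
    filter_upwards [hpos] with t h1
    have e : 0 + 0 * t + c * t ^ 2 = c * t ^ 2 := by ring
    rw [e]
    exact mul_ne_zero hc (pow_ne_zero 2 h1.ne')

theorem not_sameRay_of_cross_ne_zero {a b : ℂ} (h : a.re * b.im - a.im * b.re ≠ 0) :
    ¬ SameRay ℝ a b := by
  intro hr
  apply h
  rcases eq_or_ne a 0 with rfl | ha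
  · simp
  rcases eq_or_ne b 0 with rfl | hb
  · simp
  obtain ⟨r, -, rfl⟩ := hr.exists_pos_left ha hb
  simp
  ring

/-- Regular points exist in every neighbourhood. -/
theorem exists_mem_regularDomain {n : ℕ} {w : Fin n → ℂ} (hw : ∀ i, w i ≠ 0)
    {s : Set (Fin n → ℂ)} (hs : s ∈ 𝓝 w) : ∃ z ∈ s, z ∈ regularDomain n := by
  -- Consecutive directions have cross product 1, so the cross product along the perturbed path is a
  -- nonzero quadratic in `t`. All directions have real part 1, so the real part of a block sum
  -- grows linearly.
  let v : Fin n → ℂ := fun k => 1 + (k : ℕ) * Complex.I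
  let γ : ℝ → Fin n → ℂ := fun t k => w k + t * v k
  have hγ : Tendsto γ (𝓝[>] 0) (𝓝 w) := by
    have h1 : Continuous γ := by fun_prop
    have h2 := (h1.tendsto 0).mono_left (nhdsWithin_le_nhds (s := Ioi 0))
    have h3 : γ 0 = w := by ext k; simp [γ]
    rwa [h3] at h2
  have h0 : ∀ᶠ t in 𝓝[>] (0 : ℝ), ∀ i, γ t i ≠ 0 := by
    refine eventually_all.mpr fun k => hγ.eventually (p := fun z => z k ≠ 0) ?_
    exact ((continuous_apply k).continuousAt (x := w)).eventually_ne (hw k)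
  have h1 : ∀ᶠ t in 𝓝[>] (0 : ℝ), ∀ k : Fin n, ∀ hk : (k : ℕ) + 1 < n,
      ¬ SameRay ℝ (γ t k) (γ t ⟨k + 1, hk⟩) := by
    refine eventually_all.mpr fun k => ?_
    by_cases hk : (k : ℕ) + 1 < n
    · let a := w k
      let b := w ⟨k + 1, hk⟩
      have := eventually_quadratic_ne_zero (a := a.re * b.im - a.im * b.re)
        (b := a.re * (k + 1) + b.im - a.im - k * b.re) (c := 1) (Or.inr one_ne_zero)
      refine this.mono fun t ht _ => not_sameRay_of_cross_ne_zero ?_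
      convert ht using 1
      simp [γ, v, a, b]
      ring
    · exact Eventually.of_forall fun _ h => absurd h hk
  have hsum : ∀ a m : ℕ, 1 ≤ m → a + m ≤ n →
      ∀ᶠ t in 𝓝[>] (0 : ℝ), ∑ i, tupleSlice (γ t) a m i ≠ 0 := by
    intro a m hm ham
    have := eventually_quadratic_ne_zero (a := (∑ i, tupleSlice w a m i).re) (b := m) (c := 0)
      (Or.inl (by exact_mod_cast (by omega : m ≠ 0)))
    refine this.mono fun t ht he => ht ?_
    have h2 := congrArg Complex.re he
    have h3 : ∀ i : Fin m, (tupleSlice (γ t) a m i).re = (tupleSlice w a m i).re + t := fun i => by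
      have hi : a + (i : ℕ) < n := by omega
      simp [tupleSlice, hi, γ, v]
    rw [Complex.re_sum] at h2 ⊢
    simp only [h3, Finset.sum_add_distrib, Finset.sum_const, Finset.card_univ, Fintype.card_fin,
      nsmul_eq_mul, Complex.zero_re] at h2
    rw [zero_mul, add_zero]
    exact h2
  have h2 : ∀ᶠ t in 𝓝[>] (0 : ℝ), ∀ k ∈ Finset.Ico 1 n,
      ∑ i, tupleSlice (γ t) 0 k i ≠ 0 ∧ ∑ i, tupleSlice (γ t) k (n - k) i ≠ 0 := by
    refine (Filter.eventually_all_finset _).mpr fun k hk => ?_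
    obtain ⟨hk1, hk2⟩ := Finset.mem_Ico.mp hk
    exact (hsum 0 k hk1 (by omega)).and (hsum k (n - k) (by omega) (by omega))
  obtain ⟨t, ⟨e1, e2⟩, e3, e4⟩ := ((h0.and h1).and (h2.and (hγ.eventually hs))).exists
  exact ⟨γ t, e4, mem_slitDomain_iff.mpr ⟨e1, fun k hk => e2 ⟨k, by omega⟩ hk⟩, e3⟩

/-- A function holomorphic at all tuples of nonzero numbers whose derivative vanishes on the
regular domain is constant. -/
theorem eq_of_fderiv_eq_zero_regularDomain {n : ℕ} {f : (Fin n → ℂ) → ℂ}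
    (hf : ∀ z, (∀ i, z i ≠ 0) → DifferentiableAt ℂ f z)
    (h : ∀ z ∈ regularDomain n, fderiv ℂ f z = 0) {z z' : Fin n → ℂ} (hz : ∀ i, z i ≠ 0)
    (hz' : ∀ i, z' i ≠ 0) : f z = f z' := by
  have hloc : ∀ w : Fin n → ℂ, (∀ i, w i ≠ 0) → ∀ᶠ y in 𝓝 w, f y = f w := by
    intro w hw
    have h1 : ∀ᶠ y in 𝓝 w, ∀ i, y i ≠ 0 := by
      refine eventually_all.mpr fun k => ?_
      exact ((continuous_apply k).continuousAt (x := w)).eventually_ne (hw k)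
    obtain ⟨r, hr, hball⟩ := Metric.eventually_nhds_iff_ball.mp h1
    -- The function is constant near a regular point `p`, and the identity theorem extends this to
    -- the whole ball.
    obtain ⟨p, hp, hpr⟩ := exists_mem_regularDomain hw (Metric.ball_mem_nhds w hr)
    have hp1 : ∀ᶠ x in 𝓝 p, f x = f p := by
      obtain ⟨r', hr', hball'⟩ := Metric.isOpen_iff.mp (isOpen_regularDomain n) p hpr
      filter_upwards [Metric.ball_mem_nhds p hr'] with x hx
      exact Metric.isOpen_ball.is_const_of_fderiv_eq_zero (convex_ball p r').isPreconnected
        (fun y hy => (hf y (hball' hy).1.1).differentiableWithinAt) (fun y hy => h y (hball' hy))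
        hx (Metric.mem_ball_self hr')
    have key : ∀ q ∈ Metric.ball w r, f q = f p := fun q hq =>
      eq_of_differentiableOn_of_eventually_eq Metric.isOpen_ball (convex_ball w r)
        (fun y hy => (hf y (hball y hy)).differentiableWithinAt) hp hq hp1
    filter_upwards [Metric.ball_mem_nhds w hr] with y hy
    rw [key y hy, key w (Metric.mem_ball_self hr)]
  have hconn : IsPreconnected (pi univ fun _ : Fin n => ({0}ᶜ : Set ℂ)) :=
    isPreconnected_univ_pi fun _ => (isConnected_compl_singleton_of_one_lt_rank (by
      rw [Complex.rank_real_complex]; exact Nat.one_lt_ofNat) 0).isPreconnected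
  refine hconn.induction₂ (fun x y => f x = f y) (fun x hx => ?_) (fun _ _ _ _ _ _ => Eq.trans)
    (fun _ _ _ _ => Eq.symm) (fun i _ => hz i) (fun i _ => hz' i)
  exact ((hloc x fun i => hx i (mem_univ i)).filter_mono nhdsWithin_le_nhds).mono
    fun y hy => hy.symm

/-- For `n ≥ 2` the slit domain contains a point with vanishing sum. -/
theorem exists_mem_slitDomain_sum_eq_zero {n : ℕ} (hn : 2 ≤ n) :
    ∃ z ∈ slitDomain n, ∑ i, z i = 0 := by
  -- The n-th roots of unity in cyclic order sum to zero, and the ratio of neighbours is a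
  -- nontrivial root of unity, hence not a positive real.
  have hζ := Complex.isPrimitiveRoot_exp n (by omega)
  set ζ := Complex.exp (2 * Real.pi * Complex.I / n) with hζdef
  have hζ0 : ζ ≠ 0 := Complex.exp_ne_zero _
  refine ⟨fun i => ζ ^ (i : ℕ), ⟨fun k => pow_ne_zero _ hζ0, ?_⟩, ?_⟩
  · rintro k hk ⟨r, hr, he⟩
    simp only at he
    rw [pow_succ, mul_div_cancel_left₀ _ (pow_ne_zero _ hζ0)] at he
    have h1 : ‖ζ‖ = 1 := hζ.norm'_eq_one (by omega)
    rw [he, Complex.norm_real, Real.norm_of_nonneg hr.le] at h1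
    rw [h1, Complex.ofReal_one] at he
    exact hζ.ne_one (by omega) he
  · rw [Fin.sum_univ_eq_sum_range fun i => ζ ^ i]
    exact hζ.geom_sum_eq_zero (by omega)

theorem fderiv_eq_of_regularDomain {F F' : (n : ℕ) → (Fin n → ℂ) → ℂ} (hF : IsJoyceFamily F)
    (hF' : IsJoyceFamily F') {n : ℕ} (hn : 1 ≤ n)
    (h : ∀ m, 1 ≤ m → m < n → ∀ z : Fin m → ℂ, (∀ k, z k ≠ 0) → F m z = F' m z)
    {z : Fin n → ℂ} (hz : z ∈ regularDomain n) : fderiv ℂ (F n) z = fderiv ℂ (F' n) z := by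
  ext1 v
  rw [hF.pde n hn z hz.1 hz.2, hF'.pde n hn z hz.1 hz.2]
  refine Finset.sum_congr rfl fun k hk => ?_
  obtain ⟨hk1, hk2⟩ := Finset.mem_Ico.mp hk
  rw [h k hk1 hk2 _ (tupleSlice_zero_mem_slitDomain hz.1 hk2.le).1,
    h (n - k) (by omega) (by omega) _ (tupleSlice_mem_slitDomain hz.1 hk2.le).1]

/-- The family `F_n` is unique. -/
theorem IsJoyceFamily.eq {F F' : (n : ℕ) → (Fin n → ℂ) → ℂ} (hF : IsJoyceFamily F)
    (hF' : IsJoyceFamily F') : ∀ n, 1 ≤ n → ∀ z : Fin n → ℂ, (∀ k, z k ≠ 0) → F n z = F' n z := by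
  intro n
  induction n using Nat.strong_induction_on with
  | _ n ih =>
    intro hn z hz
    rcases hn.eq_or_lt with rfl | hn2
    · rw [hF.one z (hz 0), hF'.one z (hz 0)]
    have ih' : ∀ m, 1 ≤ m → m < n → ∀ z : Fin m → ℂ, (∀ k, z k ≠ 0) → F m z = F' m z :=
      fun m hm hmn => ih m hmn hm
    obtain ⟨y, hy, hsum⟩ := exists_mem_slitDomain_sum_eq_zero hn2
    -- The difference is constant, and `y` is a point where both functions vanish.
    have key := eq_of_fderiv_eq_zero_regularDomain (f := fun z => F n z - F' n z)
      (fun w hw => differentiableAt_sub_of_wallCrossing hF.wallCrossing hF'.wallCrossing hn ih' hw)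
      (fun w hw => ?_) hz hy.1
    · rw [hF.vanishing n hn2 y hy hsum, hF'.vanishing n hn2 y hy hsum, sub_self] at key
      exact sub_eq_zero.mp key
    · have hnhds := (isOpen_slitDomain n).mem_nhds hw.1
      rw [fderiv_fun_sub ((hF.holomorphic n hn).differentiableAt hnhds)
        ((hF'.holomorphic n hn).differentiableAt hnhds),
        fderiv_eq_of_regularDomain hF hF' hn ih' hw, sub_self]

end Uniqueness

/-! ### Generating functions over the positive cone -/

section GeneratingFunction
open Set

section Cone

variable {A : Type*} [Category A] [Abelian A] {K : Type*} [AddCommGroup K]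
  (κ : GrothendieckQuotient A K)

theorem GrothendieckQuotient.add_mem_positiveCone {α β : K} (hα : α ∈ κ.positiveCone)
    (hβ : β ∈ κ.positiveCone) : α + β ∈ κ.positiveCone := by
  obtain ⟨U, hU, rfl⟩ := hα
  obtain ⟨V, -, rfl⟩ := hβ
  exact ⟨U ⊞ V, fun h => hU ((Limits.biprod_isZero_iff U V).mp h).1,
    κ.additive _ (ShortComplex.Splitting.ofHasBinaryBiproduct U V).shortExact⟩

theorem GrothendieckQuotient.zero_notMem_positiveCone : (0 : K) ∉ κ.positiveCone := by
  rintro ⟨U, hU, h⟩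
  exact hU (κ.isZero_of_cls_eq_zero U h)

end Cone

variable {K : Type*} [AddCommGroup K] {C : Set K}

/-- The proper partial sums of a decomposition are first summands of decompositions into two parts,
and they are distinct because 0 is not in `C`. This bounds the length, and every entry is such a
summand or `α` itself. -/
theorem finite_decompositions (hadd : ∀ α ∈ C, ∀ β ∈ C, α + β ∈ C) (h0 : (0 : K) ∉ C) {α : K}
    (hfin : {p : K × K | p.1 ∈ C ∧ p.2 ∈ C ∧ α = p.1 + p.2}.Finite) :
    (decompositions C α).Finite := by
  classical
  have hsum : ∀ {ι : Type} (s : Finset ι) (f : ι → K), s.Nonempty → (∀ i, f i ∈ C) →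
      ∑ i ∈ s, f i ∈ C := fun s f hs hf =>
    Finset.sum_induction_nonempty f (· ∈ C) (fun a b ha hb => hadd a ha b hb) hs fun i _ => hf i
  set P : Finset K := (hfin.image Prod.fst).toFinset with hP
  have hmemP : ∀ β γ, β ∈ C → γ ∈ C → α = β + γ → β ∈ P := fun β γ hβ hγ h => by
    rw [hP, Set.Finite.mem_toFinset]
    exact ⟨(β, γ), ⟨hβ, hγ, h⟩, rfl⟩
  have hpi : ∀ n, {f : Fin n → K | ∀ i, f i ∈ insert α P}.Finite := fun n => by
    have := Set.Finite.pi' (fun _ : Fin n => (insert α P).finite_toSet)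
    simpa using this
  refine ((Finset.range (P.card + 2)).finite_toSet.biUnion fun n _ =>
    (hpi n).image (Sigma.mk n)).subset ?_
  rintro ⟨n, f⟩ ⟨hn : 1 ≤ n, hf : ∀ i, f i ∈ C, hα : ∑ i, f i = α⟩
  refine mem_iUnion₂.mpr ⟨n, ?_, f, fun i => ?_, rfl⟩
  · obtain ⟨m, rfl⟩ : ∃ m, n = m + 1 := ⟨n - 1, by omega⟩
    have hle : (Finset.univ : Finset (Fin m)).card ≤ P.card := by
      refine Finset.card_le_card_of_injOn (fun k => ∑ i ∈ Finset.Iic k.castSucc, f i)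
        (fun k _ => ?_) (fun k _ l _ hkl => ?_)
      · refine hmemP _ (∑ i ∈ Finset.Ioi k.castSucc, f i) (hsum _ _ ⟨k.castSucc, by simp⟩ hf)
          (hsum _ _ ⟨Fin.last m, by simp [Fin.castSucc_lt_last]⟩ hf) ?_
        rw [← hα, ← Finset.sum_union]
        · refine Finset.sum_congr ?_ fun _ _ => rfl
          ext i
          simp [le_or_gt]
        · rw [Finset.disjoint_left]
          intro i h1 h2
          exact absurd (Finset.mem_Iic.mp h1) (not_le.mpr (Finset.mem_Ioi.mp h2))
      · have key : ∀ k l : Fin m, k < l →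
            ∑ i ∈ Finset.Iic k.castSucc, f i ≠ ∑ i ∈ Finset.Iic l.castSucc, f i := by
          intro k l hlt he
          have h1 : Finset.Iic l.castSucc = Finset.Iic k.castSucc ∪ Finset.Ioc k.castSucc l.castSucc := by
            ext i
            simp only [Finset.mem_Iic, Finset.mem_union, Finset.mem_Ioc]
            constructor
            · intro h
              exact (le_or_gt i k.castSucc).imp id fun h' => ⟨h', h⟩
            · rintro (h | h)
              · exact h.trans (Fin.castSucc_le_castSucc_iff.mpr hlt.le)
              · exact h.2
          rw [h1, Finset.sum_union (by
            rw [Finset.disjoint_left]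
            intro i h1 h2
            exact absurd (Finset.mem_Iic.mp h1) (not_le.mpr (Finset.mem_Ioc.mp h2).1))] at he
          refine h0 ?_
          rw [← left_eq_add.mp he]
          exact hsum _ _ ⟨l.castSucc, Finset.mem_Ioc.mpr
            ⟨Fin.castSucc_lt_castSucc_iff.mpr hlt, le_rfl⟩⟩ hf
        rcases lt_trichotomy k l with h | h | h
        · exact absurd hkl (key k l h)
        · exact h
        · exact absurd hkl.symm (key l k h)
    rw [Finset.card_univ, Fintype.card_fin] at hle
    simp only [Finset.coe_range, mem_Iio]
    omega
  · have h1 := Finset.add_sum_erase Finset.univ f (Finset.mem_univ i)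
    rcases (Finset.univ.erase i).eq_empty_or_nonempty with he | he
    · rw [he, Finset.sum_empty, add_zero, hα] at h1
      rw [h1]
      exact Finset.mem_insert_self _ _
    · exact Finset.mem_insert_of_mem (hmemP _ _ (hf i) (hsum _ f he hf) (by rw [h1, hα]))

variable {H : Type*} [Ring H] [Algebra ℂ H]

/-- The generating function as a sum of symmetrised products. -/
theorem generatingFunction_eq_sum_symmetrizedProduct (F : (n : ℕ) → (Fin n → ℂ) → ℂ) {α : K}
    (hfin : (decompositions C α).Finite) (ε : (K →+ ℂ) → K → H) (Z : K →+ ℂ) :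
    generatingFunction F C ε α Z = ∑ p ∈ hfin.toFinset, (p.1.factorial : ℂ)⁻¹ •
      symmetrizedProduct F (fun i => Z (p.2 i)) (fun i => ε Z (p.2 i)) := by
  rw [generatingFunction, finsum_mem_eq_finite_toFinset_sum _ hfin]
  let t : (Σ n, Fin n → K) → H := fun p =>
    F p.1 (fun i => Z (p.2 i)) • (List.ofFn fun i => ε Z (p.2 i)).prod
  have h1 : ∀ p : Σ n, Fin n → K,
      t p = ∑ _σ : Equiv.Perm (Fin p.1), (p.1.factorial : ℂ)⁻¹ • t p := fun p => by
    have : (p.1.factorial : ℂ) ≠ 0 := by exact_mod_cast p.1.factorial_ne_zero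
    rw [Finset.sum_const, Finset.card_univ, Fintype.card_perm, Fintype.card_fin,
      ← Nat.cast_smul_eq_nsmul ℂ, smul_smul, mul_inv_cancel₀ this, one_smul]
  have h2 : ∀ p : Σ n, Fin n → K, (p.1.factorial : ℂ)⁻¹ •
      symmetrizedProduct F (fun i => Z (p.2 i)) (fun i => ε Z (p.2 i)) =
      ∑ σ : Equiv.Perm (Fin p.1), (p.1.factorial : ℂ)⁻¹ • t ⟨p.1, p.2 ∘ σ⟩ := fun p => by
    rw [symmetrizedProduct, Finset.smul_sum]
    rfl
  rw [Finset.sum_congr rfl fun p _ => h1 p, Finset.sum_congr rfl fun p _ => h2 p,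
    Finset.sum_sigma', Finset.sum_sigma']
  have hmem : ∀ (p : Σ n, Fin n → K) (σ : Equiv.Perm (Fin p.1)), p ∈ hfin.toFinset →
      (⟨p.1, p.2 ∘ σ⟩ : Σ n, Fin n → K) ∈ hfin.toFinset := by
    intro p σ hp
    rw [Set.Finite.mem_toFinset] at hp ⊢
    exact ⟨hp.1, fun i => hp.2.1 _, (Equiv.sum_comp σ p.2).trans hp.2.2⟩
  -- Permutations act on the decompositions of each length; the map on pairs is an involution, so
  -- tuples with repeated entries need no separate count.
  refine Finset.sum_bij' (fun q _ => ⟨⟨q.1.1, q.1.2 ∘ q.2⟩, q.2⁻¹⟩)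
    (fun q _ => ⟨⟨q.1.1, q.1.2 ∘ q.2⟩, q.2⁻¹⟩) (fun q hq => ?_) (fun q hq => ?_) (fun q _ => ?_)
    (fun q _ => ?_) (fun q _ => ?_)
  · exact Finset.mem_sigma.mpr ⟨hmem _ _ (Finset.mem_sigma.mp hq).1, Finset.mem_univ _⟩
  · exact Finset.mem_sigma.mpr ⟨hmem _ _ (Finset.mem_sigma.mp hq).1, Finset.mem_univ _⟩
  · obtain ⟨⟨n, f⟩, σ⟩ := q
    have : (f ∘ σ) ∘ ⇑(Equiv.symm σ) = f := by ext i; simp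
    simp [this]
  · obtain ⟨⟨n, f⟩, σ⟩ := q
    have : (f ∘ σ) ∘ ⇑(Equiv.symm σ) = f := by ext i; simp
    simp [this]
  · obtain ⟨⟨n, f⟩, σ⟩ := q
    have : (f ∘ σ) ∘ ⇑(Equiv.symm σ) = f := by ext i; simp
    simp [this]

theorem symmetrizedProduct_congr {F F' : (n : ℕ) → (Fin n → ℂ) → ℂ} {n : ℕ} {z : Fin n → ℂ}
    (h : ∀ z : Fin n → ℂ, (∀ k, z k ≠ 0) → F n z = F' n z) (hz : ∀ k, z k ≠ 0) (x : Fin n → H) :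
    symmetrizedProduct F z x = symmetrizedProduct F' z x :=
  Finset.sum_congr rfl fun σ _ => by rw [h _ fun k => hz _]

end GeneratingFunction

/-! ### Existence, Lie property, vanishing sums and generating functions -/

theorem theorem3p13 :
    (∃ F : (n : ℕ) → (Fin n → ℂ) → ℂ, IsJoyceFamily F) ∧
    ∀ F : (n : ℕ) → (Fin n → ℂ) → ℂ, IsJoyceFamily F →
      (∀ n, 1 ≤ n → ∀ z : Fin n → ℂ, (∀ k, z k ≠ 0) →
        symmetrizedProduct F z (FreeAlgebra.ι ℂ : Fin n → FreeAlgebra ℂ (Fin n)) ∈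
          LieSubalgebra.lieSpan ℂ (FreeAlgebra ℂ (Fin n))
            (Set.range (FreeAlgebra.ι ℂ : Fin n → FreeAlgebra ℂ (Fin n)))) ∧
      (∀ n, 2 ≤ n → ∀ z : Fin n → ℂ, (∀ k, z k ≠ 0) →
        ∑ σ : Equiv.Perm (Fin n), F n (fun i => z (σ i)) = 0) ∧
      (∀ (A : Type u) [Category.{v} A] [Abelian A] (K : Type w) [AddCommGroup K]
        (κ : GrothendieckQuotient A K)
        (_ : ∀ α ∈ κ.positiveCone,
          {p : K × K | p.1 ∈ κ.positiveCone ∧ p.2 ∈ κ.positiveCone ∧ α = p.1 + p.2}.Finite)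
        (H : Type x) [Ring H] [Algebra ℂ H] (P : GradedLiePair κ.positiveCone H)
        (Stab : Set (K →+ ℂ)) (_ : Stab ⊆ κ.centralCharges)
        (ε : (K →+ ℂ) → K → H)
        (_ : ∀ Z ∈ Stab, ∀ α ∈ κ.positiveCone, ε Z α ∈ P.liePart α),
        (∀ Z ∈ Stab, ∀ n, 1 ≤ n → ∀ β : Fin n → K, (∀ i, β i ∈ κ.positiveCone) →
          symmetrizedProduct F (fun i => Z (β i)) (fun i => ε Z (β i)) ∈
            LieSubalgebra.lieSpan ℂ H (Set.range fun i => ε Z (β i))) ∧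
        ∀ α ∈ κ.positiveCone,
          (decompositions κ.positiveCone α).Finite ∧
          Set.MapsTo (generatingFunction F κ.positiveCone ε α) Stab (P.liePart α)) := by
  refine ⟨⟨joyceF, isJoyceFamily_joyceF⟩, fun F hF => ?_⟩
  -- By uniqueness all claims for an arbitrary family reduce to `joyceF`.
  have heq := hF.eq isJoyceFamily_joyceF
  refine ⟨fun n hn z hz => ?_, fun n hn z hz => ?_, ?_⟩
  · rw [symmetrizedProduct_congr (heq n hn) hz]
    exact symmetrizedProduct_joyceF_mem_lieSpan hn hz _
  · rw [Finset.sum_congr rfl fun σ _ => heq n (by omega) _ fun k => hz (σ k)]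
    exact sum_perm_joyceF hn hz
  · intro A _ _ K _ κ hfin H _ _ P Stab hStab ε hε
    have hne : ∀ Z ∈ Stab, ∀ β ∈ κ.positiveCone, Z β ≠ 0 := fun Z hZ β hβ h => by
      have := hStab hZ β hβ
      rw [h, Complex.zero_im] at this
      exact this.false
    refine ⟨fun Z hZ n hn β hβ => ?_, fun α hα => ?_⟩
    · rw [symmetrizedProduct_congr (heq n hn) fun k => hne Z hZ _ (hβ k)]
      exact symmetrizedProduct_joyceF_mem_lieSpan hn (fun k => hne Z hZ _ (hβ k)) _
    · have hdec := finite_decompositions (fun β hβ γ hγ => κ.add_mem_positiveCone hβ hγ)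
        κ.zero_notMem_positiveCone (hfin α hα)
      refine ⟨hdec, fun Z hZ => ?_⟩
      rw [generatingFunction_eq_sum_symmetrizedProduct F hdec]
      refine Submodule.sum_mem _ fun p hp => Submodule.smul_mem _ _ ?_
      obtain ⟨hp1, hp2, hp3⟩ := hdec.mem_toFinset.mp hp
      rw [symmetrizedProduct_congr (heq p.1 hp1) fun k => hne Z hZ _ (hp2 k), ← hp3]
      -- The graded pieces of the Lie subalgebra form the commutator-closed family, so each
      -- symmetrised product lies in the piece of degree `α`.
      exact symmetrizedProduct_joyceF_mem
        ⟨fun β hβ γ hγ => κ.add_mem_positiveCone hβ hγ, P.bracket_mem⟩ hp1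
        (fun k => hne Z hZ _ (hp2 k)) hp2 fun i => hε Z hZ _ (hp2 i)
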